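/- Let $\Sigma\subset\mathbb R^3$ be a connected embedded surface of class $C^2$ which is orientable, complete (for its intrinsic distance), non-compact, not totally geodesic, and whose second fundamental form $B$ tends to zero at infinity. Fix a unit normal field on $\Sigma$, let $H$ be the mean curvature (the trace of $B$) and $\kappa$ the Gauss curvature, and let $B(R)$ denote the intrinsic ball of radius $R$ about a fixed point $p\in\Sigma$. By a compact domain $D$ of $\Sigma$ we mean a non-empty connected open subset of $\Sigma$ with compact closure in $\Sigma$, and $\partial D$ is its boundary in $\Sigma$. Assume: 1. There is $\delta_1>0$ such that $(\operatorname{length}(\partial D))^2\ge \delta_1\operatorname{Area}(D)$ for every compact domain $D$ of $\Sigma$ (length and area are one- and two-dimensional Hausdorff measure). 2. There are $\delta_2,\delta_3,A>0$ such that for every compact set $K\subset\Sigma$ there is a closed curve $C\subset\Sigma\setminus K$ (a finite disjoint union of simple closed $C^1$ curves) which is the boundary of a compact domain $D$ of $\Sigma$, and a unit vector $\vec\eta\in\mathbb R^3$ (which may depend on $K$), such that the unit normal vector $\vec\gamma$ of $C$ in $\Sigma$ pointing out of $D$ satisfies $\langle\vec\gamma,\vec\eta\rangle\ge\delta_2$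 along $C$, and such that $C$ is tamed with the constants $\delta_3,A$: the geodesic flow $\sigma(t,x)$ of $\vec\gamma$ (for each $x \in C$, $t\mapsto\sigma(t,x)$ is a geodesic of $\Sigma$ with $\sigma(0,x)=x$ and initial velocity $\vec\gamma(x)$) is defined for $|t|<\delta_3$; the map $C\times(-\delta_3,\delta_3)\to\Sigma$, $(x,t)\mapsto\sigma(t,x)$, is a $C^1$ diffeomorphism onto its image; and the differentials of this map and of its inverse have norm at most $A$. 3. $\int_\Sigma|\kappa|\,d\Sigma<\infty$. Then there is $\epsilon_0>0$ such that for every $R>0$ there is a function $j\in C_0^\infty(\Sigma\setminus B(R))$ (the restriction to $\Sigma$ of a smooth function on $\mathbb R^3$, with compact support in $\Sigma\setminus B(R)$) with $$\left(\int_\Sigma Hj\,d\Sigma\right)^2>\epsilon_0\int_\Sigma\left(|\nabla j|^2+j^2\right)d\Sigma .$$ -/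

import Mathlib

open Set Filter Topology MeasureTheory
open scoped ContDiff ENNReal

noncomputable section

namespace QuantumLayer

/-- Euclidean three-space. -/
abbrev E3 := EuclideanSpace ℝ (Fin 3)

/-! ### Surfaces of class `C²` embedded in `ℝ³` -/

/-- `S` is an embedded (not necessarily closed) `C²` surface in `ℝ³`: near each of its points a
`C²` diffeomorphism between open subsets of `ℝ³` straightens `S` to the plane `{x₂ = 0}`. -/
def IsC2Surface (S : Set E3) : Prop :=
  ∀ x ∈ S, ∃ Φ : OpenPartialHomeomorph E3 E3, x ∈ Φ.source ∧
    ContDiffOn ℝ 2 Φ Φ.source ∧ ContDiffOn ℝ 2 Φ.symm Φ.target ∧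
    ∀ y ∈ Φ.source, (y ∈ S ↔ Φ y 2 = 0)

/-- `v` is tangent to `S` at `x`: it is the velocity at `x` of a curve in `S`. -/
def IsTangent (S : Set E3) (x v : E3) : Prop :=
  ∃ c : ℝ → E3, c 0 = x ∧ HasDerivAt c v 0 ∧ ∀ᶠ t in 𝓝 (0 : ℝ), c t ∈ S

/-- A continuous unit normal field along `S` (only the values on `S` matter). Its existence
expresses that `S` is orientable. -/
structure IsUnitNormal (S : Set E3) (N : E3 → E3) : Prop where
  continuousOn : ContinuousOn N S
  norm_eq_one : ∀ x ∈ S, ‖N x‖ = 1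
  orthogonal : ∀ x ∈ S, ∀ v, IsTangent S x v → inner ℝ (N x) v = 0

/-- The tangent plane at `x` of a surface with unit normal field `N`. -/
abbrev tangentPlane (N : E3 → E3) (x : E3) : Submodule ℝ E3 := (Submodule.span ℝ {N x})ᗮ

/-- The shape operator `v ↦ -dN(v)` on the tangent plane at `x`. The second fundamental form is
`B(v, w) = ⟪shapeOperator v, w⟫`, so the operator norm of the shape operator is `‖B‖`. The derivative
of `N` is taken along `S`; in tangent directions it does not depend on an extension of `N`. -/
def shapeOperator (S : Set E3) (N : E3 → E3) (x : E3) :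
    tangentPlane N x →L[ℝ] tangentPlane N x :=
  (tangentPlane N x).orthogonalProjectionOnto ∘L (-fderivWithin ℝ N S x) ∘L
    (tangentPlane N x).subtypeL

/-- The mean curvature: the trace of the second fundamental form. -/
def meanCurvature (S : Set E3) (N : E3 → E3) (x : E3) : ℝ :=
  LinearMap.trace ℝ (tangentPlane N x) (shapeOperator S N x).toLinearMap

/-- The Gauss curvature. -/
def gaussCurvature (S : Set E3) (N : E3 → E3) (x : E3) : ℝ :=
  LinearMap.det (shapeOperator S N x).toLinearMap

/-- The second fundamental form tends to zero at infinity. -/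
def AsymptoticallyFlat (S : Set E3) (N : E3 → E3) : Prop :=
  ∀ ε > 0, ∃ K ⊆ S, IsCompact K ∧ ∀ x ∈ S \ K, ‖shapeOperator S N x‖ < ε

/-- The squared length of the gradient along the surface of the restriction of `j`, computed as the
squared norm of the differential restricted to the tangent plane. -/
def gradNormSq (N : E3 → E3) (j : E3 → ℝ) (x : E3) : ℝ :=
  ‖fderiv ℝ j x ∘L (tangentPlane N x).subtypeL‖ ^ 2

/-- Integration over the surface: the area measure is the (normalised) two-dimensional Hausdorff
measure, restricted to `S`. -/
abbrev areaMeasure (S : Set E3) : Measure E3 := (μHE[2] : Measure E3).restrict S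

/-! ### The intrinsic distance and completeness -/

/-- The intrinsic (Riemannian) distance of `S`: the infimum of the lengths of paths in `S`. -/
def intrinsicDist (S : Set E3) (x y : E3) : ℝ≥0∞ :=
  ⨅ (c : ℝ → E3) (_ : ContinuousOn c (Icc 0 1) ∧ MapsTo c (Icc 0 1) S ∧ c 0 = x ∧ c 1 = y),
    eVariationOn c (Icc 0 1)

/-- The surface is complete for its intrinsic distance. -/
def IsCompleteSurface (S : Set E3) : Prop :=
  ∀ u : ℕ → E3, (∀ n, u n ∈ S) →
    (∀ ε > 0, ∃ n₀, ∀ m ≥ n₀, ∀ n ≥ n₀, intrinsicDist S (u m) (u n) < ε) →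
    ∃ x ∈ S, Tendsto (fun n => intrinsicDist S (u n) x) atTop (𝓝 0)

/-! ### Domains and the isoperimetric inequality -/

/-- A compact domain of `S`, given by its interior `D`: a connected, relatively open subset of `S`
whose closure is a compact subset of `S`. -/
structure IsCompactDomain (S D : Set E3) : Prop where
  connected : IsConnected D
  isOpen : ∃ U, IsOpen U ∧ D = U ∩ S
  isCompact_closure : IsCompact (closure D)
  closure_subset : closure D ⊆ S

/-- The boundary in `S` of a domain of `S`. -/
def bdry (D : Set E3) : Set E3 := closure D \ D

/-- `length(∂D)² ≥ δ₁ · Area(D)` for all compact domains `D` of `S`. -/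
def IsoperimetricInequality (S : Set E3) (δ₁ : ℝ) : Prop :=
  ∀ D, IsCompactDomain S D →
    ENNReal.ofReal δ₁ * (μHE[2] : Measure E3) D ≤ ((μHE[1] : Measure E3) (bdry D)) ^ 2

/-! ### Tamed curves -/

/-- `c` is a geodesic of `S` on the interval `(-δ, δ)`: a `C²` curve in `S` whose acceleration is
normal to `S`. -/
def IsGeodesicOn (S : Set E3) (δ : ℝ) (c : ℝ → E3) : Prop :=
  ContDiffOn ℝ 2 c (Ioo (-δ) δ) ∧ ∀ t ∈ Ioo (-δ) δ, c t ∈ S ∧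
    ∀ v, IsTangent S (c t) v → inner ℝ (deriv (deriv c) t) v = 0

/-- The `c i` are arc length parametrisations, with periods `L i`, of finitely many disjoint simple
closed `C¹` curves with union `C`. -/
structure IsClosedCurve {m : ℕ} (C : Set E3) (L : Fin m → ℝ) (c : Fin m → ℝ → E3) : Prop where
  period_pos : ∀ i, 0 < L i
  contDiff : ∀ i, ContDiff ℝ 1 (c i)
  unitSpeed : ∀ i s, ‖deriv (c i) s‖ = 1
  periodic : ∀ i, Function.Periodic (c i) (L i)
  simple : ∀ i s i' s', c i s = c i' s' → i = i' ∧ ∃ k : ℤ, s - s' = k * L i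
  union_eq : C = ⋃ i, range (c i)

/-- `γ` is a unit normal vector field in `S` of the curve parametrised by the `c i`. -/
def IsConormal (S : Set E3) {m : ℕ} (c : Fin m → ℝ → E3) (γ : E3 → E3) : Prop :=
  ∀ i s, IsTangent S (c i s) (γ (c i s)) ∧ ‖γ (c i s)‖ = 1 ∧
    inner ℝ (γ (c i s)) (deriv (c i) s) = 0

/-- The curve `C` with unit normal `γ` is tamed with constants `δ₃, A`, where `σ x t` is the
geodesic flow of `γ`: it is defined for `|t| < δ₃`, is a (`C¹`) diffeomorphism from `C × (-δ₃, δ₃)`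
onto its image, and its differential and the inverse of the latter have norm at most `A`. The
coordinates on `C × (-δ₃, δ₃)` are arc length `s` on `C`, and `t`. -/
structure IsTamed (S C : Set E3) {m : ℕ} (c : Fin m → ℝ → E3) (γ : E3 → E3) (σ : E3 → ℝ → E3)
    (δ₃ A : ℝ) : Prop where
  geodesic : ∀ x ∈ C, σ x 0 = x ∧ deriv (σ x) 0 = γ x ∧ IsGeodesicOn S δ₃ (σ x)
  injective : ∀ x ∈ C, ∀ x' ∈ C, ∀ t ∈ Ioo (-δ₃) δ₃, ∀ t' ∈ Ioo (-δ₃) δ₃,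
    σ x t = σ x' t' → x = x' ∧ t = t'
  contDiffOn : ∀ i, ContDiffOn ℝ 1 (fun q : ℝ × ℝ => σ (c i q.1) q.2) (univ ×ˢ Ioo (-δ₃) δ₃)
  deriv_le : ∀ i s, ∀ t ∈ Ioo (-δ₃) δ₃, ∀ a b : ℝ,
    ‖fderiv ℝ (fun q : ℝ × ℝ => σ (c i q.1) q.2) (s, t) (a, b)‖ ≤ A * √(a ^ 2 + b ^ 2)
  inv_deriv_le : ∀ i s, ∀ t ∈ Ioo (-δ₃) δ₃, ∀ a b : ℝ,
    √(a ^ 2 + b ^ 2) ≤ A * ‖fderiv ℝ (fun q : ℝ × ℝ => σ (c i q.1) q.2) (s, t) (a, b)‖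

/-- There are constants `δ₂, δ₃, A > 0` such that outside each compact subset `K` of `S` there is a
closed curve `C` bounding a compact domain `D` of `S`, which is tamed with constants `δ₃, A`
and whose unit normal `γ` in `S`, pointing out of `D`, satisfies `⟪γ, η⟫ ≥ δ₂` along `C` for some
unit vector `η` of `ℝ³`. -/
def HasTamedCurvesAtInfinity (S : Set E3) : Prop :=
  ∃ δ₂ > 0, ∃ δ₃ > 0, ∃ A > 0, ∀ K ⊆ S, IsCompact K →
    ∃ (D C : Set E3) (m : ℕ) (L : Fin m → ℝ) (c : Fin m → ℝ → E3) (γ : E3 → E3)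
      (σ : E3 → ℝ → E3) (η : E3),
      IsCompactDomain S D ∧ bdry D = C ∧ C ⊆ S \ K ∧
      IsClosedCurve C L c ∧ IsConormal S c γ ∧ IsTamed S C c γ σ δ₃ A ∧
      (∀ x ∈ C, (∀ᶠ t in 𝓝[<] 0, σ x t ∈ D) ∧ ∀ᶠ t in 𝓝[>] 0, σ x t ∉ D) ∧
      ‖η‖ = 1 ∧ ∀ x ∈ C, δ₂ ≤ inner ℝ (γ x) η

/-! ### The condition in the conclusion -/

/-- The restriction of `j` to `S` is a smooth function with compact support in `S \ B(R)`, where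
`B(R)` is the closed intrinsic ball of radius `R` around `p`. Smooth functions of compact support on
`S` are the restrictions of smooth functions on `ℝ³`. -/
def IsTestFunctionOutside (S : Set E3) (p : E3) (R : ℝ) (j : E3 → ℝ) : Prop :=
  ContDiff ℝ ∞ j ∧ ∃ K ⊆ S, IsCompact K ∧ (∀ x ∈ K, ENNReal.ofReal R < intrinsicDist S p x) ∧
    ∀ x ∈ S, j x ≠ 0 → x ∈ K

/-- There is `ε₀ > 0` such that for every `R > 0` there is a test function `j` supported in
`S \ B(R)` with `(∫ H j)² > ε₀ ∫ (|∇j|² + j²)`. -/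
def MeanCurvatureCondition (S : Set E3) (N : E3 → E3) (p : E3) : Prop :=
  ∃ ε₀ > 0, ∀ R > 0, ∃ j : E3 → ℝ, IsTestFunctionOutside S p R j ∧
    (∫ x, meanCurvature S N x * j x ∂areaMeasure S) ^ 2 >
      ε₀ * ∫ x, (gradNormSq N j x + j x ^ 2) ∂areaMeasure S

end QuantumLayer

end

/-!
The test function is `j = X * (1 - ψ) * ⟪N, η⟫`, up to smoothing, where `X` cuts off the domain `D`
bounded by a tamed curve far out, `ψ` cuts out the ball of radius `R`, and `η` is the direction
attached to the curve. Both sides of the inequality are compared with the length `ℓ` of the curve.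

*The integral of the mean curvature.* The tangential part of the constant field `η` has divergence
`H * ⟪N, η⟫` along `S`, so that `∫ X * H * ⟪N, η⟫ = -∫ dX (η^T)`
(`integral_mul_meanCurvature_eq`). Let `X` be a function of the signed distance `t` from the curve,
dropping from `1` to `0` in the collar. If the drop takes place in a thin collar, the right-hand side
is close to the flux of `η^T` through the curve, and this is at least `δ₂ * ℓ`
(`IsTamedBoundary.le_integral_fderiv`). How thin the collar has to be depends on the curve, and a
steep cutoff has a large gradient; but replacing it by one whose profile depends only on `δ₃` changes
the integral by at most `sup |H|` times the area of the collar, which is at most a small multiple of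
`ℓ` because `H` tends to zero at infinity and the collar has area at most `2 * A ^ 2 * δ₃ * ℓ`
(`IsTamedBoundary.le_integral_cutoff`).

*The energy.* The gradient of `X` is bounded by a constant, that of `⟪N, η⟫` by the second fundamental
form. So the energy is at most a constant times the area of `D` and the collar, which by the
isoperimetric inequality is at most a constant times `ℓ ^ 2 + ℓ`, up to a term from the gradient
of `ψ` which does not depend on the curve (`IsFarCutoff.integral_energy_le`).

*The curves are long.* It remains to make `ℓ` large. A large ball around `p` avoids the collar, so
it lies in `D` or is disjoint from `D`. If it is disjoint from `D`, then `H` is small on all of `D`,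
and the lower bound `δ₂ * ℓ / 4 ≤ ε * ℓ ^ 2` for the integral gives a lower bound for `ℓ`
(`IsFarCutoff.one_le_length_of_disjoint`); moreover the support of `ψ` plays no role. If it lies in
`D`, then `ℓ ^ 2` is at least `δ₁` times the area of the ball, and these areas tend to infinity: were
the area of `S` finite, there would be no room for the collars far out
(`tendsto_measure_intrinsicBall`).

Four tools are needed: the area formula for immersed `C¹` parametrisations of surfaces by
subsets of the plane (`euclideanHausdorffMeasure_image_eq_lintegral`), the divergence theorem, the
compactness of closed balls in complete surfaces (`isCompact_intrinsic_closedBall`, the Hopf–Rinow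
theorem for length spaces), and the approximation of `C¹` test functions by smooth ones
(`exists_isTestFunctionOutside`).
-/

namespace QuantumLayer

open scoped NNReal

/-! ### The area formula for immersions of the plane into space -/

/-- The area factor of a linear map `ℝ² → ℝ³`: the square root of the Gram determinant of the images
of the two coordinate vectors. -/
noncomputable def gramJac (L : ℝ × ℝ →L[ℝ] E3) : ℝ :=
  √(‖L (1, 0)‖ ^ 2 * ‖L (0, 1)‖ ^ 2 - inner ℝ (L (1, 0)) (L (0, 1)) ^ 2)

theorem gramJac_nonneg (L : ℝ × ℝ →L[ℝ] E3) : 0 ≤ gramJac L := Real.sqrt_nonneg _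

theorem gram_nonneg (a b : E3) : 0 ≤ ‖a‖ ^ 2 * ‖b‖ ^ 2 - inner ℝ a b ^ 2 := by
  have h := abs_real_inner_le_norm a b
  have h2 := sq_le_sq' (by linarith [abs_nonneg (inner ℝ a b), neg_abs_le (inner ℝ a b)] :
    -(‖a‖ * ‖b‖) ≤ inner ℝ a b) ((le_abs_self _).trans h)
  nlinarith

theorem continuous_gramJac : Continuous gramJac := by
  unfold gramJac; fun_prop

theorem gramJac_sq (L : ℝ × ℝ →L[ℝ] E3) :
    gramJac L ^ 2 = ‖L (1, 0)‖ ^ 2 * ‖L (0, 1)‖ ^ 2 - inner ℝ (L (1, 0)) (L (0, 1)) ^ 2 :=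
  Real.sq_sqrt (gram_nonneg _ _)

theorem euclideanHausdorffMeasure_image_linear (L : ℝ × ℝ →L[ℝ] E3) (s : Set (ℝ × ℝ)) :
    (μHE[2] : Measure E3) (L '' s) = ENNReal.ofReal (gramJac L) * volume s := by
  let e : EuclideanSpace ℝ (Fin 2) ≃ₗ[ℝ] ℝ × ℝ :=
    (WithLp.linearEquiv 2 ℝ (Fin 2 → ℝ)).trans (LinearEquiv.finTwoArrow ℝ ℝ)
  have hmp : MeasurePreserving e :=
    (volume_preserving_finTwoArrow ℝ).comp (PiLp.volume_preserving_ofLp (Fin 2))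
  have h1 : L '' s = (L.toLinearMap ∘ₗ e.toLinearMap) '' (e ⁻¹' s) := by
    rw [LinearMap.coe_comp, image_comp]
    congr 1
    exact (image_preimage_eq s e.surjective).symm
  have h2 := LinearMap.euclideanHausdorffMeasure_image_eq_normDet_mul_volume
    (L.toLinearMap ∘ₗ e.toLinearMap) (e ⁻¹' s)
  rw [finrank_euclideanSpace_fin] at h2
  have h3 : volume (e ⁻¹' s) = volume s :=
    hmp.measure_preimage_emb
      ((MeasurableEquiv.finTwoArrow.measurableEmbedding).comp
        (MeasurableEquiv.toLp 2 (Fin 2 → ℝ)).symm.measurableEmbedding) s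
  have h4 : (L.toLinearMap ∘ₗ e.toLinearMap).normDet = gramJac L := by
    have h5 := LinearMap.normDet_sq_eq_det_gram (L.toLinearMap ∘ₗ e.toLinearMap)
      (EuclideanSpace.basisFun (Fin 2) ℝ)
    have e0 : e (EuclideanSpace.single 0 1) = (1, 0) := by simp [e, LinearEquiv.finTwoArrow]
    have e1 : e (EuclideanSpace.single 1 1) = (0, 1) := by simp [e, LinearEquiv.finTwoArrow]
    rw [Matrix.det_fin_two] at h5
    simp only [Matrix.gram_apply, EuclideanSpace.basisFun_apply, LinearMap.comp_apply,
      LinearEquiv.coe_coe, e0, e1, ContinuousLinearMap.coe_coe, real_inner_self_eq_norm_sq,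
      real_inner_comm (L (1, 0)) (L (0, 1))] at h5
    refine (sq_eq_sq₀ (LinearMap.normDet_nonneg _) (gramJac_nonneg _)).1 ?_
    rw [gramJac_sq, sq (inner ℝ _ _)]
    exact h5
  rw [h1, h2, h3, h4]

theorem gramJac_pos {L : ℝ × ℝ →L[ℝ] E3} (hL : Function.Injective L) : 0 < gramJac L := by
  rw [gramJac, Real.sqrt_pos]
  set a := L (1, 0)
  set b := L (0, 1)
  have ha : a ≠ 0 := fun h => by
    have := hL (h.trans (map_zero L).symm); simp at this
  have hc : ‖a‖ ^ 2 • b - (inner ℝ a b) • a ≠ 0 := fun h => by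
    have h1 : L (-(inner ℝ a b), ‖a‖ ^ 2) = 0 := by
      rw [show ((-(inner ℝ a b), ‖a‖ ^ 2) : ℝ × ℝ) =
        ‖a‖ ^ 2 • (0, 1) - (inner ℝ a b : ℝ) • (1, 0) by simp, map_sub, map_smul, map_smul]
      exact h
    have := hL (h1.trans (map_zero L).symm)
    simp [ha] at this
  have hp : 0 < ‖‖a‖ ^ 2 • b - (inner ℝ a b) • a‖ ^ 2 := by positivity
  rw [norm_sub_sq_real, norm_smul, norm_smul, real_inner_smul_left, real_inner_smul_right,
    real_inner_comm, mul_pow, mul_pow, Real.norm_eq_abs, Real.norm_eq_abs, sq_abs, sq_abs] at hp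
  have ha2 : 0 < ‖a‖ ^ 2 := by positivity
  rw [real_inner_comm] at hp
  refine (mul_pos_iff_of_pos_left ha2).1 ?_
  linarith

/-- If `f` expands distances at most `k` times as much as `g`, then it expands areas at most `k²`
times as much. -/
theorem euclideanHausdorffMeasure_image_le_of_norm_sub_le {f g : ℝ × ℝ → E3} {s : Set (ℝ × ℝ)}
    {k : ℝ≥0} (h : ∀ y ∈ s, ∀ z ∈ s, ‖f y - f z‖ ≤ k * ‖g y - g z‖) :
    (μHE[2] : Measure E3) (f '' s) ≤ (k : ℝ≥0∞) ^ 2 * μHE[2] (g '' s) := by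
  rcases s.eq_empty_or_nonempty with rfl | ⟨x0, hx0⟩
  · simp
  let φ := Function.invFunOn g s
  have hφ : ∀ y ∈ s, φ (g y) ∈ s ∧ g (φ (g y)) = g y := fun y hy =>
    ⟨Function.invFunOn_mem ⟨y, hy, rfl⟩, Function.invFunOn_eq ⟨y, hy, rfl⟩⟩
  have hfg : ∀ y ∈ s, f (φ (g y)) = f y := fun y hy => by
    have := h _ (hφ y hy).1 y hy
    rw [(hφ y hy).2, sub_self, norm_zero, mul_zero] at this
    exact sub_eq_zero.1 (norm_le_zero_iff.1 this)
  have himg : f '' s = (f ∘ φ) '' (g '' s) := by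
    rw [image_image]
    exact image_congr fun y hy => (hfg y hy).symm
  have hlip : LipschitzOnWith k (f ∘ φ) (g '' s) := by
    refine LipschitzOnWith.of_dist_le_mul ?_
    rintro _ ⟨y, hy, rfl⟩ _ ⟨z, hz, rfl⟩
    simp only [Function.comp, hfg y hy, hfg z hz, dist_eq_norm]
    exact h y hy z hz
  have := hlip.hausdorffMeasure_image_le (d := 2) (by norm_num)
  rw [himg, Measure.euclideanHausdorffMeasure_def, Measure.smul_apply, Measure.smul_apply,
    mul_smul_comm]
  refine smul_le_smul_of_nonneg_left ?_ zero_le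
  simpa using this

/-- Near each point at which it is immersive, a `C¹` map distorts areas almost exactly by the area
factor of its differential. -/
theorem exists_ball_area_almost_eq {f : ℝ × ℝ → E3} {U : Set (ℝ × ℝ)} (hU : IsOpen U)
    (hf : ContDiffOn ℝ 1 f U) {x : ℝ × ℝ} (hx : x ∈ U) (hinj : Function.Injective (fderiv ℝ f x))
    {k : ℝ≥0} (hk : 1 < k) :
    ∃ V ∈ 𝓝 x, IsOpen V ∧ ∀ E ⊆ V, MeasurableSet E →
      (μHE[2] : Measure E3) (f '' E) ≤
        (k : ℝ≥0∞) ^ 3 * ∫⁻ y in E, ENNReal.ofReal (gramJac (fderiv ℝ f y)) ∧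
      ∫⁻ y in E, ENNReal.ofReal (gramJac (fderiv ℝ f y)) ≤
        (k : ℝ≥0∞) ^ 3 * (μHE[2] : Measure E3) (f '' E) := by
  set L := fderiv ℝ f x with hL
  have hJ := gramJac_pos hinj
  have hk' : (1 : ℝ) < k := by exact_mod_cast hk
  have hfx : ContDiffAt ℝ 1 f x := hf.contDiffAt (hU.mem_nhds hx)
  obtain ⟨K, hK0, hK⟩ := L.exists_antilipschitzWith (LinearMap.ker_eq_bot.2 hinj)
  obtain ⟨δ, hδ0, hδ1, hδ2⟩ : ∃ δ : ℝ≥0, 0 < δ ∧ (1 : ℝ) + δ * K ≤ k ∧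
      1 ≤ (k : ℝ) * (1 - δ * K) := by
    have hK0' : (0 : ℝ) < K := by exact_mod_cast hK0
    have hk1 := sub_pos.2 hk'
    have hd : 0 < ((k : ℝ) - 1) / k / K := by positivity
    have h1 : ((k : ℝ) - 1) / k / K * K = (k - 1) / k := by field_simp
    refine ⟨(((k : ℝ) - 1) / k / K).toNNReal, Real.toNNReal_pos.2 hd, ?_, ?_⟩
    · rw [Real.coe_toNNReal _ hd.le, h1]
      have : ((k : ℝ) - 1) / k ≤ k - 1 := div_le_self (by linarith) hk'.le
      linarith
    · rw [Real.coe_toNNReal _ hd.le, h1]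
      have : (k : ℝ) * (1 - (k - 1) / k) = 1 := by field_simp; ring
      rw [this]
  have hstrict : HasStrictFDerivAt f L x := hfx.hasStrictFDerivAt (by norm_num)
  obtain ⟨V₁, hV₁, happ⟩ := hstrict.approximates_deriv_on_nhds (c := δ) (Or.inr hδ0)
  have hcont : ContinuousAt (fun y => gramJac (fderiv ℝ f y)) x :=
    continuous_gramJac.continuousAt.comp
      ((hfx.fderiv_right (m := 0) (by norm_num)).continuousAt)
  have hV₂ : ∀ᶠ y in 𝓝 x, gramJac (fderiv ℝ f y) < k * gramJac L ∧
      gramJac L < k * gramJac (fderiv ℝ f y) := by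
    refine (hcont.eventually_lt continuousAt_const ?_).and
      (continuousAt_const.eventually_lt (continuousAt_const.mul hcont) ?_) <;>
    · rw [← hL]; nlinarith
  obtain ⟨V, hVs, hVo, hxV⟩ := mem_nhds_iff.1 (inter_mem hV₁ hV₂)
  refine ⟨V, hVo.mem_nhds hxV, hVo, fun E hE hEm => ?_⟩
  have key : ∀ y ∈ E, ∀ z ∈ E, ‖f y - f z - L (y - z)‖ ≤ δ * K * ‖L y - L z‖ := by
    intro y hy z hz
    have h1 := happ y (hVs (hE hy)).1 z (hVs (hE hz)).1
    have h2 := hK.le_mul_dist y z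
    rw [dist_eq_norm, dist_eq_norm, ContinuousLinearMap.coe_coe] at h2
    calc _ ≤ _ := h1
      _ ≤ δ * (K * ‖L y - L z‖) := by gcongr
      _ = _ := by ring
  have hup : (μHE[2] : Measure E3) (f '' E) ≤ (k : ℝ≥0∞) ^ 2 * μHE[2] (L '' E) := by
    refine euclideanHausdorffMeasure_image_le_of_norm_sub_le fun y hy z hz => ?_
    have h1 := key y hy z hz
    have h2 : ‖f y - f z‖ ≤ ‖f y - f z - L (y - z)‖ + ‖L (y - z)‖ := by
      simpa using norm_add_le (f y - f z - L (y - z)) (L (y - z))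
    rw [map_sub] at h1 h2
    nlinarith [norm_nonneg (L y - L z)]
  have hlo : (μHE[2] : Measure E3) (L '' E) ≤ (k : ℝ≥0∞) ^ 2 * μHE[2] (f '' E) := by
    refine euclideanHausdorffMeasure_image_le_of_norm_sub_le fun y hy z hz => ?_
    have h1 := key y hy z hz
    have h2 : ‖L (y - z)‖ ≤ ‖f y - f z‖ + ‖f y - f z - L (y - z)‖ := by
      simpa using norm_sub_le (f y - f z) (f y - f z - L (y - z))
    rw [map_sub] at h1 h2
    nlinarith [norm_nonneg (L y - L z)]
  rw [euclideanHausdorffMeasure_image_linear] at hup hlo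
  have hk0 : (0 : ℝ) ≤ k := by linarith
  have hkc : ENNReal.ofReal k = k := ENNReal.ofReal_coe_nnreal
  constructor
  · refine hup.trans ?_
    have h1 : ENNReal.ofReal (gramJac L) * volume E ≤
        k * ∫⁻ y in E, ENNReal.ofReal (gramJac (fderiv ℝ f y)) := by
      rw [← setLIntegral_const, ← lintegral_const_mul' _ _ ENNReal.coe_ne_top]
      refine setLIntegral_mono_ae' hEm (ae_of_all _ fun y hy => ?_)
      rw [← hkc, ← ENNReal.ofReal_mul hk0]
      exact ENNReal.ofReal_le_ofReal (hVs (hE hy)).2.2.le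
    rw [show (k : ℝ≥0∞) ^ 3 = k ^ 2 * k from pow_succ _ _, mul_assoc]
    exact mul_le_mul' le_rfl h1
  · have : ∫⁻ y in E, ENNReal.ofReal (gramJac (fderiv ℝ f y)) ≤
        k * (ENNReal.ofReal (gramJac L) * volume E) := by
      rw [← setLIntegral_const, ← lintegral_const_mul' _ _ ENNReal.coe_ne_top]
      refine setLIntegral_mono_ae' hEm (ae_of_all _ fun y hy => ?_)
      rw [← hkc, ← ENNReal.ofReal_mul hk0]
      exact ENNReal.ofReal_le_ofReal (hVs (hE hy)).2.1.le
    refine this.trans ?_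
    rw [pow_succ', mul_assoc]
    gcongr

theorem le_of_forall_one_lt_le_pow_three_mul {a b : ℝ≥0∞}
    (h : ∀ k : ℝ≥0, 1 < k → a ≤ (k : ℝ≥0∞) ^ 3 * b) : a ≤ b := by
  have ht : Tendsto (fun k : ℝ≥0 => (k : ℝ≥0∞) ^ 3 * b) (𝓝[>] 1) (𝓝 ((1 : ℝ≥0∞) ^ 3 * b)) := by
    refine ENNReal.Tendsto.mul_const ?_ (Or.inl (by simp))
    refine ((ENNReal.continuous_pow 3).comp ENNReal.continuous_coe).continuousAt.mono_left
      nhdsWithin_le_nhds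
  rw [one_pow, one_mul] at ht
  exact ge_of_tendsto ht (eventually_mem_nhdsWithin.mono fun k hk => h k hk)

/-- The **area formula** for injective `C¹` immersions. -/
theorem euclideanHausdorffMeasure_image_eq_lintegral {f : ℝ × ℝ → E3} {U s : Set (ℝ × ℝ)}
    (hU : IsOpen U) (hf : ContDiffOn ℝ 1 f U) (hs : MeasurableSet s) (hsU : s ⊆ U)
    (hinj : InjOn f s) (himm : ∀ x ∈ s, Function.Injective (fderiv ℝ f x)) :
    (μHE[2] : Measure E3) (f '' s) = ∫⁻ x in s, ENNReal.ofReal (gramJac (fderiv ℝ f x)) := by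
  have key : ∀ k : ℝ≥0, 1 < k → ∃ B : ℕ → Set (ℝ × ℝ), Pairwise (Function.onFun Disjoint B) ∧
      (∀ n, MeasurableSet (B n)) ∧ s = ⋃ n, B n ∧ ∀ n,
      (μHE[2] : Measure E3) (f '' B n) ≤
        (k : ℝ≥0∞) ^ 3 * ∫⁻ y in B n, ENNReal.ofReal (gramJac (fderiv ℝ f y)) ∧
      ∫⁻ y in B n, ENNReal.ofReal (gramJac (fderiv ℝ f y)) ≤
        (k : ℝ≥0∞) ^ 3 * (μHE[2] : Measure E3) (f '' B n) := by
    intro k hk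
    have hloc : ∀ x : ℝ × ℝ, ∃ V : Set (ℝ × ℝ), IsOpen V ∧ (x ∈ s → V ∈ 𝓝 x) ∧ ∀ E ⊆ V,
        MeasurableSet E → (μHE[2] : Measure E3) (f '' E) ≤
          (k : ℝ≥0∞) ^ 3 * ∫⁻ y in E, ENNReal.ofReal (gramJac (fderiv ℝ f y)) ∧
        ∫⁻ y in E, ENNReal.ofReal (gramJac (fderiv ℝ f y)) ≤
          (k : ℝ≥0∞) ^ 3 * (μHE[2] : Measure E3) (f '' E) := by
      intro x
      by_cases hx : x ∈ s
      · obtain ⟨V, h1, h2, h3⟩ := exists_ball_area_almost_eq hU hf (hsU hx) (himm x hx) hk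
        exact ⟨V, h2, fun _ => h1, h3⟩
      · refine ⟨∅, isOpen_empty, fun h => absurd h hx, fun E hE _ => ?_⟩
        rw [subset_empty_iff.1 hE]; simp
    choose V hVo hVn hV using hloc
    obtain ⟨t, hts, htc, hst⟩ := TopologicalSpace.countable_cover_nhdsWithin
      fun x hx => mem_nhdsWithin_of_mem_nhds (hVn x hx)
    rcases t.eq_empty_or_nonempty with rfl | hne
    · refine ⟨fun _ => ∅, fun _ _ _ => by simp [Function.onFun], fun _ => MeasurableSet.empty, ?_,
        fun _ => by simp⟩
      simpa [subset_empty_iff] using hst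
    obtain ⟨u, rfl⟩ := htc.exists_eq_range hne
    refine ⟨fun n => s ∩ disjointed (fun n => V (u n)) n, ?_, ?_, ?_, ?_⟩
    · exact fun i j hij => ((disjoint_disjointed _ hij).mono inter_subset_right inter_subset_right)
    · exact fun n => hs.inter (MeasurableSet.disjointed (fun n => (hVo _).measurableSet) n)
    · rw [← inter_iUnion, iUnion_disjointed]
      refine (inter_eq_left.2 ?_).symm
      simpa using hst
    · exact fun n => hV (u n) _ (inter_subset_right.trans (disjointed_subset _ _))
        (hs.inter (MeasurableSet.disjointed (fun n => (hVo _).measurableSet) n))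
  refine le_antisymm (le_of_forall_one_lt_le_pow_three_mul fun k hk => ?_)
    (le_of_forall_one_lt_le_pow_three_mul fun k hk => ?_)
  · obtain ⟨B, hd, hm, hsB, hB⟩ := key k hk
    rw [hsB, image_iUnion, lintegral_iUnion hm hd, ← ENNReal.tsum_mul_left]
    exact (measure_iUnion_le _).trans (ENNReal.tsum_le_tsum fun n => (hB n).1)
  · obtain ⟨B, hd, hm, hsB, hB⟩ := key k hk
    have hBs : ∀ n, B n ⊆ s := fun n => hsB ▸ subset_iUnion B n
    have hmeas : ∀ n, MeasurableSet (f '' B n) := fun n =>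
      (hm n).image_of_continuousOn_injOn (hf.continuousOn.mono ((hBs n).trans hsU))
        (hinj.mono (hBs n))
    have hdis : Pairwise (Function.onFun Disjoint fun n => f '' B n) := fun i j hij =>
      disjoint_iff_inter_eq_empty.2 (by
        rw [← hinj.image_inter (hBs i) (hBs j), (hd hij).inter_eq, image_empty])
    conv_lhs => rw [hsB]
    conv_rhs => rw [hsB]
    rw [image_iUnion, lintegral_iUnion hm hd, measure_iUnion hdis hmeas, ← ENNReal.tsum_mul_left]
    exact ENNReal.tsum_le_tsum fun n => (hB n).2

theorem measurable_gramJac_fderiv (f : ℝ × ℝ → E3) :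
    Measurable fun x => gramJac (fderiv ℝ f x) :=
  continuous_gramJac.measurable.comp (measurable_fderiv ℝ f)

/-- The measure version of the area formula, for the restriction of the map to `s`. -/
theorem map_withDensity_gramJac {f : ℝ × ℝ → E3} {U s : Set (ℝ × ℝ)}
    (hU : IsOpen U) (hf : ContDiffOn ℝ 1 f U) (hs : MeasurableSet s) (hsU : s ⊆ U)
    (hinj : InjOn f s) (himm : ∀ x ∈ s, Function.Injective (fderiv ℝ f x)) :
    Measure.map (s.domRestrict f) (Measure.comap (↑)
      (volume.withDensity fun x => ENNReal.ofReal (gramJac (fderiv ℝ f x)))) =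
      (μHE[2] : Measure E3).restrict (f '' s) := by
  have hemb := (hf.continuousOn.mono hsU).measurableEmbedding hs hinj
  ext t ht
  have hpre : MeasurableSet (s ∩ f ⁻¹' t) := by
    have := (MeasurableEmbedding.subtype_coe hs).measurableSet_image.2 (hemb.measurable ht)
    convert this using 1
    ext x; simp [and_comm]
  rw [Measure.map_apply hemb.measurable ht,
    (MeasurableEmbedding.subtype_coe hs).comap_apply, Measure.restrict_apply ht]
  have h1 : ((↑) : s → ℝ × ℝ) '' (s.domRestrict f ⁻¹' t) = s ∩ f ⁻¹' t := by
    ext x; simp [and_comm]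
  rw [h1, withDensity_apply _ hpre, ← euclideanHausdorffMeasure_image_eq_lintegral hU hf hpre
    (inter_subset_left.trans hsU) (hinj.mono inter_subset_left) fun x hx => himm x hx.1,
    image_inter_preimage, inter_comm]

theorem integral_image_eq_integral_gramJac {f : ℝ × ℝ → E3} {U s : Set (ℝ × ℝ)}
    (hU : IsOpen U) (hf : ContDiffOn ℝ 1 f U) (hs : MeasurableSet s) (hsU : s ⊆ U)
    (hinj : InjOn f s) (himm : ∀ x ∈ s, Function.Injective (fderiv ℝ f x)) (g : E3 → ℝ) :
    ∫ x in f '' s, g x ∂(μHE[2] : Measure E3) =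
      ∫ x in s, gramJac (fderiv ℝ f x) * g (f x) := by
  have hemb := (hf.continuousOn.mono hsU).measurableEmbedding hs hinj
  rw [← map_withDensity_gramJac hU hf hs hsU hinj himm, hemb.integral_map]
  simp only [Set.domRestrict_apply, ENNReal.ofReal]
  rw [← (MeasurableEmbedding.subtype_coe hs).integral_map (g := fun x => g (f x)),
    map_comap_subtype_coe hs,
    setIntegral_withDensity_eq_setIntegral_smul₀
      (measurable_gramJac_fderiv f).real_toNNReal.aemeasurable _ hs]
  congr with x
  rw [NNReal.smul_def, Real.coe_toNNReal _ (gramJac_nonneg _), smul_eq_mul]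

theorem integrableOn_image_iff_gramJac {f : ℝ × ℝ → E3} {U s : Set (ℝ × ℝ)}
    (hU : IsOpen U) (hf : ContDiffOn ℝ 1 f U) (hs : MeasurableSet s) (hsU : s ⊆ U)
    (hinj : InjOn f s) (himm : ∀ x ∈ s, Function.Injective (fderiv ℝ f x)) (g : E3 → ℝ) :
    IntegrableOn g (f '' s) (μHE[2] : Measure E3) ↔
      IntegrableOn (fun x => gramJac (fderiv ℝ f x) * g (f x)) s := by
  have hemb := (hf.continuousOn.mono hsU).measurableEmbedding hs hinj
  rw [IntegrableOn, ← map_withDensity_gramJac hU hf hs hsU hinj himm, hemb.integrable_map_iff]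
  simp only [Set.domRestrict_eq, ← Function.comp_assoc, ENNReal.ofReal]
  rw [← (MeasurableEmbedding.subtype_coe hs).integrable_map_iff, map_comap_subtype_coe hs,
    restrict_withDensity hs, integrable_withDensity_iff_integrable_coe_smul₀]
  · simp_rw [IntegrableOn, Real.coe_toNNReal _ (gramJac_nonneg _), Function.comp_apply, smul_eq_mul]
  · exact (measurable_gramJac_fderiv f).real_toNNReal.aemeasurable

end QuantumLayer

namespace QuantumLayer

/-! ### Charts, tangent planes and functions of class `C¹` on the surface -/

/-- A `C²` chart of `S`: a parametrisation `param` of the open piece `S ∩ source` of `S` by an open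
subset `domain` of `ℝ²`, with inverse `coord` (defined on an open subset of `ℝ³`), together with a
regular equation `eqn = 0` of the piece. -/
structure SurfaceChart (S : Set E3) where
  source : Set E3
  domain : Set (ℝ × ℝ)
  param : ℝ × ℝ → E3
  coord : E3 → ℝ × ℝ
  eqn : E3 → ℝ
  isOpen_source : IsOpen source
  isOpen_domain : IsOpen domain
  contDiffOn_param : ContDiffOn ℝ 2 param domain
  contDiffOn_coord : ContDiffOn ℝ 2 coord source
  contDiffOn_eqn : ContDiffOn ℝ 2 eqn source
  param_mem : ∀ u ∈ domain, param u ∈ source ∩ S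
  coord_mem : ∀ y ∈ source ∩ S, coord y ∈ domain
  param_coord : ∀ y ∈ source ∩ S, param (coord y) = y
  coord_param : ∀ u ∈ domain, coord (param u) = u
  eqn_eq_zero : ∀ y ∈ source ∩ S, eqn y = 0
  fderiv_eqn_ne_zero : ∀ y ∈ source, fderiv ℝ eqn y ≠ 0

theorem IsC2Surface.exists_chart {S : Set E3} (hS : IsC2Surface S) {x : E3} (hx : x ∈ S) :
    ∃ c : SurfaceChart S, x ∈ c.source := by
  obtain ⟨Φ, hxΦ, h1, h2, h3⟩ := hS x hx
  let ι : ℝ × ℝ → E3 := fun u => WithLp.toLp 2 ![u.1, u.2, 0]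
  let P : E3 → ℝ × ℝ := fun y => (y 0, y 1)
  have hι : ContDiff ℝ 2 ι := by
    refine contDiff_euclidean.2 fun i => ?_
    fin_cases i
    · exact contDiff_fst
    · exact contDiff_snd
    · exact contDiff_const
  have hcoord : ∀ i : Fin 3, ContDiff ℝ 2 fun y : E3 => y i := fun i =>
    (EuclideanSpace.proj (𝕜 := ℝ) i).contDiff
  have hP : ContDiff ℝ 2 P := (hcoord 0).prodMk (hcoord 1)
  have hPι : ∀ u, P (ι u) = u := fun u => rfl
  have hιP : ∀ y : E3, y 2 = 0 → ι (P y) = y := fun y hy => by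
    ext i; fin_cases i
    · rfl
    · rfl
    · exact hy.symm
  have hmem : ∀ u ∈ ι ⁻¹' Φ.target, Φ.symm (ι u) ∈ Φ.source ∩ S := fun u hu => by
    refine ⟨Φ.map_target hu, (h3 _ (Φ.map_target hu)).2 ?_⟩
    rw [Φ.right_inv hu]; rfl
  refine ⟨⟨Φ.source, ι ⁻¹' Φ.target, fun u => Φ.symm (ι u), fun y => P (Φ y), fun y => Φ y 2,
    Φ.open_source, Φ.open_target.preimage hι.continuous, ?_, ?_, ?_, hmem, ?_, ?_, ?_, ?_, ?_⟩, hxΦ⟩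
  · exact h2.comp hι.contDiffOn fun u hu => hu
  · exact hP.comp_contDiffOn h1
  · exact (hcoord 2).comp_contDiffOn h1
  · intro y hy
    change ι (P (Φ y)) ∈ Φ.target
    rw [hιP _ ((h3 y hy.1).1 hy.2)]
    exact Φ.map_source hy.1
  · intro y hy
    rw [hιP _ ((h3 y hy.1).1 hy.2), Φ.left_inv hy.1]
  · intro u hu
    rw [Φ.right_inv hu, hPι]
  · exact fun y hy => (h3 y hy.1).1 hy.2
  · intro y hy h0
    have hz := Φ.map_source hy
    have hd1 : DifferentiableAt ℝ (fun y => Φ y 2) (Φ.symm (Φ y)) := by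
      rw [Φ.left_inv hy]
      exact (((hcoord 2).comp_contDiffOn h1).contDiffAt (Φ.open_source.mem_nhds hy)).differentiableAt
        (by norm_num)
    have hd2 : DifferentiableAt ℝ Φ.symm (Φ y) :=
      (h2.contDiffAt (Φ.open_target.mem_nhds hz)).differentiableAt (by norm_num)
    have hc := hd1.hasFDerivAt.comp (Φ y) hd2.hasFDerivAt
    rw [Φ.left_inv hy, h0, ContinuousLinearMap.zero_comp] at hc
    have hc' : HasFDerivAt (fun z : E3 => z 2) (0 : E3 →L[ℝ] ℝ) (Φ y) := by
      refine hc.congr_of_eventuallyEq ?_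
      filter_upwards [Φ.open_target.mem_nhds hz] with z hz'
      simp [Φ.right_inv hz']
    have he := hc'.unique (EuclideanSpace.proj (𝕜 := ℝ) (2 : Fin 3)).hasFDerivAt
    have := congrArg (fun l => l (EuclideanSpace.single 2 1)) he
    simp at this

namespace SurfaceChart

variable {S : Set E3} (c : SurfaceChart S)

theorem image_domain : c.param '' c.domain = c.source ∩ S :=
  Subset.antisymm (image_subset_iff.2 c.param_mem)
    fun y hy => ⟨c.coord y, c.coord_mem y hy, c.param_coord y hy⟩

theorem injOn_param : InjOn c.param c.domain := fun u hu v hv h => by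
  rw [← c.coord_param u hu, ← c.coord_param v hv, h]

theorem contDiffAt_param {u : ℝ × ℝ} (hu : u ∈ c.domain) : ContDiffAt ℝ 2 c.param u :=
  c.contDiffOn_param.contDiffAt (c.isOpen_domain.mem_nhds hu)

theorem differentiableAt_param {u : ℝ × ℝ} (hu : u ∈ c.domain) :
    DifferentiableAt ℝ c.param u :=
  (c.contDiffAt_param hu).differentiableAt (by norm_num)

theorem contDiffAt_coord {y : E3} (hy : y ∈ c.source) : ContDiffAt ℝ 2 c.coord y :=
  c.contDiffOn_coord.contDiffAt (c.isOpen_source.mem_nhds hy)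

theorem fderiv_param_injective {u : ℝ × ℝ} (hu : u ∈ c.domain) :
    Function.Injective (fderiv ℝ c.param u) := by
  have h1 := c.differentiableAt_param hu
  have h2 := ((c.contDiffAt_coord (c.param_mem u hu).1).differentiableAt (by norm_num)).hasFDerivAt.comp
    u h1.hasFDerivAt
  have h3 : HasFDerivAt (fun v : ℝ × ℝ => v) (ContinuousLinearMap.id ℝ (ℝ × ℝ)) u := hasFDerivAt_id u
  have h4 := h2.unique (h3.congr_of_eventuallyEq (by
    filter_upwards [c.isOpen_domain.mem_nhds hu] with v hv using c.coord_param v hv))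
  intro a b hab
  have := congrArg (fun l => l a) h4
  have h' := congrArg (fun l => l b) h4
  simp only [ContinuousLinearMap.comp_apply, ContinuousLinearMap.id_apply] at this h'
  rw [← this, ← h', hab]

theorem isTangent_fderiv_param {u : ℝ × ℝ} (hu : u ∈ c.domain) (w : ℝ × ℝ) :
    IsTangent S (c.param u) (fderiv ℝ c.param u w) := by
  have hline : HasDerivAt (fun t : ℝ => u + t • w) w 0 := by
    simpa using ((hasDerivAt_id (0 : ℝ)).smul_const w).const_add u
  refine ⟨fun t => c.param (u + t • w), by simp, ?_, ?_⟩
  · exact (c.differentiableAt_param hu).hasFDerivAt.comp_hasDerivAt_of_eq (0 : ℝ) hline (by simp)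
  · have h : Tendsto (fun t : ℝ => u + t • w) (𝓝 0) (𝓝 u) := by
      simpa using hline.continuousAt.tendsto
    exact (h.eventually (c.isOpen_domain.mem_nhds hu)).mono fun t ht => (c.param_mem _ ht).2

end SurfaceChart

theorem mem_tangentPlane {N : E3 → E3} {x v : E3} :
    v ∈ tangentPlane N x ↔ inner ℝ (N x) v = 0 :=
  Submodule.mem_orthogonal_singleton_iff_inner_right

instance : Fact (Module.finrank ℝ E3 = 2 + 1) := ⟨finrank_euclideanSpace_fin⟩

theorem IsUnitNormal.ne_zero {S : Set E3} {N : E3 → E3} (hN : IsUnitNormal S N) {x : E3}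
    (hx : x ∈ S) : N x ≠ 0 := fun h => by
  have := hN.norm_eq_one x hx
  rw [h, norm_zero] at this
  exact zero_ne_one this

theorem IsUnitNormal.finrank_tangentPlane {S : Set E3} {N : E3 → E3} (hN : IsUnitNormal S N)
    {x : E3} (hx : x ∈ S) : Module.finrank ℝ (tangentPlane N x) = 2 :=
  Submodule.finrank_orthogonal_span_singleton (hN.ne_zero hx)

theorem SurfaceChart.range_fderiv_param {S : Set E3} {N : E3 → E3} (hN : IsUnitNormal S N)
    (c : SurfaceChart S) {u : ℝ × ℝ} (hu : u ∈ c.domain) :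
    (fderiv ℝ c.param u).range = tangentPlane N (c.param u) := by
  refine Submodule.eq_of_le_of_finrank_eq ?_ ?_
  · rintro _ ⟨w, rfl⟩
    exact mem_tangentPlane.2 (hN.orthogonal _ (c.param_mem u hu).2 _ (c.isTangent_fderiv_param hu w))
  · rw [hN.finrank_tangentPlane (c.param_mem u hu).2]
    refine (LinearMap.finrank_range_of_inj (c.fderiv_param_injective hu)).trans ?_
    simp

theorem IsUnitNormal.isTangent_iff {S : Set E3} {N : E3 → E3} (hS : IsC2Surface S)
    (hN : IsUnitNormal S N) {x v : E3} (hx : x ∈ S) :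
    IsTangent S x v ↔ v ∈ tangentPlane N x := by
  refine ⟨fun h => mem_tangentPlane.2 (hN.orthogonal x hx v h), fun h => ?_⟩
  obtain ⟨c, hc⟩ := hS.exists_chart hx
  have hu := c.coord_mem x ⟨hc, hx⟩
  have hp := c.param_coord x ⟨hc, hx⟩
  have h1 := c.range_fderiv_param hN hu
  rw [hp] at h1
  rw [← h1] at h
  obtain ⟨w, rfl⟩ := h
  have := c.isTangent_fderiv_param hu w
  rwa [hp] at this

/-- A derivative along `S` is determined on tangent vectors. -/
theorem IsTangent.hasFDerivWithinAt_unique {F : Type*} [NormedAddCommGroup F] [NormedSpace ℝ F]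
    {S : Set E3} {g : E3 → F} {L L' : E3 →L[ℝ] F} {x v : E3} (hv : IsTangent S x v)
    (h : HasFDerivWithinAt g L S x) (h' : HasFDerivWithinAt g L' S x) : L v = L' v := by
  obtain ⟨k, rfl, hk, hkS⟩ := hv
  exact (h.comp_hasDerivAt (0 : ℝ) hk hkS).unique (h'.comp_hasDerivAt (0 : ℝ) hk hkS)

/-- `g` is of class `C¹` along `S`: near each point of `S` it agrees on `S` with a function which is
of class `C¹` near that point of `ℝ³`. -/
def IsC1On {F : Type*} [NormedAddCommGroup F] [NormedSpace ℝ F] (S : Set E3) (g : E3 → F) : Prop :=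
  ∀ x ∈ S, ∃ G : E3 → F, ContDiffAt ℝ 1 G x ∧ g =ᶠ[𝓝[S] x] G

section IsC1On

variable {F : Type*} [NormedAddCommGroup F] [NormedSpace ℝ F] {S : Set E3}

theorem _root_.ContDiff.isC1On {g : E3 → F} (hg : ContDiff ℝ 1 g) : IsC1On S g :=
  fun _ _ => ⟨g, hg.contDiffAt, EventuallyEq.rfl⟩

theorem IsC1On.differentiableWithinAt {g : E3 → F} (hg : IsC1On S g) {x : E3} (hx : x ∈ S) :
    DifferentiableWithinAt ℝ g S x := by
  obtain ⟨G, hG, he⟩ := hg x hx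
  exact ((hG.differentiableAt (by norm_num)).differentiableWithinAt).congr_of_eventuallyEq he
    (he.self_of_nhdsWithin hx)

theorem IsC1On.mul {g h : E3 → ℝ} (hg : IsC1On S g) (hh : IsC1On S h) :
    IsC1On S fun x => g x * h x := by
  intro x hx
  obtain ⟨G, hG, hGe⟩ := hg x hx
  obtain ⟨H, hH, hHe⟩ := hh x hx
  exact ⟨fun y => G y * H y, hG.mul hH, hGe.mul hHe⟩

theorem IsC1On.inner_const {g : E3 → E3} (hg : IsC1On S g) (η : E3) :
    IsC1On S fun x => inner ℝ (g x) η := by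
  intro x hx
  obtain ⟨G, hG, hGe⟩ := hg x hx
  exact ⟨fun y => inner ℝ (G y) η, hG.inner ℝ contDiffAt_const, hGe.fun_comp fun v => inner ℝ v η⟩

/-- Composition with a chart turns functions of class `C¹` along `S` into functions of class
`C¹`. -/
theorem IsC1On.contDiffOn_comp_param {g : E3 → F} (hg : IsC1On S g) (c : SurfaceChart S) :
    ContDiffOn ℝ 1 (fun u => g (c.param u)) c.domain := by
  intro u hu
  obtain ⟨G, hG, hGe⟩ := hg _ (c.param_mem u hu).2
  refine ContDiffAt.contDiffWithinAt ?_
  refine ((hG.comp u ((c.contDiffAt_param hu).of_le (by norm_num))).congr_of_eventuallyEq ?_)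
  have h1 : Tendsto c.param (𝓝 u) (𝓝[S] (c.param u)) := by
    refine tendsto_nhdsWithin_iff.2 ⟨(c.contDiffAt_param hu).continuousAt, ?_⟩
    filter_upwards [c.isOpen_domain.mem_nhds hu] with v hv using (c.param_mem v hv).2
  exact h1.eventually hGe

theorem IsC1On.fderiv_comp_param {g : E3 → F} (hg : IsC1On S g) (c : SurfaceChart S)
    {u : ℝ × ℝ} (hu : u ∈ c.domain) (w : ℝ × ℝ) :
    fderiv ℝ (fun u => g (c.param u)) u w =
      fderivWithin ℝ g S (c.param u) (fderiv ℝ c.param u w) := by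
  have h1 := (hg.differentiableWithinAt (c.param_mem u hu).2).hasFDerivWithinAt
  have h2 := (c.differentiableAt_param hu).hasFDerivAt
  have h3 : HasFDerivAt (fun u => g (c.param u))
      ((fderivWithin ℝ g S (c.param u)).comp (fderiv ℝ c.param u)) u := by
    have := h1.comp (s := c.domain) u h2.hasFDerivWithinAt fun v hv => (c.param_mem v hv).2
    exact this.hasFDerivAt (c.isOpen_domain.mem_nhds hu)
  rw [h3.fderiv]; rfl

end IsC1On

/-- A unit normal field of a `C²` surface is of class `C¹`: near a point it is, up to a constant sign,
the normalised gradient of an equation of the surface. -/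
theorem IsUnitNormal.isC1On {S : Set E3} {N : E3 → E3} (hS : IsC2Surface S)
    (hN : IsUnitNormal S N) : IsC1On S N := by
  intro x hx
  obtain ⟨c, hc⟩ := hS.exists_chart hx
  let n : E3 → E3 := fun y => (InnerProductSpace.toDual ℝ E3).symm (fderiv ℝ c.eqn y)
  have hn0 : ∀ y ∈ c.source, n y ≠ 0 := fun y hy h =>
    c.fderiv_eqn_ne_zero y hy ((InnerProductSpace.toDual ℝ E3).symm.map_eq_zero_iff.1 h)
  have hnc : ∀ y ∈ c.source, ContDiffAt ℝ 1 n y := fun y hy => by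
    have h1 : ContDiffAt ℝ 2 c.eqn y := c.contDiffOn_eqn.contDiffAt (c.isOpen_source.mem_nhds hy)
    exact (InnerProductSpace.toDual ℝ E3).symm.contDiff.contDiffAt.comp y
      (h1.fderiv_right (m := 1) (by norm_num))
  let ν : E3 → E3 := fun y => ‖n y‖⁻¹ • n y
  have hνc : ∀ y ∈ c.source, ContDiffAt ℝ 1 ν y := fun y hy =>
    ((((hnc y hy).norm ℝ (hn0 y hy)).inv (norm_ne_zero_iff.2 (hn0 y hy))).smul (hnc y hy))
  have hν1 : ∀ y ∈ c.source, ‖ν y‖ = 1 := fun y hy => by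
    have := norm_ne_zero_iff.2 (hn0 y hy)
    simp [ν, norm_smul, this]
  -- both unit vectors are orthogonal to the tangent plane
  have hνN : ∀ y ∈ c.source ∩ S, ∃ s : ℝ, |s| = 1 ∧ N y = s • ν y := by
    intro y hy
    have hu := c.coord_mem y hy
    have hp := c.param_coord y hy
    have hr := c.range_fderiv_param hN hu
    rw [hp] at hr
    have hperp : ν y ∈ (tangentPlane N y)ᗮ := by
      rw [← hr, Submodule.mem_orthogonal]
      rintro _ ⟨w, rfl⟩
      have h1 : HasFDerivAt (fun v => c.eqn (c.param v))
          ((fderiv ℝ c.eqn y).comp (fderiv ℝ c.param (c.coord y))) (c.coord y) := by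
        refine HasFDerivAt.comp (c.coord y) ?_ (c.differentiableAt_param hu).hasFDerivAt
        rw [hp]
        exact ((c.contDiffOn_eqn.contDiffAt (c.isOpen_source.mem_nhds hy.1)).differentiableAt
          (by norm_num)).hasFDerivAt
      have h2 : HasFDerivAt (fun v => c.eqn (c.param v)) (0 : ℝ × ℝ →L[ℝ] ℝ) (c.coord y) := by
        refine (hasFDerivAt_const (0 : ℝ) _).congr_of_eventuallyEq ?_
        filter_upwards [c.isOpen_domain.mem_nhds hu] with v hv using c.eqn_eq_zero _ (c.param_mem v hv)
      have h3 := congrArg (fun l => l w) (h1.unique h2)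
      simp only [ContinuousLinearMap.comp_apply, zero_apply] at h3
      have h4 : inner ℝ (n y) (fderiv ℝ c.param (c.coord y) w) = 0 := by
        rw [InnerProductSpace.toDual_symm_apply]; exact h3
      change inner ℝ (fderiv ℝ c.param (c.coord y) w) (‖n y‖⁻¹ • n y) = 0
      rw [real_inner_smul_right, real_inner_comm, h4, mul_zero]
    rw [Submodule.orthogonal_orthogonal, Submodule.mem_span_singleton] at hperp
    obtain ⟨a, ha⟩ := hperp
    have ha1 : |a| = 1 := by
      have h1 := hν1 y hy.1
      rwa [← ha, norm_smul, hN.norm_eq_one y hy.2, mul_one, Real.norm_eq_abs] at h1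
    refine ⟨a, ha1, ?_⟩
    rw [← ha, smul_smul, ← sq, ← sq_abs, ha1, one_pow, one_smul]
  obtain ⟨s, hs, hNs⟩ := hνN x ⟨hc, hx⟩
  refine ⟨fun y => s • ν y, (hνc x hc).const_smul s, ?_⟩
  -- the sign is locally constant by continuity
  have hcont : ContinuousWithinAt (fun y => N y - s • ν y) S x :=
    (hN.continuousOn x hx).sub
      ((hνc x hc).continuousAt.continuousWithinAt.const_smul s)
  have hsmall : ∀ᶠ y in 𝓝[S] x, ‖N y - s • ν y‖ < 2 := by
    refine hcont.norm.eventually_lt continuousWithinAt_const ?_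
    simp [hNs]
  filter_upwards [hsmall, self_mem_nhdsWithin,
    mem_nhdsWithin_of_mem_nhds (c.isOpen_source.mem_nhds hc)] with y hy hyS hyc
  obtain ⟨s', hs', hNs'⟩ := hνN y ⟨hyc, hyS⟩
  rw [hNs', ← sub_smul, norm_smul, hν1 y hyc, mul_one, Real.norm_eq_abs] at hy
  rw [hNs']
  rcases (abs_eq (zero_le_one' ℝ)).1 hs with rfl | rfl <;>
  rcases (abs_eq (zero_le_one' ℝ)).1 hs' with rfl | rfl <;> first | rfl | norm_num at hy

end QuantumLayer

namespace QuantumLayer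

/-! ### The triple product and the mean curvature -/

/-- The triple product `det (η, a, b)` as a bilinear form in `a` and `b`. -/
noncomputable def tripleProduct (η : E3) : E3 →L[ℝ] E3 →L[ℝ] ℝ :=
  (LinearMap.mk₂ ℝ (fun a b : E3 => η 0 * (a 1 * b 2 - a 2 * b 1) - η 1 * (a 0 * b 2 - a 2 * b 0) +
    η 2 * (a 0 * b 1 - a 1 * b 0))
    (fun a a' b => by simp only [PiLp.add_apply]; ring)
    (fun r a b => by simp only [PiLp.smul_apply, smul_eq_mul]; ring)
    (fun a b b' => by simp only [PiLp.add_apply]; ring)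
    (fun r a b => by simp only [PiLp.smul_apply, smul_eq_mul]; ring)).toContinuousBilinearMap

theorem tripleProduct_apply (η a b : E3) : tripleProduct η a b =
    η 0 * (a 1 * b 2 - a 2 * b 1) - η 1 * (a 0 * b 2 - a 2 * b 0) +
      η 2 * (a 0 * b 1 - a 1 * b 0) := rfl

theorem tripleProduct_swap (η a b : E3) : tripleProduct η a b = -tripleProduct η b a := by
  simp only [tripleProduct_apply]; ring

theorem tripleProduct_self (η a : E3) : tripleProduct η a a = 0 := by
  simp only [tripleProduct_apply]; ring

theorem tripleProduct_sq {n a b : E3} (hn : ‖n‖ = 1) (ha : inner ℝ n a = 0)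
    (hb : inner ℝ n b = 0) :
    tripleProduct n a b ^ 2 = ‖a‖ ^ 2 * ‖b‖ ^ 2 - inner ℝ a b ^ 2 := by
  have hn' : ‖n‖ ^ 2 = 1 := by rw [hn, one_pow]
  rw [← real_inner_self_eq_norm_sq] at hn'
  rw [← real_inner_self_eq_norm_sq, ← real_inner_self_eq_norm_sq]
  simp only [PiLp.inner_apply, Fin.sum_univ_three, RCLike.inner_apply, conj_trivial] at *
  rw [tripleProduct_apply]
  -- the square of a determinant is the Gram determinant
  have key : (n 0 * (a 1 * b 2 - a 2 * b 1) - n 1 * (a 0 * b 2 - a 2 * b 0) +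
      n 2 * (a 0 * b 1 - a 1 * b 0)) ^ 2 =
      (n 0 * n 0 + n 1 * n 1 + n 2 * n 2) *
        ((a 0 * a 0 + a 1 * a 1 + a 2 * a 2) * (b 0 * b 0 + b 1 * b 1 + b 2 * b 2) -
          (b 0 * a 0 + b 1 * a 1 + b 2 * a 2) ^ 2) -
      (a 0 * n 0 + a 1 * n 1 + a 2 * n 2) *
        ((a 0 * n 0 + a 1 * n 1 + a 2 * n 2) * (b 0 * b 0 + b 1 * b 1 + b 2 * b 2) -
          (b 0 * a 0 + b 1 * a 1 + b 2 * a 2) * (b 0 * n 0 + b 1 * n 1 + b 2 * n 2)) +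
      (b 0 * n 0 + b 1 * n 1 + b 2 * n 2) *
        ((a 0 * n 0 + a 1 * n 1 + a 2 * n 2) * (b 0 * a 0 + b 1 * a 1 + b 2 * a 2) -
          (b 0 * n 0 + b 1 * n 1 + b 2 * n 2) * (a 0 * a 0 + a 1 * a 1 + a 2 * a 2)) := by ring
  rw [key, hn', ha, hb]; ring

theorem abs_tripleProduct_eq_gramJac {n : E3} {L : ℝ × ℝ →L[ℝ] E3} (hn : ‖n‖ = 1)
    (h : ∀ w, inner ℝ n (L w) = 0) : |tripleProduct n (L (1, 0)) (L (0, 1))| = gramJac L := by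
  rw [← abs_of_nonneg (gramJac_nonneg L), ← sq_eq_sq_iff_abs_eq_abs, gramJac_sq,
    tripleProduct_sq hn (h _) (h _)]

/-- The tangential part of a vector, with respect to the unit normal `n`. -/
noncomputable def tangentPart (n η : E3) : E3 := η - (inner ℝ n η : ℝ) • n

theorem inner_tangentPart {n : E3} (hn : ‖n‖ = 1) (η : E3) : inner ℝ n (tangentPart n η) = 0 := by
  rw [tangentPart, inner_sub_right, real_inner_smul_right, real_inner_self_eq_norm_sq, hn]; ring

theorem norm_tangentPart_le {n : E3} (hn : ‖n‖ = 1) (η : E3) : ‖tangentPart n η‖ ≤ ‖η‖ := by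
  refine abs_le_of_sq_le_sq' ?_ (norm_nonneg _) |>.2
  rw [tangentPart, norm_sub_sq_real, real_inner_smul_right, norm_smul, hn, mul_one,
    Real.norm_eq_abs, sq_abs, real_inner_comm η n]
  nlinarith [sq_nonneg (inner ℝ n η : ℝ)]

/-- If `α a + β b` is the tangential part of `η`, then its coefficients are quotients of triple
products. -/
theorem tripleProduct_of_tangentPart_eq {n η a b : E3} {α β : ℝ}
    (h : tangentPart n η = α • a + β • b) :
    tripleProduct η a b = inner ℝ n η * tripleProduct n a b ∧
      tripleProduct η n b = -(α * tripleProduct n a b) ∧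
      tripleProduct η n a = β * tripleProduct n a b := by
  have hη : η = α • a + β • b + (inner ℝ n η : ℝ) • n := by
    rw [← h, tangentPart, sub_add_cancel]
  generalize (inner ℝ n η : ℝ) = r at *
  subst hη
  simp only [tripleProduct_apply, PiLp.add_apply, PiLp.smul_apply, smul_eq_mul]
  refine ⟨by ring, by ring, by ring⟩

section shape

variable {S : Set E3} {N : E3 → E3}

/-- The derivative of the unit normal in tangent directions is tangent. -/
theorem IsUnitNormal.inner_fderivWithin (hS : IsC2Surface S) (hN : IsUnitNormal S N) {x v : E3}
    (hx : x ∈ S) (hv : IsTangent S x v) : inner ℝ (N x) (fderivWithin ℝ N S x v) = 0 := by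
  have h := ((hN.isC1On hS).differentiableWithinAt hx).hasFDerivWithinAt
  obtain ⟨k, rfl, hk, hkS⟩ := hv
  have h1 := h.comp_hasDerivAt (0 : ℝ) hk hkS
  have h2 := h1.inner ℝ h1
  have h3 : HasDerivAt (fun t => inner ℝ ((N ∘ k) t) ((N ∘ k) t)) (0 : ℝ) (0 : ℝ) := by
    refine (hasDerivAt_const (0 : ℝ) (1 : ℝ)).congr_of_eventuallyEq ?_
    filter_upwards [hkS] with t ht
    simp [hN.norm_eq_one _ ht]
  have h4 := h2.unique h3
  rw [real_inner_comm] at h4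
  simp only [Function.comp] at h4 ⊢
  rw [real_inner_comm]
  linarith [real_inner_comm (N (k 0)) (fderivWithin ℝ N S (k 0) v)]

theorem IsUnitNormal.coe_shapeOperator (hS : IsC2Surface S) (hN : IsUnitNormal S N) {x : E3}
    (hx : x ∈ S) (v : tangentPlane N x) :
    (shapeOperator S N x v : E3) = -fderivWithin ℝ N S x v := by
  have hmem : -fderivWithin ℝ N S x v ∈ tangentPlane N x := by
    rw [mem_tangentPlane, inner_neg_right,
      hN.inner_fderivWithin hS hx ((hN.isTangent_iff hS hx).2 v.2), neg_zero]
  have := (tangentPlane N x).orthogonalProjectionOnto_mem_subspace_eq_self ⟨_, hmem⟩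
  exact congrArg Subtype.val this

theorem IsUnitNormal.norm_fderivWithin_le (hS : IsC2Surface S) (hN : IsUnitNormal S N) {x v : E3}
    (hx : x ∈ S) (hv : v ∈ tangentPlane N x) :
    ‖fderivWithin ℝ N S x v‖ ≤ ‖shapeOperator S N x‖ * ‖v‖ := by
  have h1 := hN.coe_shapeOperator hS hx ⟨v, hv⟩
  rw [← norm_neg, ← h1]
  exact (shapeOperator S N x).le_opNorm ⟨v, hv⟩

/-- An orthonormal basis of the tangent plane. -/
noncomputable def IsUnitNormal.tangentBasis (hN : IsUnitNormal S N) {x : E3} (hx : x ∈ S) :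
    OrthonormalBasis (Fin 2) ℝ (tangentPlane N x) :=
  (stdOrthonormalBasis ℝ (tangentPlane N x)).reindex (finCongr (hN.finrank_tangentPlane hx))

theorem IsUnitNormal.abs_meanCurvature_le (hN : IsUnitNormal S N) {x : E3} (hx : x ∈ S) :
    |meanCurvature S N x| ≤ 2 * ‖shapeOperator S N x‖ := by
  rw [meanCurvature, LinearMap.trace_eq_sum_inner _ (hN.tangentBasis hx), Fin.sum_univ_two]
  have h : ∀ i, |inner ℝ (hN.tangentBasis hx i) (shapeOperator S N x (hN.tangentBasis hx i))| ≤
      ‖shapeOperator S N x‖ := fun i => by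
    refine (abs_real_inner_le_norm _ _).trans ?_
    have h1 := (shapeOperator S N x).le_opNorm (hN.tangentBasis hx i)
    rw [(hN.tangentBasis hx).orthonormal.1 i] at *
    linarith
  refine (abs_add_le _ _).trans ?_
  have h0 := h 0
  have h1 := h 1
  simp only [ContinuousLinearMap.coe_coe] at *
  linarith

/-- The trace of the differential of the normal, expressed by triple products: this is the identity
`dN(a) × b + a × dN(b) = -H a × b`. -/
theorem IsUnitNormal.tripleProduct_add (hS : IsC2Surface S) (hN : IsUnitNormal S N) {x a b : E3}
    (hx : x ∈ S) (ha : a ∈ tangentPlane N x) (hb : b ∈ tangentPlane N x) (η : E3) :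
    tripleProduct η (fderivWithin ℝ N S x a) b + tripleProduct η a (fderivWithin ℝ N S x b) =
      -(meanCurvature S N x * tripleProduct η a b) := by
  set e := hN.tangentBasis hx with he
  have hexp : ∀ v : tangentPlane N x, (v : E3) =
      (inner ℝ (e 0) v : ℝ) • (e 0 : E3) + (inner ℝ (e 1) v : ℝ) • (e 1 : E3) := fun v => by
    have h := e.sum_repr' v
    rw [Fin.sum_univ_two] at h
    conv_lhs => rw [← h]
    rfl
  have hL : ∀ v : tangentPlane N x, fderivWithin ℝ N S x v = -(shapeOperator S N x v : E3) :=
    fun v => by rw [hN.coe_shapeOperator hS hx v, neg_neg]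
  have hH : meanCurvature S N x =
      inner ℝ (e 0) (shapeOperator S N x (e 0)) + inner ℝ (e 1) (shapeOperator S N x (e 1)) := by
    rw [meanCurvature, LinearMap.trace_eq_sum_inner _ e, Fin.sum_univ_two]; rfl
  have h0 := hL (e 0)
  have h1 := hL (e 1)
  rw [hexp (shapeOperator S N x (e 0))] at h0
  rw [hexp (shapeOperator S N x (e 1))] at h1
  obtain ⟨α, β, ha'⟩ : ∃ α β : ℝ, a = α • (e 0 : E3) + β • (e 1 : E3) := ⟨_, _, hexp ⟨a, ha⟩⟩
  obtain ⟨α', β', hb'⟩ : ∃ α β : ℝ, b = α • (e 0 : E3) + β • (e 1 : E3) := ⟨_, _, hexp ⟨b, hb⟩⟩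
  rw [ha', hb', hH]
  simp only [map_add, map_smul, h0, h1]
  simp only [map_neg, map_add, map_smul, add_apply, smul_apply, neg_apply, smul_eq_mul,
    tripleProduct_self, tripleProduct_swap η (e 1) (e 0)]
  ring

/-- The mean curvature in a chart. -/
theorem IsUnitNormal.meanCurvature_param (hS : IsC2Surface S) (hN : IsUnitNormal S N)
    (c : SurfaceChart S) {u : ℝ × ℝ} (hu : u ∈ c.domain) :
    meanCurvature S N (c.param u) * tripleProduct (N (c.param u)) (fderiv ℝ c.param u (1, 0))
        (fderiv ℝ c.param u (0, 1)) =
      -(tripleProduct (N (c.param u)) (fderiv ℝ (fun u => N (c.param u)) u (1, 0))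
          (fderiv ℝ c.param u (0, 1)) +
        tripleProduct (N (c.param u)) (fderiv ℝ c.param u (1, 0))
          (fderiv ℝ (fun u => N (c.param u)) u (0, 1))) := by
  have hx := (c.param_mem u hu).2
  have hr := c.range_fderiv_param hN hu
  rw [(hN.isC1On hS).fderiv_comp_param c hu, (hN.isC1On hS).fderiv_comp_param c hu,
    hN.tripleProduct_add hS hx (hr ▸ ⟨_, rfl⟩) (hr ▸ ⟨_, rfl⟩), neg_neg]

theorem IsUnitNormal.abs_tripleProduct_param (hN : IsUnitNormal S N) (c : SurfaceChart S)
    {u : ℝ × ℝ} (hu : u ∈ c.domain) :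
    |tripleProduct (N (c.param u)) (fderiv ℝ c.param u (1, 0)) (fderiv ℝ c.param u (0, 1))| =
      gramJac (fderiv ℝ c.param u) :=
  abs_tripleProduct_eq_gramJac (hN.norm_eq_one _ (c.param_mem u hu).2) fun w =>
    hN.orthogonal _ (c.param_mem u hu).2 _ (c.isTangent_fderiv_param hu w)

theorem _root_.ContinuousOn.tripleProduct {X : Type*} [TopologicalSpace X] {s : Set X}
    {f g h : X → E3} (hf : ContinuousOn f s) (hg : ContinuousOn g s) (hh : ContinuousOn h s) :
    ContinuousOn (fun x => QuantumLayer.tripleProduct (f x) (g x) (h x)) s := by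
  have hc : Continuous fun p : E3 × E3 × E3 => QuantumLayer.tripleProduct p.1 p.2.1 p.2.2 := by
    simp only [tripleProduct_apply]; fun_prop
  exact hc.comp_continuousOn (f := fun x => (f x, g x, h x)) (hf.prodMk (hg.prodMk hh))

theorem SurfaceChart.continuousOn_fderiv_param (c : SurfaceChart S) (w : ℝ × ℝ) :
    ContinuousOn (fun u => fderiv ℝ c.param u w) c.domain :=
  (c.contDiffOn_param.continuousOn_fderiv_of_isOpen c.isOpen_domain (by norm_num)).clm_apply
    continuousOn_const

theorem IsUnitNormal.continuousOn_meanCurvature (hS : IsC2Surface S) (hN : IsUnitNormal S N) :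
    ContinuousOn (meanCurvature S N) S := by
  intro x hx
  obtain ⟨c, hc⟩ := hS.exists_chart hx
  have hNc := (hN.isC1On hS).contDiffOn_comp_param c
  have hNd : ∀ w : ℝ × ℝ, ContinuousOn (fun u => fderiv ℝ (fun u => N (c.param u)) u w) c.domain :=
    fun w => (hNc.continuousOn_fderiv_of_isOpen c.isOpen_domain (by norm_num)).clm_apply
      continuousOn_const
  have hD0 : ∀ u ∈ c.domain, tripleProduct (N (c.param u)) (fderiv ℝ c.param u (1, 0))
      (fderiv ℝ c.param u (0, 1)) ≠ 0 := fun u hu => by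
    rw [← abs_pos, hN.abs_tripleProduct_param c hu]
    exact gramJac_pos (c.fderiv_param_injective hu)
  have h1 : ContinuousOn (fun u => meanCurvature S N (c.param u)) c.domain := by
    have h2 := (((hNc.continuousOn.tripleProduct (hNd (1, 0))
      (c.continuousOn_fderiv_param (0, 1))).add (hNc.continuousOn.tripleProduct
        (c.continuousOn_fderiv_param (1, 0)) (hNd (0, 1)))).neg).div
      (hNc.continuousOn.tripleProduct (c.continuousOn_fderiv_param (1, 0))
        (c.continuousOn_fderiv_param (0, 1))) hD0
    refine h2.congr fun u hu => ?_
    exact eq_div_of_mul_eq (hD0 u hu) (hN.meanCurvature_param hS c hu)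
  have h2 : ContinuousOn (meanCurvature S N) (c.source ∩ S) := by
    refine (h1.comp (c.contDiffOn_coord.continuousOn.mono inter_subset_left)
      fun y hy => c.coord_mem y hy).congr fun y hy => ?_
    simp only [Function.comp, c.param_coord y hy]
  exact (h2 x ⟨hc, hx⟩).mono_of_mem_nhdsWithin
    (inter_mem (mem_nhdsWithin_of_mem_nhds (c.isOpen_source.mem_nhds hc)) self_mem_nhdsWithin)

end shape

end QuantumLayer

namespace QuantumLayer

/-! ### Area on compact pieces -/

section area

variable {S : Set E3} {N : E3 → E3}

/-- A `C²` surface is relatively closed in an open set. -/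
theorem IsC2Surface.exists_isOpen (hS : IsC2Surface S) :
    ∃ O, IsOpen O ∧ S ⊆ O ∧ closure S ∩ O ⊆ S := by
  choose Φ hx h1 h2 h3 using fun x : S => hS x x.2
  refine ⟨⋃ x, (Φ x).source, isOpen_iUnion fun x => (Φ x).open_source,
    fun x hxS => mem_iUnion_of_mem ⟨x, hxS⟩ (hx ⟨x, hxS⟩), ?_⟩
  rintro y ⟨hyc, hyO⟩
  obtain ⟨x, hy⟩ := mem_iUnion.1 hyO
  refine (h3 x y hy).2 ?_
  have hcont : ContinuousAt (fun z => Φ x z 2) y :=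
    (EuclideanSpace.proj (𝕜 := ℝ) (2 : Fin 3)).continuous.continuousAt.comp
      ((Φ x).continuousAt hy)
  by_contra h0
  obtain ⟨z, ⟨hz0, hzs⟩, hzS⟩ := mem_closure_iff_nhds.1 hyc _
    (inter_mem (hcont.eventually_ne h0) ((Φ x).open_source.mem_nhds hy))
  exact hz0 ((h3 x z hzs).1 hzS)

theorem IsC2Surface.measurableSet (hS : IsC2Surface S) : MeasurableSet S := by
  obtain ⟨O, hO, hSO, h⟩ := hS.exists_isOpen
  rw [← Subset.antisymm h (subset_inter subset_closure hSO)]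
  exact isClosed_closure.measurableSet.inter hO.measurableSet

/-- The area factor of a chart is continuous. -/
theorem SurfaceChart.continuousOn_gramJac (c : SurfaceChart S) :
    ContinuousOn (fun u => gramJac (fderiv ℝ c.param u)) c.domain :=
  continuous_gramJac.comp_continuousOn
    (c.contDiffOn_param.continuousOn_fderiv_of_isOpen c.isOpen_domain (by norm_num))

theorem SurfaceChart.measure_image (c : SurfaceChart S) {s : Set (ℝ × ℝ)} (hs : MeasurableSet s)
    (hsd : s ⊆ c.domain) : (μHE[2] : Measure E3) (c.param '' s) =
      ∫⁻ u in s, ENNReal.ofReal (gramJac (fderiv ℝ c.param u)) :=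
  euclideanHausdorffMeasure_image_eq_lintegral c.isOpen_domain
    (c.contDiffOn_param.of_le (by norm_num)) hs hsd (c.injOn_param.mono hsd)
    fun _ hu => c.fderiv_param_injective (hsd hu)

theorem SurfaceChart.setIntegral_source (c : SurfaceChart S) (g : E3 → ℝ) :
    ∫ x in c.source ∩ S, g x ∂(μHE[2] : Measure E3) =
      ∫ u in c.domain, gramJac (fderiv ℝ c.param u) * g (c.param u) := by
  rw [← c.image_domain]
  exact integral_image_eq_integral_gramJac c.isOpen_domain
    (c.contDiffOn_param.of_le (by norm_num)) c.isOpen_domain.measurableSet Subset.rfl c.injOn_param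
    (fun _ hu => c.fderiv_param_injective hu) g

theorem SurfaceChart.measure_image_lt_top (c : SurfaceChart S) {s : Set (ℝ × ℝ)}
    (hs : IsCompact s) (hsd : s ⊆ c.domain) : (μHE[2] : Measure E3) (c.param '' s) < ⊤ := by
  rw [c.measure_image hs.measurableSet hsd]
  exact ((c.continuousOn_gramJac.mono hsd).integrableOn_compact hs).lintegral_lt_top

/-- Relative neighbourhoods in `S` in terms of a chart. -/
theorem SurfaceChart.image_mem_nhdsWithin (c : SurfaceChart S) {u : ℝ × ℝ} (hu : u ∈ c.domain)
    {s : Set (ℝ × ℝ)} (hs : s ∈ 𝓝 u) : c.param '' s ∈ 𝓝[S] (c.param u) := by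
  have hy := c.param_mem u hu
  have h1 : c.coord ⁻¹' s ∈ 𝓝 (c.param u) :=
    (c.contDiffAt_coord hy.1).continuousAt.preimage_mem_nhds (by rwa [c.coord_param u hu])
  filter_upwards [mem_nhdsWithin_of_mem_nhds h1, self_mem_nhdsWithin,
    mem_nhdsWithin_of_mem_nhds (c.isOpen_source.mem_nhds hy.1)] with z hz hzS hzc
  exact ⟨c.coord z, hz, c.param_coord z ⟨hzc, hzS⟩⟩

theorem IsC2Surface.measure_lt_top_of_isCompact (hS : IsC2Surface S) {K : Set E3}
    (hK : IsCompact K) (hKS : K ⊆ S) : (μHE[2] : Measure E3) K < ⊤ := by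
  refine hK.measure_lt_top_of_nhdsWithin fun x hx => ?_
  obtain ⟨c, hc⟩ := hS.exists_chart (hKS hx)
  have hu := c.coord_mem x ⟨hc, hKS hx⟩
  obtain ⟨s, hs, hsd, hsc⟩ := local_compact_nhds (c.isOpen_domain.mem_nhds hu)
  have h1 := c.image_mem_nhdsWithin hu hs
  rw [c.param_coord x ⟨hc, hKS hx⟩] at h1
  exact ⟨_, nhdsWithin_mono x hKS h1, c.measure_image_lt_top hsc hsd⟩

/-- Nonempty relatively open subsets of `S` have positive area. -/
theorem IsC2Surface.measure_pos_of_mem_nhdsWithin (hS : IsC2Surface S) {x : E3} (hx : x ∈ S)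
    {V : Set E3} (hV : V ∈ 𝓝[S] x) : 0 < (μHE[2] : Measure E3) V := by
  obtain ⟨c, hc⟩ := hS.exists_chart hx
  have hu := c.coord_mem x ⟨hc, hx⟩
  have hp := c.param_coord x ⟨hc, hx⟩
  have ht : Tendsto c.param (𝓝 (c.coord x)) (𝓝[S] x) := by
    refine tendsto_nhdsWithin_iff.2 ⟨?_, ?_⟩
    · simpa [ContinuousAt, hp] using (c.contDiffAt_param hu).continuousAt
    · filter_upwards [c.isOpen_domain.mem_nhds hu] with v hv using (c.param_mem v hv).2
  obtain ⟨s, hs, hso, hxs⟩ := mem_nhds_iff.1 (inter_mem (ht hV) (c.isOpen_domain.mem_nhds hu))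
  have hsd : s ⊆ c.domain := fun v hv => (hs hv).2
  have h1 : 0 < (μHE[2] : Measure E3) (c.param '' s) := by
    rw [c.measure_image hso.measurableSet hsd, setLIntegral_pos_iff
      (measurable_gramJac_fderiv _).ennreal_ofReal]
    have : (Function.support fun u => ENNReal.ofReal (gramJac (fderiv ℝ c.param u))) ∩ s = s := by
      refine inter_eq_right.2 fun v hv => ?_
      have := gramJac_pos (c.fderiv_param_injective (hsd hv))
      simpa using this
    rw [this]
    exact hso.measure_pos volume ⟨_, hxs⟩
  exact h1.trans_le (measure_mono (image_subset_iff.2 fun v hv => (hs hv).1))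

theorem areaMeasure_apply (hS : IsC2Surface S) {K : Set E3} (hKS : K ⊆ S) :
    areaMeasure S K = (μHE[2] : Measure E3) K := by
  rw [areaMeasure, Measure.restrict_apply' hS.measurableSet, inter_eq_left.2 hKS]

theorem IsC2Surface.integrable_of_isCompact (hS : IsC2Surface S) {K : Set E3}
    (hK : IsCompact K) (hKS : K ⊆ S) {h : E3 → ℝ} (hc : ContinuousOn h S)
    (h0 : ∀ x ∈ S, x ∉ K → h x = 0) : Integrable h (areaMeasure S) := by
  obtain ⟨M, hM⟩ := hK.exists_bound_of_continuousOn (hc.mono hKS)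
  have h1 : IntegrableOn h K (areaMeasure S) := by
    refine Measure.integrableOn_of_bounded (M := M) ?_ ?_ ?_
    · rw [areaMeasure_apply hS hKS]; exact (hS.measure_lt_top_of_isCompact hK hKS).ne
    · exact hc.aestronglyMeasurable hS.measurableSet
    · exact (ae_restrict_iff' hK.measurableSet).2 (ae_of_all _ hM)
  refine (integrableOn_iff_integrable_of_support_subset (s := K ∪ Sᶜ) ?_).1 ?_
  · intro x hx
    by_contra hn
    simp only [mem_union, mem_compl_iff, not_or, not_not] at hn
    exact hx (h0 x hn.2 hn.1)
  · refine h1.union ?_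
    rw [IntegrableOn, Measure.restrict_restrict hS.measurableSet.compl, compl_inter_self,
      Measure.restrict_empty]
    exact integrable_zero_measure

end area

/-! ### The divergence theorem for the tangential part of a constant vector -/

theorem integral_fderiv_eq_zero {f : ℝ × ℝ → ℝ} (hf : ContDiff ℝ 1 f) (hc : HasCompactSupport f)
    (v : ℝ × ℝ) : Integrable (fun u => fderiv ℝ f u v) ∧ ∫ u, fderiv ℝ f u v = 0 := by
  have h1 : Integrable (fun u => fderiv ℝ f u v) :=
    ((hf.continuous_fderiv (by norm_num)).clm_apply continuous_const).integrable_of_hasCompactSupport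
      (hc.fderiv_apply ℝ v)
  refine ⟨h1, ?_⟩
  have h := integral_mul_fderiv_eq_neg_fderiv_mul_of_integrable (μ := (volume : Measure (ℝ × ℝ)))
    (f := fun _ : ℝ × ℝ => (1 : ℝ)) (g := f) (v := v) (by simp) (by simpa using h1)
    (by simpa using hf.continuous.integrable_of_hasCompactSupport hc)
    (fun _ _ => differentiableAt_const _) (fun x _ => hf.differentiable (by norm_num) x)
  simpa using h

section divergence

variable {S : Set E3} {N : E3 → E3}

/-- The divergence of `g η^T`, where `η^T` is the tangential part of the constant vector `η`. -/
noncomputable def divTangent (S : Set E3) (N : E3 → E3) (η : E3) (g : E3 → ℝ) (x : E3) : ℝ :=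
  fderiv ℝ g x (tangentPart (N x) η) + g x * (meanCurvature S N x * inner ℝ (N x) η)

theorem IsUnitNormal.isTangent_tangentPart (hS : IsC2Surface S) (hN : IsUnitNormal S N) (η : E3)
    {x : E3} (hx : x ∈ S) : IsTangent S x (tangentPart (N x) η) :=
  (hN.isTangent_iff hS hx).2 (mem_tangentPlane.2 (inner_tangentPart (hN.norm_eq_one x hx) η))

/-- Differentials of functions which agree along `S` agree on tangent vectors. -/
theorem IsTangent.fderiv_eq {g h : E3 → ℝ} {x v : E3} (hv : IsTangent S x v) (hx : x ∈ S)
    (hg : DifferentiableAt ℝ g x) (hh : DifferentiableAt ℝ h x) (hgh : g =ᶠ[𝓝[S] x] h) :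
    fderiv ℝ g x v = fderiv ℝ h x v :=
  hv.hasFDerivWithinAt_unique hg.hasFDerivAt.hasFDerivWithinAt
    (hh.hasFDerivAt.hasFDerivWithinAt.congr_of_eventuallyEq hgh (hgh.self_of_nhdsWithin hx))

theorem eventually_eq_zero_of_notMem {g : E3 → ℝ} {K : Set E3} (hK : IsClosed K)
    (h0 : ∀ x ∈ S, x ∉ K → g x = 0) {x : E3} (hxK : x ∉ K) : g =ᶠ[𝓝[S] x] fun _ => 0 := by
  filter_upwards [self_mem_nhdsWithin, mem_nhdsWithin_of_mem_nhds (hK.isOpen_compl.mem_nhds hxK)]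
    with y hyS hyK using h0 y hyS hyK

theorem divTangent_eq_zero (hS : IsC2Surface S) (hN : IsUnitNormal S N) (η : E3) {g : E3 → ℝ}
    (hg : ContDiff ℝ 1 g) {K : Set E3} (hK : IsClosed K) (h0 : ∀ x ∈ S, x ∉ K → g x = 0) {x : E3}
    (hx : x ∈ S) (hxK : x ∉ K) : divTangent S N η g x = 0 := by
  rw [divTangent, h0 x hx hxK, (hN.isTangent_tangentPart hS η hx).fderiv_eq hx
    (hg.differentiable (by norm_num) x) (differentiableAt_const (0 : ℝ))
    (eventually_eq_zero_of_notMem hK h0 hxK)]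
  simp

theorem continuousOn_tangentPart (hN : IsUnitNormal S N) (η : E3) :
    ContinuousOn (fun x => tangentPart (N x) η) S := by
  have := hN.continuousOn
  unfold tangentPart
  fun_prop

theorem continuousOn_fderiv_tangentPart (hN : IsUnitNormal S N) (η : E3) {g : E3 → ℝ}
    (hg : ContDiff ℝ 1 g) : ContinuousOn (fun x => fderiv ℝ g x (tangentPart (N x) η)) S :=
  (hg.continuous_fderiv (by norm_num)).continuousOn.clm_apply (continuousOn_tangentPart hN η)

theorem continuousOn_meanCurvature_mul (hS : IsC2Surface S) (hN : IsUnitNormal S N) (η : E3)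
    {g : E3 → ℝ} (hg : ContinuousOn g S) :
    ContinuousOn (fun x => g x * (meanCurvature S N x * inner ℝ (N x) η)) S :=
  hg.mul ((hN.continuousOn_meanCurvature hS).mul (hN.continuousOn.inner continuousOn_const))

theorem continuousOn_divTangent (hS : IsC2Surface S) (hN : IsUnitNormal S N) (η : E3) {g : E3 → ℝ}
    (hg : ContDiff ℝ 1 g) : ContinuousOn (divTangent S N η g) S :=
  (continuousOn_fderiv_tangentPart hN η hg).add
    (continuousOn_meanCurvature_mul hS hN η hg.continuous.continuousOn)

end divergence

end QuantumLayer

namespace QuantumLayer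

section divergence

variable {S : Set E3} {N : E3 → E3}

/-- A function of class `C¹` on an open set `U` which vanishes off a compact subset of `U`, extended by
zero. -/
theorem contDiff_indicator_of_isCompact {P : ℝ × ℝ → ℝ} {U K : Set (ℝ × ℝ)} (hU : IsOpen U)
    (hP : ContDiffOn ℝ 1 P U) (hK : IsCompact K) (hKU : K ⊆ U) (h0 : ∀ u ∈ U, u ∉ K → P u = 0) :
    ContDiff ℝ 1 (K.indicator P) ∧ HasCompactSupport (K.indicator P) ∧
      ∀ u ∈ U, fderiv ℝ (K.indicator P) u = fderiv ℝ P u := by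
  have heq : EqOn (K.indicator P) P U := fun u hu => by
    by_cases h : u ∈ K
    · exact indicator_of_mem h P
    · rw [indicator_of_notMem h, h0 u hu h]
  refine ⟨contDiff_iff_contDiffAt.2 fun u => ?_, ?_, fun u hu => ?_⟩
  · by_cases hu : u ∈ U
    · exact (hP.contDiffAt (hU.mem_nhds hu)).congr_of_eventuallyEq
        (heq.eventuallyEq_of_mem (hU.mem_nhds hu))
    · refine (contDiffAt_const (c := (0 : ℝ))).congr_of_eventuallyEq ?_
      filter_upwards [hK.isClosed.isOpen_compl.mem_nhds fun h => hu (hKU h)] with v hv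
      exact indicator_of_notMem hv P
  · exact HasCompactSupport.intro hK fun u hu => indicator_of_notMem hu P
  · exact (heq.eventuallyEq_of_mem (hU.mem_nhds hu)).fderiv_eq

/-- In a chart, the divergence of `g η^T` times the triple product of the normal and the coordinate
vectors is, up to sign, the exterior derivative of the form `g det(η, N, ·)`. -/
theorem divTangent_param (hS : IsC2Surface S) (hN : IsUnitNormal S N) (η : E3) {g : E3 → ℝ}
    (hg : ContDiff ℝ 1 g) (c : SurfaceChart S) {u : ℝ × ℝ} (hu : u ∈ c.domain) :
    fderiv ℝ (fun u => g (c.param u) *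
        tripleProduct η (N (c.param u)) (fderiv ℝ c.param u (0, 1))) u (1, 0) -
      fderiv ℝ (fun u => g (c.param u) *
        tripleProduct η (N (c.param u)) (fderiv ℝ c.param u (1, 0))) u (0, 1) =
      -(divTangent S N η g (c.param u) * tripleProduct (N (c.param u)) (fderiv ℝ c.param u (1, 0))
        (fderiv ℝ c.param u (0, 1))) := by
  have hx := (c.param_mem u hu).2
  have hr := c.range_fderiv_param hN hu
  have hNu : DifferentiableAt ℝ (fun u => N (c.param u)) u :=
    (((hN.isC1On hS).contDiffOn_comp_param c).contDiffAt
      (c.isOpen_domain.mem_nhds hu)).differentiableAt (by norm_num)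
  have hgd := hg.differentiable (by norm_num) (c.param u)
  have hgu : HasFDerivAt (fun u => g (c.param u))
      ((fderiv ℝ g (c.param u)).comp (fderiv ℝ c.param u)) u :=
    hgd.hasFDerivAt.comp u (c.differentiableAt_param hu).hasFDerivAt
  have hFd : HasFDerivAt (fderiv ℝ c.param) (fderiv ℝ (fderiv ℝ c.param) u) u :=
    (((c.contDiffAt_param hu).fderiv_right (m := 1) (by norm_num)).differentiableAt
      (by norm_num)).hasFDerivAt
  have hsymm : fderiv ℝ (fderiv ℝ c.param) u (1, 0) (0, 1) =
      fderiv ℝ (fderiv ℝ c.param) u (0, 1) (1, 0) :=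
    ((c.contDiffAt_param hu).isSymmSndFDerivAt (by simp)).eq _ _
  have hder : ∀ w v : ℝ × ℝ, fderiv ℝ (fun u => g (c.param u) *
        tripleProduct η (N (c.param u)) (fderiv ℝ c.param u w)) u v =
      g (c.param u) * (tripleProduct η (N (c.param u)) (fderiv ℝ (fderiv ℝ c.param) u v w) +
        tripleProduct η (fderivWithin ℝ N S (c.param u) (fderiv ℝ c.param u v))
          (fderiv ℝ c.param u w)) +
      fderiv ℝ g (c.param u) (fderiv ℝ c.param u v) *
        tripleProduct η (N (c.param u)) (fderiv ℝ c.param u w) := by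
    intro w v
    have hw : HasFDerivAt (fun u => fderiv ℝ c.param u w)
        ((fderiv ℝ (fderiv ℝ c.param) u).flip w) u :=
      (hFd.clm_apply (hasFDerivAt_const w u)).congr_fderiv (by ext <;> simp)
    have h1 := (tripleProduct η).hasFDerivAt_of_bilinear hNu.hasFDerivAt hw
    have h2 := hgu.fun_mul h1
    rw [h2.fderiv, ← (hN.isC1On hS).fderiv_comp_param c hu]
    simp only [ContinuousLinearMap.precompR_apply, ContinuousLinearMap.precompL_apply, add_apply,
      smul_apply, smul_eq_mul, ContinuousLinearMap.comp_apply, ContinuousLinearMap.compL_apply,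
      ContinuousLinearMap.flip_apply]
    ring
  rw [hder, hder, hsymm]
  have hH := hN.tripleProduct_add hS hx (a := fderiv ℝ c.param u (1, 0))
    (b := fderiv ℝ c.param u (0, 1)) (hr ▸ ⟨_, rfl⟩) (hr ▸ ⟨_, rfl⟩) η
  obtain ⟨w, hw⟩ : tangentPart (N (c.param u)) η ∈ (fderiv ℝ c.param u).range := by
    rw [hr]; exact mem_tangentPlane.2 (inner_tangentPart (hN.norm_eq_one _ hx) η)
  have hw' : tangentPart (N (c.param u)) η =
      w.1 • fderiv ℝ c.param u (1, 0) + w.2 • fderiv ℝ c.param u (0, 1) := by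
    rw [← map_smul, ← map_smul, ← map_add]
    refine hw.symm.trans (congrArg (fderiv ℝ c.param u) ?_)
    ext <;> simp
  obtain ⟨t1, t2, t3⟩ := tripleProduct_of_tangentPart_eq hw'
  rw [tripleProduct_swap η _ (fderivWithin ℝ N S _ _), t1] at hH
  rw [divTangent, hw', map_add, map_smul, map_smul, t2, t3]
  simp only [smul_eq_mul]
  linear_combination g (c.param u) * hH

/-- The local form of the divergence theorem. -/
theorem exists_nhds_integral_divTangent_eq_zero (hS : IsC2Surface S) (hN : IsUnitNormal S N)
    {x : E3} (hx : x ∈ S) :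
    ∃ V ∈ 𝓝 x, ∀ (η : E3) (g : E3 → ℝ) (K : Set E3), ContDiff ℝ 1 g → IsCompact K → K ⊆ V ∩ S →
      (∀ y ∈ S, y ∉ K → g y = 0) → ∫ y, divTangent S N η g y ∂areaMeasure S = 0 := by
  obtain ⟨c, hc⟩ := hS.exists_chart hx
  set D : ℝ × ℝ → ℝ := fun u => tripleProduct (N (c.param u)) (fderiv ℝ c.param u (1, 0))
    (fderiv ℝ c.param u (0, 1)) with hD
  have hNc := (hN.isC1On hS).contDiffOn_comp_param c
  have hDc : ContinuousOn D c.domain := hNc.continuousOn.tripleProduct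
    (c.continuousOn_fderiv_param (1, 0)) (c.continuousOn_fderiv_param (0, 1))
  have hDJ : ∀ u ∈ c.domain, |D u| = gramJac (fderiv ℝ c.param u) := fun u hu =>
    hN.abs_tripleProduct_param c hu
  have hu₀ := c.coord_mem x ⟨hc, hx⟩
  -- the sign of the triple product at the given point
  obtain ⟨σ, hσ, hσD⟩ : ∃ σ : ℝ, |σ| = 1 ∧ 0 < σ * D (c.coord x) := by
    have h0 : D (c.coord x) ≠ 0 := by
      rw [← abs_pos, hDJ _ hu₀]
      exact gramJac_pos (c.fderiv_param_injective hu₀)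
    rcases h0.lt_or_gt with h | h
    · exact ⟨-1, by simp, by linarith⟩
    · exact ⟨1, by simp, by linarith⟩
  have hV : ∀ᶠ y in 𝓝 x, y ∈ c.source ∧ (y ∈ S → 0 < σ * D (c.coord y)) := by
    have h1 : ∀ᶠ u in 𝓝 (c.coord x), 0 < σ * D u :=
      continuousAt_const.eventually_lt
        (continuousAt_const.mul (hDc.continuousAt (c.isOpen_domain.mem_nhds hu₀))) hσD
    filter_upwards [c.isOpen_source.mem_nhds hc, (c.contDiffAt_coord hc).continuousAt.eventually h1]
      with y h2 h3 using ⟨h2, fun _ => h3⟩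
  refine ⟨_, hV, fun η g K hg hK hKV h0 => ?_⟩
  set K' := c.coord '' K with hK'
  have hK'c : IsCompact K' := hK.image_of_continuousOn
    (c.contDiffOn_coord.continuousOn.mono fun y hy => (hKV hy).1.1)
  have hK'd : K' ⊆ c.domain := by
    rintro _ ⟨y, hy, rfl⟩
    exact c.coord_mem y ⟨(hKV hy).1.1, (hKV hy).2⟩
  have hmem : ∀ u ∈ c.domain, u ∉ K' → c.param u ∉ K := fun u hu h h' =>
    h ⟨_, h', c.coord_param u hu⟩
  have hP : ∀ w : ℝ × ℝ, ContDiffOn ℝ 1 (fun u => g (c.param u) *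
      tripleProduct η (N (c.param u)) (fderiv ℝ c.param u w)) c.domain := by
    intro w
    have h1 : ContDiffOn ℝ 1 (fun u => g (c.param u)) c.domain :=
      hg.comp_contDiffOn (c.contDiffOn_param.of_le (by norm_num))
    have h2 : ContDiffOn ℝ 1 (fun u => fderiv ℝ c.param u w) c.domain :=
      (c.contDiffOn_param.fderiv_of_isOpen c.isOpen_domain (by norm_num)).clm_apply contDiffOn_const
    exact h1.mul (((tripleProduct η).contDiff.comp_contDiffOn hNc).clm_apply h2)
  have hP0 : ∀ w : ℝ × ℝ, ∀ u ∈ c.domain, u ∉ K' → g (c.param u) *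
      tripleProduct η (N (c.param u)) (fderiv ℝ c.param u w) = 0 := fun w u hu huK => by
    rw [h0 _ (c.param_mem u hu).2 (hmem u hu huK), zero_mul]
  obtain ⟨p1, p2, p3⟩ := contDiff_indicator_of_isCompact c.isOpen_domain (hP (0, 1)) hK'c hK'd
    (hP0 (0, 1))
  obtain ⟨q1, q2, q3⟩ := contDiff_indicator_of_isCompact c.isOpen_domain (hP (1, 0)) hK'c hK'd
    (hP0 (1, 0))
  obtain ⟨pi, p0⟩ := integral_fderiv_eq_zero p1 p2 (1, 0)
  obtain ⟨qi, q0⟩ := integral_fderiv_eq_zero q1 q2 (0, 1)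
  have hsum := integral_sub pi qi
  rw [p0, q0, sub_zero] at hsum
  -- the integrand vanishes off the domain of the chart
  have h1 : ∫ y, divTangent S N η g y ∂areaMeasure S =
      ∫ y in c.source ∩ S, divTangent S N η g y ∂(μHE[2] : Measure E3) := by
    refine setIntegral_eq_of_subset_of_forall_sdiff_eq_zero hS.measurableSet inter_subset_right ?_
    rintro y ⟨hy, hyc⟩
    exact divTangent_eq_zero hS hN η hg hK.isClosed h0 hy fun h => hyc ⟨(hKV h).1.1, hy⟩
  rw [h1, c.setIntegral_source]
  have h2 : ∀ u ∈ c.domain, gramJac (fderiv ℝ c.param u) * divTangent S N η g (c.param u) =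
      -σ * (fderiv ℝ (K'.indicator fun u => g (c.param u) *
        tripleProduct η (N (c.param u)) (fderiv ℝ c.param u (0, 1))) u (1, 0) -
      fderiv ℝ (K'.indicator fun u => g (c.param u) *
        tripleProduct η (N (c.param u)) (fderiv ℝ c.param u (1, 0))) u (0, 1)) := by
    intro u hu
    rw [p3 u hu, q3 u hu, divTangent_param hS hN η hg c hu]
    by_cases huK : u ∈ K'
    · obtain ⟨y, hy, rfl⟩ := huK
      have hpos := (hKV hy).1.2 (hKV hy).2
      have : gramJac (fderiv ℝ c.param (c.coord y)) = σ * D (c.coord y) := by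
        rw [← hDJ _ hu, ← abs_of_pos hpos, abs_mul, hσ, one_mul]
      rw [this]
      simp only [hD]
      ring
    · rw [divTangent_eq_zero hS hN η hg hK.isClosed h0 (c.param_mem u hu).2 (hmem u hu huK)]
      ring
  rw [setIntegral_congr_fun c.isOpen_domain.measurableSet h2, integral_const_mul]
  refine mul_eq_zero_of_right _ ?_
  rw [setIntegral_eq_integral_of_forall_compl_eq_zero, hsum]
  intro u hu
  have : ∀ P : ℝ × ℝ → ℝ, fderiv ℝ (K'.indicator P) u = 0 := fun P => by
    have : K'.indicator P =ᶠ[𝓝 u] fun _ => 0 := by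
      filter_upwards [hK'c.isClosed.isOpen_compl.mem_nhds fun h => hu (hK'd h)] with v hv
      exact indicator_of_notMem hv P
    rw [this.fderiv_eq]; simp
  rw [this, this]; simp

/-- The **divergence theorem** for `g η^T`, where `g` is a function with compact support on `S` and
`η^T` is the tangential part of a constant vector: `div η^T = H ⟪N, η⟫`. -/
theorem integral_divTangent_eq_zero (hS : IsC2Surface S) (hN : IsUnitNormal S N) (η : E3)
    {g : E3 → ℝ} {K : Set E3} (hg : ContDiff ℝ 1 g) (hK : IsCompact K) (hKS : K ⊆ S)
    (h0 : ∀ y ∈ S, y ∉ K → g y = 0) : ∫ y, divTangent S N η g y ∂areaMeasure S = 0 := by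
  choose! V hV hVg using fun (x : E3) (hx : x ∈ S) =>
    exists_nhds_integral_divTangent_eq_zero hS hN hx
  obtain ⟨t, htK, hKt⟩ := hK.elim_nhds_subcover (fun x => interior (V x))
    fun x hx => isOpen_interior.mem_nhds (mem_interior_iff_mem_nhds.2 (hV x (hKS hx)))
  obtain ⟨ρ, hρ⟩ := SmoothPartitionOfUnity.exists_isSubordinate (modelWithCornersSelf ℝ E3)
    hK.isClosed (fun x : t => interior (V x)) (fun _ => isOpen_interior) fun y hy => by
      obtain ⟨x, hx, h⟩ := mem_iUnion₂.1 (hKt hy)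
      exact mem_iUnion.2 ⟨⟨x, hx⟩, h⟩
  have hρc : ∀ i, ContDiff ℝ 1 (ρ i) := fun i => (ρ i).contMDiff.contDiff.of_le (by
    exact_mod_cast le_top)
  have hgi : ∀ i, ContDiff ℝ 1 fun y => ρ i y * g y := fun i => (hρc i).mul hg
  have hKi : ∀ i, IsCompact (K ∩ tsupport (ρ i)) := fun i => hK.inter_right (isClosed_tsupport _)
  have h0i : ∀ i, ∀ y ∈ S, y ∉ K ∩ tsupport (ρ i) → ρ i y * g y = 0 := fun i y hy hyK => by
    by_cases h : y ∈ K
    · rw [image_eq_zero_of_notMem_tsupport fun h' => hyK ⟨h, h'⟩, zero_mul]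
    · rw [h0 y hy h, mul_zero]
  have hint : ∀ i, ∫ y, divTangent S N η (fun y => ρ i y * g y) y ∂areaMeasure S = 0 := fun i =>
    hVg i (hKS (htK i i.2)) η _ _ (hgi i) (hKi i)
      (fun y hy => ⟨interior_subset (hρ i hy.2), hKS hy.1⟩) (h0i i)
  have hsum : ∀ y ∈ S, g y = ∑ i, ρ i y * g y := fun y hy => by
    by_cases h : y ∈ K
    · have := ρ.sum_eq_one h
      rw [finsum_eq_sum_of_fintype] at this
      rw [← Finset.sum_mul, this, one_mul]
    · simp [h0 y hy h]
  have hdiv : ∀ y ∈ S, divTangent S N η g y =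
      ∑ i, divTangent S N η (fun y => ρ i y * g y) y := fun y hy => by
    have h1 := (hN.isTangent_tangentPart hS η hy).fderiv_eq hy (hg.differentiable (by norm_num) y)
      (DifferentiableAt.fun_sum fun i _ => (hgi i).differentiable (by norm_num) y)
      (eventually_mem_nhdsWithin.mono fun z hz => hsum z hz)
    simp only [divTangent]
    rw [h1, fderiv_fun_sum fun i _ => (hgi i).differentiable (by norm_num) y,
      Finset.sum_add_distrib, ← Finset.sum_mul, ← hsum y hy, sum_apply]
  rw [areaMeasure, setIntegral_congr_fun hS.measurableSet hdiv, integral_finsetSum]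
  · exact Finset.sum_eq_zero fun i _ => hint i
  · intro i _
    exact hS.integrable_of_isCompact (hKi i) (inter_subset_left.trans hKS)
      (continuousOn_divTangent hS hN η (hgi i)) fun y hy hyK =>
        divTangent_eq_zero hS hN η (hgi i) (hKi i).isClosed (h0i i) hy hyK

/-- Integration by parts along `S`. -/
theorem integral_mul_meanCurvature_eq (hS : IsC2Surface S) (hN : IsUnitNormal S N) (η : E3)
    {g : E3 → ℝ} {K : Set E3} (hg : ContDiff ℝ 1 g) (hK : IsCompact K) (hKS : K ⊆ S)
    (h0 : ∀ y ∈ S, y ∉ K → g y = 0) :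
    ∫ y, g y * (meanCurvature S N y * inner ℝ (N y) η) ∂areaMeasure S =
      -∫ y, fderiv ℝ g y (tangentPart (N y) η) ∂areaMeasure S := by
  have h := integral_divTangent_eq_zero hS hN η hg hK hKS h0
  simp only [divTangent] at h
  rw [integral_add] at h
  · linarith
  · refine hS.integrable_of_isCompact hK hKS (continuousOn_fderiv_tangentPart hN η hg) ?_
    intro y hy hyK
    rw [(hN.isTangent_tangentPart hS η hy).fderiv_eq hy (hg.differentiable (by norm_num) y)
      (differentiableAt_const (0 : ℝ)) (eventually_eq_zero_of_notMem hK.isClosed h0 hyK)]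
    simp
  · refine hS.integrable_of_isCompact hK hKS
      (continuousOn_meanCurvature_mul hS hN η hg.continuous.continuousOn) ?_
    intro y hy hyK
    rw [h0 y hy hyK, zero_mul]

end divergence

end QuantumLayer

namespace QuantumLayer

/-! ### The Hopf–Rinow–Cohn-Vossen theorem -/

/-- **Hopf–Rinow–Cohn-Vossen**: closed balls of a complete, locally compact length space are
compact. -/
theorem isCompact_closedEBall_of_length {X : Type*} [EMetricSpace X] [CompleteSpace X]
    [WeaklyLocallyCompactSpace X]
    (hlen : ∀ (x y : X) (a b : ℝ≥0∞), 0 < b → edist x y < a + b → ∃ z, edist x z ≤ a ∧ edist z y < b)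
    (p : X) (R : ℝ) : IsCompact (Metric.closedEBall p (ENNReal.ofReal R)) := by
  set B : ℝ → Set X := fun r => Metric.closedEBall p (ENNReal.ofReal r) with hB
  have hBc : ∀ r, IsClosed (B r) := fun r => Metric.isClosed_closedEBall
  have hmono : ∀ {r r'}, r ≤ r' → B r ⊆ B r' := fun h =>
    Metric.closedEBall_subset_closedEBall (ENNReal.ofReal_le_ofReal h)
  have hB0 : ∀ r ≤ 0, IsCompact (B r) := fun r hr => by
    rw [hB]
    simp only [ENNReal.ofReal_of_nonpos hr, Metric.closedEBall_zero]
    exact isCompact_singleton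
  have hdown : ∀ {r r'}, r ≤ r' → IsCompact (B r') → IsCompact (B r) := fun h h' =>
    h'.of_isClosed_subset (hBc _) (hmono h)
  -- compactness passes to limits of radii, by completeness
  have hlim : ∀ x, (∀ r < x, IsCompact (B r)) → IsCompact (B x) := by
    intro x hx
    rcases le_or_gt x 0 with hx0 | hx0
    · exact hB0 x hx0
    rw [isCompact_iff_totallyBounded_isComplete]
    refine ⟨EMetric.totallyBounded_iff.2 fun ε hε => ?_, (hBc x).isComplete⟩
    obtain ⟨δ, hδ0, hδx, hδε⟩ : ∃ δ : ℝ, 0 < δ ∧ δ < x ∧ ENNReal.ofReal (2 * δ) ≤ ε / 2 := by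
      obtain ⟨q, hq0, hq⟩ := ENNReal.lt_iff_exists_nnreal_btwn.1 (ENNReal.half_pos hε.ne')
      have hq0' : (0 : ℝ) < q := by exact_mod_cast hq0
      refine ⟨min (x / 2) (q / 2), by positivity, ?_, ?_⟩
      · exact (min_le_left _ _).trans_lt (by linarith)
      · refine le_trans ?_ hq.le
        rw [← ENNReal.ofReal_coe_nnreal]
        exact ENNReal.ofReal_le_ofReal (by linarith [min_le_right (x / 2) ((q : ℝ) / 2)])
    obtain ⟨t, ht, hcov⟩ := EMetric.totallyBounded_iff.1 (hx (x - δ) (by linarith)).totallyBounded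
      (ε / 2) (ENNReal.half_pos hε.ne')
    refine ⟨t, ht, fun y hy => ?_⟩
    obtain ⟨z, hz1, hz2⟩ := hlen p y (ENNReal.ofReal (x - δ)) (ENNReal.ofReal (2 * δ))
      (ENNReal.ofReal_pos.2 (by linarith)) (by
      rw [← ENNReal.ofReal_add (by linarith) (by linarith), edist_comm]
      exact (Metric.mem_closedEBall.1 hy).trans_lt
        ((ENNReal.ofReal_lt_ofReal_iff (by linarith)).2 (by linarith)))
    obtain ⟨w, hw, hzw⟩ := mem_iUnion₂.1 (hcov (show z ∈ B (x - δ) by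
      rw [hB, Metric.mem_closedEBall, edist_comm]; exact hz1))
    refine mem_biUnion hw ?_
    rw [Metric.mem_eball] at hzw ⊢
    calc edist y w ≤ edist y z + edist z w := edist_triangle _ _ _
      _ < ε / 2 + ε / 2 := ENNReal.add_lt_add ((edist_comm y z ▸ hz2).trans_le hδε) hzw
      _ = ε := ENNReal.add_halves ε
  -- compactness propagates to slightly larger radii, by local compactness
  have hopen : ∀ x, 0 ≤ x → IsCompact (B x) → ∃ δ > 0, IsCompact (B (x + δ)) := by
    intro x hx0 hx
    obtain ⟨K, hK, hKx⟩ := exists_compact_superset hx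
    obtain ⟨δ, hδ, hδK⟩ := hx.exists_thickening_subset_open isOpen_interior hKx
    refine ⟨δ / 2, by linarith, hK.of_isClosed_subset (hBc _) fun y hy => ?_⟩
    refine interior_subset (hδK ((Metric.mem_thickening_iff_exists_edist_lt _ _).2 ?_))
    obtain ⟨z, hz1, hz2⟩ := hlen p y (ENNReal.ofReal x) (ENNReal.ofReal δ)
      (ENNReal.ofReal_pos.2 hδ) (by
      rw [← ENNReal.ofReal_add hx0 hδ.le, edist_comm]
      exact (Metric.mem_closedEBall.1 hy).trans_lt
        ((ENNReal.ofReal_lt_ofReal_iff (by linarith)).2 (by linarith)))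
    exact ⟨z, by rw [hB, Metric.mem_closedEBall, edist_comm]; exact hz1, by rwa [edist_comm]⟩
  rcases le_or_gt R 0 with hR | hR
  · exact hB0 R hR
  have hclosed : IsClosed ({r | IsCompact (B r)} ∩ Icc 0 R) := by
    refine isClosed_of_closure_subset fun x hx => ⟨hlim x fun r hr => ?_, ?_⟩
    · obtain ⟨r', hr', hr'x⟩ := mem_closure_iff.1 hx (Ioi r) isOpen_Ioi hr
      exact hdown (le_of_lt hr') hr'x.1
    · exact closure_minimal inter_subset_right isClosed_Icc hx
  refine hclosed.Icc_subset_of_forall_mem_nhdsWithin (hB0 0 le_rfl) ?_ (right_mem_Icc.2 hR.le)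
  rintro x ⟨hx, hx0, -⟩
  obtain ⟨δ, hδ, hδc⟩ := hopen x hx0 hx
  filter_upwards [Ioo_mem_nhdsGT (show x < x + δ by linarith)] with r hr
  exact hdown hr.2.le hδc

/-! ### The intrinsic distance -/

section intrinsic

variable {S : Set E3}

theorem intrinsicDist_le_eVariationOn {c : ℝ → E3} {a b : ℝ} (hab : a ≤ b)
    (hc : ContinuousOn c (Icc a b)) (hcS : MapsTo c (Icc a b) S) :
    intrinsicDist S (c a) (c b) ≤ eVariationOn c (Icc a b) := by
  let φ : ℝ → ℝ := fun t => a + t * (b - a)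
  have hφ : MapsTo φ (Icc 0 1) (Icc a b) := fun t ht => by
    constructor <;> simp only [φ] <;> nlinarith [ht.1, ht.2]
  have hmono : MonotoneOn φ (Icc 0 1) := fun s _ t _ hst => by
    simp only [φ]; nlinarith
  refine (iInf₂_le (c ∘ φ) ⟨hc.comp (by fun_prop) hφ, hcS.comp hφ, by simp [φ], by simp [φ]⟩).trans ?_
  exact eVariationOn.comp_le_of_monotoneOn c φ hmono hφ

theorem intrinsicDist_le_of_lipschitzOnWith {c : ℝ → E3} {a b : ℝ} {K : NNReal} (hab : a ≤ b)
    (hc : LipschitzOnWith K c (Icc a b)) (hcS : MapsTo c (Icc a b) S) :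
    intrinsicDist S (c a) (c b) ≤ K * ENNReal.ofReal (b - a) := by
  refine (intrinsicDist_le_eVariationOn hab hc.continuousOn hcS).trans ?_
  refine (hc.comp_eVariationOn_le (mapsTo_id _)).trans ?_
  have h := (monotoneOn_id (s := Icc a b)).eVariationOn_eq (left_mem_Icc.2 hab)
    (right_mem_Icc.2 hab)
  rw [inter_self] at h
  rw [h]; rfl

theorem edist_le_intrinsicDist (x y : E3) : edist x y ≤ intrinsicDist S x y := by
  refine le_iInf₂ fun c hc => ?_
  rw [← hc.2.2.1, ← hc.2.2.2]
  exact eVariationOn.edist_le c (left_mem_Icc.2 zero_le_one) (right_mem_Icc.2 zero_le_one)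

theorem intrinsicDist_self {x : E3} (hx : x ∈ S) : intrinsicDist S x x = 0 := by
  refine le_antisymm ?_ zero_le
  refine (intrinsicDist_le_eVariationOn (c := fun _ => x) (a := 0) (b := 0) le_rfl
    continuousOn_const fun _ _ => hx).trans ?_
  simp [eVariationOn.subsingleton]

theorem intrinsicDist_comm (x y : E3) : intrinsicDist S x y = intrinsicDist S y x := by
  have h : ∀ x y : E3, intrinsicDist S x y ≤ intrinsicDist S y x := fun x y => by
    refine le_iInf₂ fun c hc => ?_
    have hφ : MapsTo (fun t : ℝ => 1 - t) (Icc 0 1) (Icc 0 1) := fun t ht =>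
      ⟨by linarith [ht.2], by linarith [ht.1]⟩
    refine (iInf₂_le (c ∘ fun t => 1 - t) ⟨hc.1.comp (by fun_prop) hφ, hc.2.1.comp hφ,
      by simp [hc.2.2.2], by simp [hc.2.2.1]⟩).trans ?_
    exact eVariationOn.comp_le_of_antitoneOn c _ (fun s _ t _ hst => by linarith) hφ
  exact le_antisymm (h x y) (h y x)

theorem intrinsicDist_triangle (x y z : E3) :
    intrinsicDist S x z ≤ intrinsicDist S x y + intrinsicDist S y z := by
  simp only [intrinsicDist]
  refine ENNReal.le_iInf₂_add_iInf₂ fun c hc d hd => ?_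
  -- concatenate the two paths
  let e : ℝ → E3 := fun t => if t ≤ 1 then c t else d (t - 1)
  have h1 : EqOn e c (Icc 0 1) := fun t ht => if_pos ht.2
  have h2 : EqOn e (d ∘ fun t => t - 1) (Icc 1 2) := fun t ht => by
    by_cases h : t ≤ 1
    · obtain rfl : t = 1 := le_antisymm h ht.1
      simp [e, hc.2.2.2, hd.2.2.1]
    · simp [e, h]
  have hφ : MapsTo (fun t : ℝ => t - 1) (Icc 1 2) (Icc 0 1) := fun t ht =>
    ⟨by linarith [ht.1], by linarith [ht.2]⟩
  have hU : Icc (0 : ℝ) 2 = Icc 0 1 ∪ Icc 1 2 := (Icc_union_Icc_eq_Icc zero_le_one one_le_two).symm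
  have hcont : ContinuousOn e (Icc 0 2) := by
    rw [hU]
    exact (hc.1.congr h1).union_of_isClosed ((hd.1.comp (by fun_prop) hφ).congr h2) isClosed_Icc
      isClosed_Icc
  have hmap : MapsTo e (Icc 0 2) S := by
    rw [hU]
    exact (hc.2.1.congr h1.symm).union ((hd.2.1.comp hφ).congr h2.symm)
  have h := intrinsicDist_le_eVariationOn zero_le_two hcont hmap
  have he0 : e 0 = x := by rw [h1 (left_mem_Icc.2 zero_le_one), hc.2.2.1]
  have he2 : e 2 = z := by
    rw [h2 (right_mem_Icc.2 one_le_two), Function.comp, ← hd.2.2.2]; norm_num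
  rw [he0, he2, ← univ_inter (Icc (0 : ℝ) 2),
    ← eVariationOn.Icc_add_Icc e zero_le_one one_le_two (mem_univ 1), univ_inter, univ_inter,
    eVariationOn.congr h1, eVariationOn.congr h2] at h
  exact h.trans (add_le_add le_rfl
    (eVariationOn.comp_le_of_monotoneOn d _ (fun s _ t _ hst => by linarith) hφ))

/-- Nearby points of `S` are close for the intrinsic distance. -/
theorem IsC2Surface.eventually_intrinsicDist_lt (hS : IsC2Surface S) {x : E3} (hx : x ∈ S)
    {ε : ℝ≥0∞} (hε : 0 < ε) : ∀ᶠ y in 𝓝[S] x, intrinsicDist S x y < ε := by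
  obtain ⟨c, hc⟩ := hS.exists_chart hx
  have hu := c.coord_mem x ⟨hc, hx⟩
  have hp := c.param_coord x ⟨hc, hx⟩
  obtain ⟨K, t, ht, hK⟩ := ((c.contDiffAt_param hu).of_le (m := 1)
    (by norm_num)).exists_lipschitzOnWith
  obtain ⟨r, hr, hrt⟩ := Metric.mem_nhds_iff.1 (inter_mem ht (c.isOpen_domain.mem_nhds hu))
  have hcont := (c.contDiffAt_coord hc).continuousAt
  have hlim : Tendsto (fun y => (K : ℝ≥0∞) * ‖c.coord y - c.coord x‖₊) (𝓝 x) (𝓝 0) := by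
    have h1 : Tendsto (fun y => ‖c.coord y - c.coord x‖₊) (𝓝 x) (𝓝 0) := by
      have := (tendsto_iff_norm_sub_tendsto_zero.1 hcont).nnnorm
      simpa using this
    simpa using ENNReal.Tendsto.const_mul (ENNReal.tendsto_coe.2 h1)
      (Or.inr (ENNReal.coe_ne_top (r := K)))
  filter_upwards [mem_nhdsWithin_of_mem_nhds (hlim.eventually_lt_const hε), self_mem_nhdsWithin,
    mem_nhdsWithin_of_mem_nhds (c.isOpen_source.mem_nhds hc),
    mem_nhdsWithin_of_mem_nhds (hcont.preimage_mem_nhds (Metric.ball_mem_nhds _ hr))]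
    with y hy hyS hyc hyr
  -- the straight segment in the chart
  let l : ℝ → ℝ × ℝ := fun s => c.coord x + s • (c.coord y - c.coord x)
  have hl : MapsTo l (Icc 0 1) (Metric.ball (c.coord x) r) := fun s hs =>
    (convex_ball (c.coord x) r).add_smul_sub_mem (Metric.mem_ball_self hr) hyr hs
  have hlip : LipschitzOnWith ‖c.coord y - c.coord x‖₊ l (Icc 0 1) := by
    refine LipschitzOnWith.of_dist_le_mul fun s _ s' _ => ?_
    simp only [l, dist_eq_norm, add_sub_add_left_eq_sub, ← sub_smul, norm_smul, coe_nnnorm]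
    rw [mul_comm]
  have h := intrinsicDist_le_of_lipschitzOnWith (S := S) zero_le_one
    ((hK.mono fun v hv => (hrt hv).1).comp hlip hl)
    fun s hs => (c.param_mem _ (hrt (hl hs)).2).2
  have e0 : (c.param ∘ l) 0 = x := by simp [l, hp]
  have e1 : (c.param ∘ l) 1 = y := by simp [l, c.param_coord y ⟨hyc, hyS⟩]
  rw [e0, e1, sub_zero, ENNReal.ofReal_one, mul_one] at h
  refine h.trans_lt ?_
  rwa [ENNReal.coe_mul]

/-- The surface `S`, equipped with its intrinsic distance. -/
def Intrinsic (S : Set E3) : Type := S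

noncomputable instance : EMetricSpace (Intrinsic S) where
  edist x y := intrinsicDist S x.1 y.1
  edist_self x := intrinsicDist_self x.2
  edist_comm x y := intrinsicDist_comm x.1 y.1
  edist_triangle x y z := intrinsicDist_triangle x.1 y.1 z.1
  eq_of_edist_eq_zero {x y} h := Subtype.ext (edist_eq_zero.1
    (le_antisymm ((edist_le_intrinsicDist (S := S) x.1 y.1).trans h.le) zero_le))

/-- The inclusion into space of the surface with its intrinsic distance. -/
def Intrinsic.val (x : Intrinsic S) : E3 := x.1

/-- The points of the surface, as points of the surface with its intrinsic distance. -/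
def Intrinsic.mk (x : S) : Intrinsic S := x

theorem Intrinsic.val_mem (x : Intrinsic S) : x.val ∈ S := x.2

theorem Intrinsic.continuous_val : Continuous (Intrinsic.val : Intrinsic S → E3) :=
  (LipschitzWith.of_edist_le fun _ _ => edist_le_intrinsicDist (S := S) _ _).continuous

theorem Intrinsic.continuous_mk (hS : IsC2Surface S) :
    Continuous (Intrinsic.mk : S → Intrinsic S) := by
  refine continuous_iff_continuousAt.2 fun x => EMetric.tendsto_nhds.2 fun ε hε => ?_
  have h := hS.eventually_intrinsicDist_lt x.2 hε
  rw [nhdsWithin_eq_map_subtype_coe x.2, eventually_map] at h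
  filter_upwards [h] with y hy
  rw [edist_comm]; exact hy

theorem Intrinsic.isCompact_preimage (hS : IsC2Surface S) {K : Set E3} (hK : IsCompact K)
    (hKS : K ⊆ S) : IsCompact (Intrinsic.val ⁻¹' K : Set (Intrinsic S)) := by
  have h1 : IsCompact ((↑) ⁻¹' K : Set S) := by
    rw [Subtype.isCompact_iff, Subtype.image_preimage_coe, inter_eq_right.2 hKS]; exact hK
  have h2 := h1.image (Intrinsic.continuous_mk hS)
  convert h2 using 1
  ext x
  exact ⟨fun hx => ⟨x, hx, rfl⟩, by rintro ⟨y, hy, rfl⟩; exact hy⟩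

theorem Intrinsic.weaklyLocallyCompactSpace (hS : IsC2Surface S) :
    WeaklyLocallyCompactSpace (Intrinsic S) where
  exists_compact_mem_nhds x := by
    obtain ⟨c, hc⟩ := hS.exists_chart x.val_mem
    have hu := c.coord_mem x.val ⟨hc, x.val_mem⟩
    obtain ⟨s, hs, hsd, hsc⟩ := local_compact_nhds (c.isOpen_domain.mem_nhds hu)
    have hK : IsCompact (c.param '' s) := hsc.image_of_continuousOn
      (c.contDiffOn_param.continuousOn.mono hsd)
    have hKS : c.param '' s ⊆ S := image_subset_iff.2 fun v hv => (c.param_mem v (hsd hv)).2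
    refine ⟨_, Intrinsic.isCompact_preimage hS hK hKS, ?_⟩
    have h1 := c.image_mem_nhdsWithin hu hs
    rw [c.param_coord _ ⟨hc, x.val_mem⟩] at h1
    exact (tendsto_nhdsWithin_iff.2 ⟨Intrinsic.continuous_val.continuousAt,
      Eventually.of_forall fun y => y.val_mem⟩ : Tendsto Intrinsic.val (𝓝 x) (𝓝[S] x.val)) h1

theorem Intrinsic.completeSpace (hc : IsCompleteSurface S) : CompleteSpace (Intrinsic S) := by
  refine EMetric.complete_of_cauchySeq_tendsto fun u hu => ?_
  rw [EMetric.cauchySeq_iff] at hu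
  obtain ⟨x, hx, hux⟩ := hc (fun n => (u n).val) (fun n => (u n).val_mem) hu
  exact ⟨⟨x, hx⟩, tendsto_iff_edist_tendsto_0.2 hux⟩

/-- The intrinsic distance is a length distance. -/
theorem Intrinsic.exists_between (hS : IsC2Surface S) (x y : Intrinsic S) (a b : ℝ≥0∞)
    (hb : 0 < b) (h : edist x y < a + b) : ∃ z, edist x z ≤ a ∧ edist z y < b := by
  rcases le_or_gt (edist x y) a with hxy | hxy
  · exact ⟨y, hxy, by rwa [edist_self]⟩
  obtain ⟨c, hc⟩ := iInf_lt_iff.1 h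
  obtain ⟨⟨hcc, hcS, hc0, hc1⟩, hcv⟩ := iInf_lt_iff.1 hc
  -- by continuity there is a point of the path at distance `a` from its origin
  let γ : Icc (0 : ℝ) 1 → Intrinsic S := fun t => ⟨c t, hcS t.2⟩
  have hγ : Continuous γ := (Intrinsic.continuous_mk hS).comp
    (hcc.domRestrict.subtype_mk fun t => hcS t.2)
  have hγ0 : γ ⟨0, left_mem_Icc.2 zero_le_one⟩ = x := Subtype.ext hc0
  have hγ1 : γ ⟨1, right_mem_Icc.2 zero_le_one⟩ = y := Subtype.ext hc1
  obtain ⟨t, ht⟩ : a ∈ range fun t => edist x (γ t) := by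
    refine intermediate_value_univ (X := Icc (0 : ℝ) 1) ⟨0, left_mem_Icc.2 zero_le_one⟩
      ⟨1, right_mem_Icc.2 zero_le_one⟩ (continuous_const.edist hγ) ⟨?_, ?_⟩
    · rw [hγ0, edist_self]; exact zero_le
    · rw [hγ1]; exact hxy.le
  refine ⟨γ t, ht.le, ?_⟩
  have h0 : Icc 0 (t : ℝ) ⊆ Icc 0 1 := Icc_subset_Icc le_rfl t.2.2
  have h1 : Icc (t : ℝ) 1 ⊆ Icc 0 1 := Icc_subset_Icc t.2.1 le_rfl
  have hv0 := intrinsicDist_le_eVariationOn t.2.1 (hcc.mono h0) (hcS.mono h0 Subset.rfl)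
  have hv1 := intrinsicDist_le_eVariationOn t.2.2 (hcc.mono h1) (hcS.mono h1 Subset.rfl)
  rw [hc0] at hv0
  rw [hc1] at hv1
  have hadd := eVariationOn.Icc_add_Icc c t.2.1 t.2.2 (mem_univ (t : ℝ))
  simp only [univ_inter] at hadd
  rw [← hadd] at hcv
  have ha : a ≤ eVariationOn c (Icc 0 t) := ht ▸ hv0
  have ha' : a ≠ ⊤ := hxy.ne_top
  exact hv1.trans_lt ((ENNReal.add_lt_add_iff_left ha').1 ((add_le_add ha le_rfl).trans_lt hcv))

theorem isCompact_intrinsic_closedBall (hS : IsC2Surface S) (hc : IsCompleteSurface S) {p : E3}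
    (hp : p ∈ S) (R : ℝ) : IsCompact {x | x ∈ S ∧ intrinsicDist S p x ≤ ENNReal.ofReal R} := by
  have := Intrinsic.completeSpace hc
  have := Intrinsic.weaklyLocallyCompactSpace hS
  have h := (isCompact_closedEBall_of_length (Intrinsic.exists_between hS) (Intrinsic.mk ⟨p, hp⟩)
    R).image Intrinsic.continuous_val
  convert h using 1
  ext x
  constructor
  · rintro ⟨hx, hpx⟩
    exact ⟨Intrinsic.mk ⟨x, hx⟩, by rw [Metric.mem_closedEBall, edist_comm]; exact hpx, rfl⟩
  · rintro ⟨y, hy, rfl⟩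
    rw [Metric.mem_closedEBall, edist_comm] at hy
    exact ⟨y.val_mem, hy⟩

/-- Open intrinsic balls are relatively open. -/
theorem exists_isOpen_intrinsic_ball (hS : IsC2Surface S) {p : E3} (r : ℝ≥0∞) :
    ∃ U, IsOpen U ∧ {x | x ∈ S ∧ intrinsicDist S p x < r} = U ∩ S := by
  have h : ∀ x ∈ S, intrinsicDist S p x < r → ∀ᶠ y in 𝓝[S] x, intrinsicDist S p y < r := by
    intro x hx hxr
    obtain ⟨ε, hε, hxε⟩ : ∃ ε > 0, intrinsicDist S p x + ε ≤ r :=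
      ⟨r - intrinsicDist S p x, tsub_pos_iff_lt.2 hxr, (add_tsub_cancel_of_le hxr.le).le⟩
    filter_upwards [hS.eventually_intrinsicDist_lt hx hε] with y hy
    exact (intrinsicDist_triangle p x y).trans_lt
      ((ENNReal.add_lt_add_left hxr.ne_top hy).trans_le hxε)
  refine ⟨⋃₀ {U | IsOpen U ∧ ∀ y ∈ U ∩ S, intrinsicDist S p y < r},
    isOpen_sUnion fun U hU => hU.1, Subset.antisymm ?_ ?_⟩
  · rintro x ⟨hx, hxr⟩
    obtain ⟨U, hU, hxU, hUS⟩ := mem_nhdsWithin.1 (h x hx hxr)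
    exact ⟨⟨U, ⟨hU, hUS⟩, hxU⟩, hx⟩
  · rintro x ⟨⟨U, hU, hxU⟩, hx⟩
    exact ⟨hx, hU.2 x ⟨hxU, hx⟩⟩

theorem isPreconnected_intrinsic_ball {p : E3} (r : ℝ≥0∞) :
    IsPreconnected {x | x ∈ S ∧ intrinsicDist S p x < r} := by
  refine isPreconnected_of_forall p fun x hx => ?_
  obtain ⟨c, hc⟩ := iInf_lt_iff.1 hx.2
  obtain ⟨⟨hcc, hcS, hc0, hc1⟩, hcv⟩ := iInf_lt_iff.1 hc
  refine ⟨c '' Icc 0 1, ?_, ⟨0, left_mem_Icc.2 zero_le_one, hc0⟩,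
    ⟨1, right_mem_Icc.2 zero_le_one, hc1⟩, isPreconnected_Icc.image c hcc⟩
  rintro _ ⟨t, ht, rfl⟩
  have h0 : Icc 0 t ⊆ Icc 0 1 := Icc_subset_Icc le_rfl ht.2
  refine ⟨hcS ht, ?_⟩
  rw [← hc0]
  exact ((intrinsicDist_le_eVariationOn ht.1 (hcc.mono h0) (hcS.mono h0 Subset.rfl)).trans
    (eVariationOn.mono c h0)).trans_lt hcv

theorem intrinsicDist_lt_top (hS : IsC2Surface S) (hconn : IsConnected S) {p x : E3} (hp : p ∈ S)
    (hx : x ∈ S) : intrinsicDist S p x < ⊤ := by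
  have h1 : IsClopen (Metric.eball (Intrinsic.mk ⟨p, hp⟩) ⊤) :=
    ⟨Metric.isClosed_eball_top, Metric.isOpen_eball⟩
  have : PreconnectedSpace S := isPreconnected_iff_preconnectedSpace.1 hconn.isPreconnected
  have h2 := (h1.preimage (Intrinsic.continuous_mk hS)).eq_univ
    ⟨⟨p, hp⟩, Metric.mem_eball_self ENNReal.coe_lt_top⟩
  have h3 : (⟨x, hx⟩ : S) ∈ Intrinsic.mk ⁻¹' Metric.eball (Intrinsic.mk ⟨p, hp⟩) ⊤ :=
    h2 ▸ mem_univ _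
  rw [mem_preimage, Metric.mem_eball, edist_comm] at h3
  exact h3

/-- Compact subsets of `S` lie in intrinsic balls. -/
theorem exists_subset_intrinsic_ball (hS : IsC2Surface S) (hconn : IsConnected S) {p : E3}
    (hp : p ∈ S) {K : Set E3} (hK : IsCompact K) (hKS : K ⊆ S) :
    ∃ R : ℝ, 0 < R ∧ K ⊆ {x | x ∈ S ∧ intrinsicDist S p x < ENNReal.ofReal R} := by
  choose U hU hUb using fun n : ℕ =>
    exists_isOpen_intrinsic_ball hS (p := p) (ENNReal.ofReal (n + 1))
  have hmono : Monotone fun n : ℕ =>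
      {x | x ∈ S ∧ intrinsicDist S p x < ENNReal.ofReal (n + 1)} := fun m n hmn x hx =>
    ⟨hx.1, hx.2.trans_le (ENNReal.ofReal_le_ofReal (by gcongr))⟩
  obtain ⟨t, ht⟩ := hK.elim_finite_subcover U hU fun x hx => by
    obtain ⟨n, hn⟩ := ENNReal.exists_nat_gt (intrinsicDist_lt_top hS hconn hp (hKS hx)).ne
    have h1 : x ∈ U n ∩ S := hUb n ▸ ⟨hKS hx, hn.trans_le (by
      rw [← ENNReal.ofReal_natCast]
      exact ENNReal.ofReal_le_ofReal (by linarith))⟩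
    exact mem_iUnion.2 ⟨n, h1.1⟩
  obtain ⟨M, hM⟩ := t.exists_le
  refine ⟨M + 1, by positivity, fun x hx => ?_⟩
  obtain ⟨n, hn, hxn⟩ := mem_iUnion₂.1 (ht hx)
  exact hmono (hM n hn) ((hUb n).symm.subset ⟨hxn, hKS hx⟩)

end intrinsic

end QuantumLayer

/-! ### Extension from the surface and smoothing -/

namespace QuantumLayer

/-- A function of class `C¹` along `S` which vanishes on `S` off a compact set `K` is the restriction
of a `C¹` function on `ℝ³` supported near `K`: glue the local extensions by a partition of unity. -/
theorem IsC1On.exists_contDiff_extension {S K Ω : Set E3} {g : E3 → ℝ} (hg : IsC1On S g)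
    (hK : IsCompact K) (hKS : K ⊆ S) (hΩ : IsOpen Ω) (hKΩ : K ⊆ Ω)
    (h0 : ∀ x ∈ S, x ∉ K → g x = 0) :
    ∃ G : E3 → ℝ, ContDiff ℝ 1 G ∧ HasCompactSupport G ∧ tsupport G ⊆ Ω ∧ EqOn G g S := by
  obtain ⟨Q, hQ, hKQ, hQΩ⟩ := exists_compact_between hK hΩ hKΩ
  let t : E3 → Set ℝ := fun x => {y | (x ∈ S → y = g x) ∧ (x ∉ Q → y = 0)}
  have ht : ∀ x, Convex ℝ (t x) := by
    intro x y hy z hz a b _ _ hab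
    refine ⟨fun hx => ?_, fun hx => ?_⟩
    · rw [hy.1 hx, hz.1 hx, ← add_smul, hab, one_smul]
    · rw [hy.2 hx, hz.2 hx, smul_zero, smul_zero, add_zero]
  obtain ⟨G, hG⟩ := exists_contMDiffMap_forall_mem_convex_of_local
    (modelWithCornersSelf ℝ E3) (n := 1) (t := t) ht (by
      intro x
      by_cases hx : x ∈ K
      · obtain ⟨G, hG, he⟩ := hg x (hKS hx)
        obtain ⟨u, hu, hGu⟩ := hG.contDiffOn le_rfl (by simp)
        refine ⟨u ∩ (interior Q ∩ {y | y ∈ S → g y = G y}), inter_mem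
          (by simpa using hu)
          (inter_mem (isOpen_interior.mem_nhds (hKQ hx)) (eventually_nhdsWithin_iff.1 he)), G,
          contMDiffOn_iff_contDiffOn.2 (hGu.mono inter_subset_left), fun y hy => ⟨fun hyS =>
            (hy.2.2 hyS).symm, fun hyQ => (hyQ (interior_subset hy.2.1)).elim⟩⟩
      · exact ⟨Kᶜ, hK.isClosed.isOpen_compl.mem_nhds hx, fun _ => 0,
          contMDiffOn_const, fun y hy => ⟨fun hyS => (h0 y hyS hy).symm, fun _ => rfl⟩⟩)
  have hsupp : tsupport G ⊆ Q := closure_minimal (fun x hx => by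
    by_contra h
    exact hx ((hG x).2 h)) hQ.isClosed
  exact ⟨G, G.contMDiff.contDiff, HasCompactSupport.of_support_subset_isCompact hQ
    ((subset_tsupport _).trans hsupp), hsupp.trans hQΩ, fun x hx => (hG x).1 hx⟩

/-- Mollification approximates a compactly supported `C¹` function by smooth functions, uniformly
together with the first derivatives, without enlarging the support much. -/
theorem exists_contDiff_approx_fderiv {G : E3 → ℝ} (hG : ContDiff ℝ 1 G)
    (hc : HasCompactSupport G) {ε δ : ℝ} (hε : 0 < ε) (hδ : 0 < δ) :
    ∃ j : E3 → ℝ, ContDiff ℝ ∞ j ∧ Function.support j ⊆ Metric.thickening δ (tsupport G) ∧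
      (∀ x, |j x - G x| ≤ ε) ∧ ∀ x, ‖fderiv ℝ j x - fderiv ℝ G x‖ ≤ ε := by
  have hdc : Continuous (fderiv ℝ G) := hG.continuous_fderiv (by norm_num)
  obtain ⟨r₁, hr₁, h1⟩ := Metric.uniformContinuous_iff.1
    (hc.uniformContinuous_of_continuous hG.continuous) ε hε
  obtain ⟨r₂, hr₂, h2⟩ := Metric.uniformContinuous_iff.1
    ((hc.fderiv (𝕜 := ℝ)).uniformContinuous_of_continuous hdc) ε hε
  set r := min δ (min r₁ r₂) with hr
  have hr0 : 0 < r := lt_min hδ (lt_min hr₁ hr₂)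
  let φ : ContDiffBump (0 : E3) := ⟨r / 2, r, half_pos hr0, half_lt_self hr0⟩
  let j : E3 → ℝ := convolution (φ.normed volume) G (ContinuousLinearMap.lsmul ℝ ℝ) volume
  have hφi : LocallyIntegrable (φ.normed (volume : Measure E3)) volume :=
    φ.continuous_normed.locallyIntegrable
  have hfd : ∀ x, fderiv ℝ j x = convolution (φ.normed volume) (fderiv ℝ G)
      (ContinuousLinearMap.lsmul ℝ ℝ) volume x := fun x => by
    rw [(hc.hasFDerivAt_convolution_right (ContinuousLinearMap.lsmul ℝ ℝ) hφi hG x).fderiv]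
    rfl
  refine ⟨j, ?_, ?_, fun x => ?_, fun x => ?_⟩
  · exact φ.hasCompactSupport_normed.contDiff_convolution_left _ φ.contDiff_normed
      hG.continuous.locallyIntegrable
  · intro x hx
    by_contra hxn
    refine hx ?_
    have h3 : ∀ y ∈ Metric.ball x φ.rOut, G y = 0 := fun y hy => by
      by_contra hy0
      refine hxn (Metric.mem_thickening_iff.2 ⟨y, subset_tsupport G hy0, ?_⟩)
      rw [dist_comm]
      exact (Metric.mem_ball.1 hy).trans_le (min_le_left _ _)
    have h4 := φ.dist_normed_convolution_le (μ := volume) (g := G) (x₀ := x) (ε := 0)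
      hG.continuous.aestronglyMeasurable (fun y hy => by
        rw [h3 y hy, h3 x (Metric.mem_ball_self φ.rOut_pos), dist_self])
    have h5 := dist_le_zero.1 h4
    rw [h3 x (Metric.mem_ball_self φ.rOut_pos)] at h5
    exact h5
  · rw [← Real.dist_eq]
    refine φ.dist_normed_convolution_le hG.continuous.aestronglyMeasurable fun y hy => (h1 ?_).le
    exact (Metric.mem_ball.1 hy).trans_le ((min_le_right _ _).trans (min_le_left _ _))
  · rw [← dist_eq_norm, hfd]
    refine φ.dist_normed_convolution_le hdc.aestronglyMeasurable fun y hy => (h2 ?_).le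
    exact (Metric.mem_ball.1 hy).trans_le ((min_le_right _ _).trans (min_le_right _ _))

theorem gradNormSq_nonneg (N : E3 → E3) (j : E3 → ℝ) (x : E3) : 0 ≤ gradNormSq N j x := sq_nonneg _

theorem gradNormSq_le (N : E3 → E3) (j : E3 → ℝ) (x : E3) :
    gradNormSq N j x ≤ ‖fderiv ℝ j x‖ ^ 2 := by
  unfold gradNormSq
  gcongr
  refine (ContinuousLinearMap.opNorm_comp_le _ _).trans ?_
  exact mul_le_of_le_one_right (norm_nonneg _) (Submodule.norm_subtypeL_le _)

theorem gradNormSq_le_sq {N : E3 → E3} {j : E3 → ℝ} {x : E3} {M : ℝ} (hM : 0 ≤ M)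
    (h : ∀ v ∈ tangentPlane N x, |fderiv ℝ j x v| ≤ M * ‖v‖) : gradNormSq N j x ≤ M ^ 2 :=
  pow_le_pow_left₀ (norm_nonneg (fderiv ℝ j x ∘L (tangentPlane N x).subtypeL))
    (ContinuousLinearMap.opNorm_le_bound _ hM fun v => h _ (Subtype.coe_prop v)) 2

theorem tendsto_gradNormSq (N : E3 → E3) {j : ℕ → E3 → ℝ} {G : E3 → ℝ} {x : E3}
    (h : Tendsto (fun n => fderiv ℝ (j n) x) atTop (𝓝 (fderiv ℝ G x))) :
    Tendsto (fun n => gradNormSq N (j n) x) atTop (𝓝 (gradNormSq N G x)) := by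
  have hc : Continuous fun l : E3 →L[ℝ] ℝ => l ∘L (tangentPlane N x).subtypeL :=
    continuous_id.clm_comp continuous_const
  have h1 : Tendsto (fun n => fderiv ℝ (j n) x ∘L (tangentPlane N x).subtypeL) atTop
      (𝓝 (fderiv ℝ G x ∘L (tangentPlane N x).subtypeL)) := (hc.tendsto _).comp h
  have h2 : Tendsto (fun n => ‖fderiv ℝ (j n) x ∘L (tangentPlane N x).subtypeL‖) atTop
      (𝓝 ‖fderiv ℝ G x ∘L (tangentPlane N x).subtypeL‖) :=
    ((continuous_norm (E := tangentPlane N x →L[ℝ] ℝ)).tendsto _).comp h1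
  exact h2.pow 2

theorem gradNormSq_eq {N : E3 → E3} {j : E3 → ℝ} {x : E3} (hx : ‖N x‖ = 1) :
    gradNormSq N j x =
      ‖fderiv ℝ j x - fderiv ℝ j x (N x) • innerSL ℝ (N x)‖ ^ 2 := by
  have key : ∀ v, (fderiv ℝ j x - fderiv ℝ j x (N x) • innerSL ℝ (N x)) v =
      fderiv ℝ j x (tangentPart (N x) v) := fun v => by
    simp [tangentPart, mul_comm]
  have hmem : ∀ v, tangentPart (N x) v ∈ tangentPlane N x := fun v =>
    mem_tangentPlane.2 (by rw [inner_tangentPart hx])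
  unfold gradNormSq
  congr 1
  refine le_antisymm (ContinuousLinearMap.opNorm_le_bound _ (by positivity) fun v => ?_)
    (ContinuousLinearMap.opNorm_le_bound _ (by positivity) fun v => ?_)
  · have h1 := (fderiv ℝ j x - fderiv ℝ j x (N x) • innerSL ℝ (N x)).le_opNorm (v : E3)
    have h2 : tangentPart (N x) (v : E3) = v := by
      rw [tangentPart, mem_tangentPlane.1 v.2, zero_smul, sub_zero]
    rw [key, h2] at h1
    exact h1
  · rw [key]
    refine ((fderiv ℝ j x ∘L (tangentPlane N x).subtypeL).le_opNorm
      ⟨tangentPart (N x) v, hmem v⟩).trans ?_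
    exact mul_le_mul_of_nonneg_left (norm_tangentPart_le hx v) (norm_nonneg _)

theorem IsUnitNormal.continuousOn_gradNormSq {S : Set E3} {N : E3 → E3} (hN : IsUnitNormal S N)
    {j : E3 → ℝ} (hj : ContDiff ℝ 1 j) : ContinuousOn (gradNormSq N j) S := by
  have hdc : Continuous (fderiv ℝ j) := hj.continuous_fderiv (by norm_num)
  refine ContinuousOn.congr (f := fun x =>
    ‖fderiv ℝ j x - fderiv ℝ j x (N x) • innerSL ℝ (N x)‖ ^ 2) ?_
    fun x hx => gradNormSq_eq (hN.norm_eq_one x hx)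
  have h1 : ContinuousOn (fun x => innerSL ℝ (N x)) S :=
    (innerSL ℝ).continuous.comp_continuousOn hN.continuousOn
  exact ((hdc.continuousOn.sub
    ((hdc.continuousOn.clm_apply hN.continuousOn).smul h1)).norm).pow 2

/-- It suffices to find `C¹` test functions: a strict inequality survives smoothing. -/
theorem exists_isTestFunctionOutside {S : Set E3} {N : E3 → E3} (hS : IsC2Surface S)
    (hN : IsUnitNormal S N) (hcomplete : IsCompleteSurface S) {p : E3} (hp : p ∈ S) {R ε₀ : ℝ}
    {g : E3 → ℝ} (hg : IsC1On S g) {K : Set E3} (hK : IsCompact K) (hKS : K ⊆ S)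
    (hKR : ∀ x ∈ K, ENNReal.ofReal R < intrinsicDist S p x) (h0 : ∀ x ∈ S, x ∉ K → g x = 0)
    (hlt : ∀ G : E3 → ℝ, ContDiff ℝ 1 G → EqOn G g S →
      ε₀ * ∫ x, (gradNormSq N G x + G x ^ 2) ∂areaMeasure S <
        (∫ x, meanCurvature S N x * G x ∂areaMeasure S) ^ 2) :
    ∃ j : E3 → ℝ, IsTestFunctionOutside S p R j ∧
      (∫ x, meanCurvature S N x * j x ∂areaMeasure S) ^ 2 >
        ε₀ * ∫ x, (gradNormSq N j x + j x ^ 2) ∂areaMeasure S := by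
  obtain ⟨O, hO, hSO, hOS⟩ := hS.exists_isOpen
  have hB := isCompact_intrinsic_closedBall hS hcomplete hp R
  set B := {x | x ∈ S ∧ intrinsicDist S p x ≤ ENNReal.ofReal R} with hBdef
  have hΩ : IsOpen (O ∩ Bᶜ) := hO.inter hB.isClosed.isOpen_compl
  obtain ⟨G, hG, hGc, hGΩ, hGg⟩ := hg.exists_contDiff_extension hK hKS hΩ
    (fun x hx => ⟨hSO (hKS hx), fun h => (hKR x hx).not_ge h.2⟩) h0
  have hlt := hlt G hG hGg
  obtain ⟨δ, hδ, hδΩ⟩ := hGc.isCompact.exists_cthickening_subset_open hΩ hGΩ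
  set Q := Metric.cthickening δ (tsupport G) with hQ
  have hQc : IsCompact Q := hGc.isCompact.cthickening
  have hQS : Q ∩ S = Q ∩ closure S := Subset.antisymm
    (inter_subset_inter_right _ subset_closure)
    fun x hx => ⟨hx.1, hOS ⟨hx.2, (hδΩ hx.1).1⟩⟩
  have hQSc : IsCompact (Q ∩ S) := hQS ▸ hQc.inter_right isClosed_closure
  have hQfin := hS.measure_lt_top_of_isCompact hQSc inter_subset_right
  choose j hj hjs hj0 hj1 using fun n : ℕ =>
    exists_contDiff_approx_fderiv hG hGc (Nat.one_div_pos_of_nat (α := ℝ) (n := n)) hδ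
  have hjQ : ∀ n, tsupport (j n) ⊆ Q := fun n => closure_minimal
    ((hjs n).trans (Metric.thickening_subset_cthickening _ _)) Metric.isClosed_cthickening
  have hjC1 : ∀ n, ContDiff ℝ 1 (j n) := fun n => (hj n).of_le (by exact_mod_cast le_top)
  have hT0 : ∀ x, Tendsto (fun n => j n x) atTop (𝓝 (G x)) := fun x => by
    refine tendsto_iff_dist_tendsto_zero.2 (squeeze_zero (fun _ => dist_nonneg) (fun n => ?_)
      tendsto_one_div_add_atTop_nhds_zero_nat)
    rw [Real.dist_eq]
    exact hj0 n x
  have hT1 : ∀ x, Tendsto (fun n => fderiv ℝ (j n) x) atTop (𝓝 (fderiv ℝ G x)) := fun x => by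
    refine tendsto_iff_dist_tendsto_zero.2 (squeeze_zero (fun _ => dist_nonneg) (fun n => ?_)
      tendsto_one_div_add_atTop_nhds_zero_nat)
    rw [dist_eq_norm]
    exact hj1 n x
  have hone : ∀ n : ℕ, (1 : ℝ) / (n + 1) ≤ 1 := fun n => by
    rw [div_le_one (by positivity)]
    linarith [n.cast_nonneg (α := ℝ)]
  have hbd0 : ∀ n x, |j n x| ≤ |G x| + 1 := fun n x => by
    have h1 := abs_sub_abs_le_abs_sub (j n x) (G x)
    linarith [hj0 n x, hone n]
  have hbd1 : ∀ n x, ‖fderiv ℝ (j n) x‖ ≤ ‖fderiv ℝ G x‖ + 1 := fun n x => by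
    have h1 := norm_sub_norm_le (fderiv ℝ (j n) x) (fderiv ℝ G x)
    linarith [hj1 n x, hone n]
  have hz : ∀ n x, x ∉ Q → j n x = 0 := fun n x hx => image_eq_zero_of_notMem_tsupport
    fun h => hx (hjQ n h)
  have hz1 : ∀ n x, x ∉ Q → fderiv ℝ (j n) x = 0 := fun n x hx => image_eq_zero_of_notMem_tsupport
    fun h => hx (hjQ n (tsupport_fderiv_subset ℝ h))
  -- functions supported on `Q ∩ S` serve as integrable majorants
  have hint : ∀ h : E3 → ℝ, ContinuousOn h S →
      Integrable ((Q ∩ S).indicator h) (areaMeasure S) := fun h hh => by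
    rw [integrable_indicator_iff hQSc.measurableSet]
    obtain ⟨M, hM⟩ := hQSc.exists_bound_of_continuousOn (hh.mono inter_subset_right)
    refine IntegrableOn.of_bound (C := M) ?_ ?_ ?_
    · exact (Measure.restrict_apply_le _ _).trans_lt hQfin
    · exact (hh.mono inter_subset_right).aestronglyMeasurable hQSc.measurableSet
    · exact (ae_restrict_iff' hQSc.measurableSet).2 (Eventually.of_forall hM)
  have hHc := hN.continuousOn_meanCurvature hS
  have hae : ∀ {P : E3 → Prop}, (∀ x ∈ S, P x) → ∀ᵐ x ∂areaMeasure S, P x := fun {P} h =>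
    (ae_restrict_iff' hS.measurableSet).2 (Eventually.of_forall h)
  have hI1 : Tendsto (fun n => ∫ x, meanCurvature S N x * j n x ∂areaMeasure S) atTop
      (𝓝 (∫ x, meanCurvature S N x * G x ∂areaMeasure S)) := by
    refine tendsto_integral_of_dominated_convergence
      ((Q ∩ S).indicator fun x => |meanCurvature S N x| * (|G x| + 1)) (fun n => ?_)
      (hint _ (hHc.abs.mul (hG.continuous.abs.continuousOn.add continuousOn_const)))
      (fun n => hae fun x hx => ?_)
      (hae fun x _ => (hT0 x).const_mul _)
    · exact (hHc.mul (hj n).continuous.continuousOn).aestronglyMeasurable hS.measurableSet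
    · by_cases hxQ : x ∈ Q
      · rw [indicator_of_mem (show x ∈ Q ∩ S from ⟨hxQ, hx⟩), norm_mul, Real.norm_eq_abs, Real.norm_eq_abs]
        exact mul_le_mul_of_nonneg_left (hbd0 n x) (abs_nonneg _)
      · rw [hz n x hxQ, mul_zero, norm_zero]
        exact indicator_nonneg (fun y _ => by positivity) x
  have hI2 : Tendsto (fun n => ∫ x, (gradNormSq N (j n) x + j n x ^ 2) ∂areaMeasure S) atTop
      (𝓝 (∫ x, (gradNormSq N G x + G x ^ 2) ∂areaMeasure S)) := by
    refine tendsto_integral_of_dominated_convergence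
      ((Q ∩ S).indicator fun x => (‖fderiv ℝ G x‖ + 1) ^ 2 + (|G x| + 1) ^ 2) (fun n => ?_)
      (hint _ (Continuous.continuousOn ?_)) (fun n => hae fun x hx => ?_)
      (hae fun x _ => ?_)
    · exact ((hN.continuousOn_gradNormSq (hjC1 n)).add
        ((hj n).continuous.continuousOn.pow 2)).aestronglyMeasurable hS.measurableSet
    · exact (((hG.continuous_fderiv (by norm_num)).norm.add continuous_const).pow 2).add
        ((hG.continuous.abs.add continuous_const).pow 2)
    · rw [Real.norm_eq_abs, abs_of_nonneg (add_nonneg (gradNormSq_nonneg _ _ _) (sq_nonneg _))]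
      by_cases hxQ : x ∈ Q
      · rw [indicator_of_mem (show x ∈ Q ∩ S from ⟨hxQ, hx⟩)]
        refine add_le_add ((gradNormSq_le N _ x).trans
          (pow_le_pow_left₀ (norm_nonneg _) (hbd1 n x) 2)) ?_
        rw [← sq_abs]
        exact pow_le_pow_left₀ (abs_nonneg _) (hbd0 n x) 2
      · have h1 := gradNormSq_le N (j n) x
        rw [hz1 n x hxQ, norm_zero] at h1
        rw [hz n x hxQ]
        exact (by linarith : gradNormSq N (j n) x + 0 ^ 2 ≤ 0).trans
          (indicator_nonneg (fun y _ => by positivity) x)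
    · exact (tendsto_gradNormSq N (hT1 x)).add ((hT0 x).pow 2)
  obtain ⟨n, hn⟩ := ((hI2.const_mul ε₀).eventually_lt (hI1.pow 2) hlt).exists
  refine ⟨j n, ⟨hj n, Q ∩ S, inter_subset_right, hQSc, fun x hx => ?_, fun x hx hxj => ?_⟩, hn⟩
  · exact not_le.1 fun h => (hδΩ hx.1).2 ⟨hx.2, h⟩
  · exact ⟨by_contra fun h => hxj (hz n x h), hx⟩

end QuantumLayer

/-! ### The collar of a tamed curve -/

namespace QuantumLayer

section GramJac

variable {l : ℝ × ℝ →L[ℝ] E3}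

theorem clm_prod_apply (l : ℝ × ℝ →L[ℝ] E3) (w : ℝ × ℝ) :
    l w = w.1 • l (1, 0) + w.2 • l (0, 1) := by
  rw [← map_smul, ← map_smul, ← map_add]; simp

/-- Cramer's rule: the second coordinate of the tangential part of `η` in the frame
`l (1, 0), l (0, 1)`. -/
theorem gramJac_sq_mul_snd (w : ℝ × ℝ) {η : E3} (h : ∀ u, inner ℝ η (l u) = inner ℝ (l w) (l u)) :
    gramJac l ^ 2 * w.2 = ‖l (1, 0)‖ ^ 2 * inner ℝ η (l (0, 1)) -
      inner ℝ (l (1, 0)) (l (0, 1)) * inner ℝ η (l (1, 0)) := by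
  rw [h, h, gramJac_sq, clm_prod_apply l w, inner_add_left, inner_add_left, real_inner_smul_left,
    real_inner_smul_left, real_inner_smul_left, real_inner_smul_left, real_inner_self_eq_norm_sq,
    real_inner_self_eq_norm_sq, real_inner_comm (l (1, 0)) (l (0, 1))]
  ring

theorem gramJac_le {A : ℝ} (h : ∀ a b : ℝ, ‖l (a, b)‖ ≤ A * √(a ^ 2 + b ^ 2)) :
    gramJac l ≤ A ^ 2 := by
  have h1 := h 1 0
  have h2 := h 0 1
  norm_num at h1 h2
  refine abs_le_of_sq_le_sq' ?_ (sq_nonneg A) |>.2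
  rw [gramJac_sq]
  have h3 : ‖l (1, 0)‖ ^ 2 ≤ A ^ 2 := pow_le_pow_left₀ (norm_nonneg _) h1 2
  have h4 : ‖l (0, 1)‖ ^ 2 ≤ A ^ 2 := pow_le_pow_left₀ (norm_nonneg _) h2 2
  nlinarith [mul_le_mul h3 h4 (sq_nonneg _) (sq_nonneg A), sq_nonneg (inner ℝ (l (1, 0)) (l (0, 1)))]

theorem le_gramJac {A : ℝ} (hA : 0 < A) (h : ∀ a b : ℝ, √(a ^ 2 + b ^ 2) ≤ A * ‖l (a, b)‖) :
    (A ^ 2)⁻¹ ≤ gramJac l := by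
  have hsq : ∀ a b : ℝ, (A ^ 2)⁻¹ * (a ^ 2 + b ^ 2) ≤ ‖l (a, b)‖ ^ 2 := fun a b => by
    have h1 := pow_le_pow_left₀ (Real.sqrt_nonneg _) (h a b) 2
    rw [Real.sq_sqrt (by positivity), mul_pow] at h1
    rw [inv_mul_le_iff₀ (by positivity)]
    exact h1
  have hE := hsq 1 0
  -- the quadratic form evaluated at the vector which is conjugate to the first basis vector
  have hform := hsq (-(inner ℝ (l (1, 0)) (l (0, 1)))) (‖l (1, 0)‖ ^ 2)
  rw [clm_prod_apply l (-(inner ℝ (l (1, 0)) (l (0, 1))), ‖l (1, 0)‖ ^ 2), norm_add_sq_real,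
    norm_smul, norm_smul, mul_pow, mul_pow, Real.norm_eq_abs, Real.norm_eq_abs, sq_abs, sq_abs,
    real_inner_smul_left, real_inner_smul_right] at hform
  have hg := gramJac_sq l
  simp only at hform
  set E := ‖l (1, 0)‖ ^ 2
  set F := (inner ℝ (l (1, 0)) (l (0, 1)) : ℝ)
  set G := ‖l (0, 1)‖ ^ 2
  have hm : 0 < (A ^ 2)⁻¹ := by positivity
  set m := (A ^ 2)⁻¹
  have hE' : m ≤ E := by linarith
  have hE0 : 0 < E := hm.trans_le hE'
  refine abs_le_of_sq_le_sq' ?_ (gramJac_nonneg l) |>.2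
  have h5 : E * (m * E) ≤ E * gramJac l ^ 2 := by nlinarith [sq_nonneg F]
  nlinarith [le_of_mul_le_mul_left h5 hE0]

theorem injective_of_sqrt_le {A : ℝ} (h : ∀ a b : ℝ, √(a ^ 2 + b ^ 2) ≤ A * ‖l (a, b)‖) :
    Function.Injective l := by
  refine (injective_iff_map_eq_zero l).2 fun w hw => ?_
  have h1 := h w.1 w.2
  rw [Prod.mk.eta, hw, norm_zero, mul_zero] at h1
  have h2 := Real.sqrt_eq_zero'.1 (h1.antisymm (Real.sqrt_nonneg _))
  exact Prod.ext (pow_eq_zero_iff two_ne_zero |>.1 (by nlinarith [sq_nonneg w.1, sq_nonneg w.2]))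
    (pow_eq_zero_iff two_ne_zero |>.1 (by nlinarith [sq_nonneg w.1, sq_nonneg w.2]))

end GramJac

/-- Near a point of `S`, the inverse of an immersed `C¹` parametrisation of `S` is the restriction to
`S` of a `C¹` map. -/
theorem exists_contDiffAt_inverse {S : Set E3} (hS : IsC2Surface S) {f : ℝ × ℝ → E3} {q : ℝ × ℝ}
    (hf : ContDiffAt ℝ 1 f q) (hfS : ∀ᶠ u in 𝓝 q, f u ∈ S)
    (hinj : Function.Injective (fderiv ℝ f q)) :
    ∃ Ψ : E3 → ℝ × ℝ, ContDiffAt ℝ 1 Ψ (f q) ∧ Ψ (f q) = q ∧ ∀ᶠ y in 𝓝[S] (f q), f (Ψ y) = y := by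
  obtain ⟨ch, hch⟩ := hS.exists_chart hfS.self_of_nhds
  have hfd := (hf.differentiableAt (by norm_num)).hasFDerivAt
  have hcd := ((ch.contDiffAt_coord hch).of_le (by norm_num : (1 : ℕ∞ω) ≤ 2))
  set h : ℝ × ℝ → ℝ × ℝ := fun u => ch.coord (f u) with hh
  have hsrc : ∀ᶠ u in 𝓝 q, f u ∈ ch.source ∩ S :=
    (hf.continuousAt.eventually (ch.isOpen_source.mem_nhds hch)).and hfS
  have hhc : ContDiffAt ℝ 1 h q := hcd.comp q hf
  have hhd := (hhc.differentiableAt (by norm_num)).hasFDerivAt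
  have hhinj : Function.Injective (fderiv ℝ h q) := by
    have hu := ch.coord_mem _ ⟨hch, hfS.self_of_nhds⟩
    have h1 := ((ch.differentiableAt_param hu).hasFDerivAt.comp q hhd)
    have h2 := h1.unique (hfd.congr_of_eventuallyEq
      (hsrc.mono fun u hu => ch.param_coord _ hu))
    intro a b hab
    refine hinj ?_
    rw [← h2]
    exact congrArg (fderiv ℝ ch.param (h q)) hab
  let e : (ℝ × ℝ) ≃L[ℝ] ℝ × ℝ := (LinearEquiv.ofInjectiveEndo (fderiv ℝ h q).toLinearMap
    hhinj).toContinuousLinearEquiv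
  have hee : (e : (ℝ × ℝ) →L[ℝ] ℝ × ℝ) = fderiv ℝ h q := rfl
  have hhe : HasFDerivAt h (e : (ℝ × ℝ) →L[ℝ] ℝ × ℝ) q := hee ▸ hhd
  have hst := hhc.hasStrictFDerivAt' hhe (by norm_num)
  have hΨ1 := hhc.to_localInverse hhe (by norm_num)
  set Λ := hhc.localInverse hhe (by norm_num) with hΛ
  have hΛq : Λ (h q) = q := hhc.localInverse_apply_image hhe (by norm_num)
  refine ⟨fun y => Λ (ch.coord y), ?_, hΛq, ?_⟩
  · exact ContDiffAt.comp (f q) hΨ1 hcd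
  · have hr : ∀ᶠ z in 𝓝 (h q), h (Λ z) = z := hst.eventually_right_inverse
    have hcc : Tendsto ch.coord (𝓝[S] f q) (𝓝 (h q)) :=
      (ch.contDiffAt_coord hch).continuousAt.tendsto.mono_left nhdsWithin_le_nhds
    have hΛc : Tendsto Λ (𝓝 (h q)) (𝓝 q) := by
      have := hΨ1.continuousAt.tendsto
      rwa [hΛq] at this
    filter_upwards [hcc.eventually hr, (hΛc.comp hcc).eventually hsrc, self_mem_nhdsWithin,
      mem_nhdsWithin_of_mem_nhds (ch.isOpen_source.mem_nhds hch)] with y h1 h2 h3 h4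
    have h5 := congrArg ch.param h1
    rw [ch.param_coord y ⟨h4, h3⟩] at h5
    exact (ch.param_coord _ h2).symm.trans h5

/-- The parametrisation of the collar by arc length on the curve `c` and distance from it. -/
abbrev collarMap (σ : E3 → ℝ → E3) (c : ℝ → E3) (q : ℝ × ℝ) : E3 := σ (c q.1) q.2

/-- The part of the collar of `C` where the parameter of the normal geodesics lies in `J`. -/
def collar (σ : E3 → ℝ → E3) (C : Set E3) (J : Set ℝ) : Set E3 := {y | ∃ x ∈ C, ∃ t ∈ J, σ x t = y}

open Classical in
/-- The signed distance from `C` in the collar of width `δ`: the parameter `t` of the point `σ x t`;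
zero off the collar. -/
noncomputable def signedDist (σ : E3 → ℝ → E3) (C : Set E3) (δ : ℝ) (y : E3) : ℝ :=
  if h : ∃ t ∈ Ioo (-δ) δ, ∃ x ∈ C, σ x t = y then h.choose else 0

open Classical in
/-- The profile `φ` of the signed distance in the collar, extended by the indicator of `D`. -/
noncomputable def cutoff (D : Set E3) (σ : E3 → ℝ → E3) (C : Set E3) (δ : ℝ) (φ : ℝ → ℝ) (y : E3) : ℝ :=
  if y ∈ collar σ C (Ioo (-δ) δ) then φ (signedDist σ C δ y) else if y ∈ D then 1 else 0

section collar

variable {S C D : Set E3} {m : ℕ} {L : Fin m → ℝ} {c : Fin m → ℝ → E3} {γ : E3 → E3}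
  {σ : E3 → ℝ → E3} {δ A : ℝ}

theorem IsClosedCurve.mem (hC : IsClosedCurve C L c) (i : Fin m) (s : ℝ) : c i s ∈ C := by
  rw [hC.union_eq]; exact mem_iUnion.2 ⟨i, s, rfl⟩

theorem IsClosedCurve.exists_eq (hC : IsClosedCurve C L c) {x : E3} (hx : x ∈ C) :
    ∃ i, ∃ s ∈ Ico 0 (L i), c i s = x := by
  rw [hC.union_eq] at hx
  obtain ⟨i, s, rfl⟩ := mem_iUnion.1 hx
  obtain ⟨s', hs', he⟩ := (hC.periodic i).exists_mem_Ico₀ (hC.period_pos i) s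
  exact ⟨i, s', hs', he.symm⟩

theorem IsClosedCurve.eq_of_eq (hC : IsClosedCurve C L c) {i i' : Fin m} {s s' : ℝ}
    (hs : s ∈ Ico 0 (L i)) (hs' : s' ∈ Ico 0 (L i')) (h : c i s = c i' s') : i = i' ∧ s = s' := by
  obtain ⟨rfl, k, hk⟩ := hC.simple i s i' s' h
  refine ⟨rfl, ?_⟩
  have hL := hC.period_pos i
  have h1 : (k : ℝ) < 1 := by
    by_contra hk1
    nlinarith [hs.2, hs'.1, not_lt.1 hk1]
  have h2 : (-1 : ℝ) < k := by
    by_contra hk1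
    nlinarith [hs.1, hs'.2, not_lt.1 hk1]
  have h3 : k = 0 := by
    have h1' : k < 1 := by exact_mod_cast h1
    have h2' : -1 < k := by exact_mod_cast h2
    omega
  rw [h3] at hk
  push_cast at hk
  linarith

theorem collar_eq_iUnion (hC : IsClosedCurve C L c) (J : Set ℝ) :
    collar σ C J = ⋃ i, collarMap σ (c i) '' (Ico 0 (L i) ×ˢ J) := by
  ext y
  simp only [collar, mem_ofPred_eq, mem_iUnion, mem_image, mem_prod, Prod.exists, collarMap]
  constructor
  · rintro ⟨x, hx, t, ht, rfl⟩
    obtain ⟨i, s, hs, rfl⟩ := hC.exists_eq hx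
    exact ⟨i, s, t, ⟨hs, ht⟩, rfl⟩
  · rintro ⟨i, s, t, ⟨_, ht⟩, rfl⟩
    exact ⟨c i s, hC.mem i s, t, ht, rfl⟩

theorem collar_mono {J J' : Set ℝ} (h : J ⊆ J') : collar σ C J ⊆ collar σ C J' :=
  fun _ ⟨x, hx, t, ht, e⟩ => ⟨x, hx, t, h ht, e⟩

theorem IsTamed.mem (hT : IsTamed S C c γ σ δ A) {x : E3} (hx : x ∈ C) {t : ℝ}
    (ht : t ∈ Ioo (-δ) δ) : σ x t ∈ S :=
  ((hT.geodesic x hx).2.2.2 t ht).1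

theorem IsTamed.collar_subset (hT : IsTamed S C c γ σ δ A) {J : Set ℝ} (hJ : J ⊆ Ioo (-δ) δ) :
    collar σ C J ⊆ S := by
  rintro _ ⟨x, hx, t, ht, rfl⟩
  exact hT.mem hx (hJ ht)

theorem isOpen_strip (δ : ℝ) : IsOpen ((univ : Set ℝ) ×ˢ Ioo (-δ) δ) := isOpen_univ.prod isOpen_Ioo

theorem IsTamed.contDiffAt (hT : IsTamed S C c γ σ δ A) (i : Fin m) {q : ℝ × ℝ}
    (hq : q.2 ∈ Ioo (-δ) δ) : ContDiffAt ℝ 1 (collarMap σ (c i)) q :=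
  (hT.contDiffOn i).contDiffAt ((isOpen_strip δ).mem_nhds ⟨mem_univ _, hq⟩)

theorem IsTamed.injective_fderiv (hT : IsTamed S C c γ σ δ A) (i : Fin m) {q : ℝ × ℝ}
    (hq : q.2 ∈ Ioo (-δ) δ) : Function.Injective (fderiv ℝ (collarMap σ (c i)) q) :=
  injective_of_sqrt_le (hT.inv_deriv_le i q.1 q.2 hq)

theorem eventually_mem_strip {q : ℝ × ℝ} (hq : q.2 ∈ Ioo (-δ) δ) :
    ∀ᶠ u : ℝ × ℝ in 𝓝 q, u.2 ∈ Ioo (-δ) δ :=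
  continuous_snd.continuousAt.eventually (isOpen_Ioo.mem_nhds hq)

theorem IsTamed.exists_inverse (hS : IsC2Surface S) (hC : IsClosedCurve C L c)
    (hT : IsTamed S C c γ σ δ A) (i : Fin m) {q : ℝ × ℝ} (hq : q.2 ∈ Ioo (-δ) δ) :
    ∃ Ψ : E3 → ℝ × ℝ, ContDiffAt ℝ 1 Ψ (collarMap σ (c i) q) ∧
      ∀ᶠ y in 𝓝[S] (collarMap σ (c i) q), (Ψ y).2 ∈ Ioo (-δ) δ ∧ collarMap σ (c i) (Ψ y) = y := by
  obtain ⟨Ψ, h1, h2, h3⟩ := exists_contDiffAt_inverse hS (hT.contDiffAt i hq)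
    ((eventually_mem_strip hq).mono fun u hu => hT.mem (hC.mem i u.1) hu) (hT.injective_fderiv i hq)
  refine ⟨Ψ, h1, Eventually.and ?_ h3⟩
  have h4 := h1.continuousAt.tendsto
  rw [h2] at h4
  exact (h4.mono_left nhdsWithin_le_nhds).eventually (eventually_mem_strip hq)

theorem IsTamed.signedDist_apply (hT : IsTamed S C c γ σ δ A) {x : E3} (hx : x ∈ C) {t : ℝ}
    (ht : t ∈ Ioo (-δ) δ) : signedDist σ C δ (σ x t) = t := by
  have h : ∃ t' ∈ Ioo (-δ) δ, ∃ x' ∈ C, σ x' t' = σ x t := ⟨t, ht, x, hx, rfl⟩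
  rw [signedDist, dif_pos h]
  obtain ⟨h1, x', hx', h2⟩ := h.choose_spec
  exact (hT.injective x' hx' x hx _ h1 t ht h2).2

theorem IsTamed.cutoff_apply (hT : IsTamed S C c γ σ δ A) (φ : ℝ → ℝ) {x : E3} (hx : x ∈ C) {t : ℝ}
    (ht : t ∈ Ioo (-δ) δ) : cutoff D σ C δ φ (σ x t) = φ t := by
  rw [cutoff, if_pos ⟨x, hx, t, ht, rfl⟩, hT.signedDist_apply hx ht]

theorem IsTamed.isCompact_collar (hC : IsClosedCurve C L c) (hT : IsTamed S C c γ σ δ A) {a : ℝ}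
    (ha : a < δ) : IsCompact (collar σ C (Icc (-a) a)) := by
  have hsub : Icc (-a) a ⊆ Ioo (-δ) δ := fun t ht => ⟨by linarith [ht.1], by linarith [ht.2]⟩
  have h : collar σ C (Icc (-a) a) = ⋃ i, collarMap σ (c i) '' (Icc 0 (L i) ×ˢ Icc (-a) a) := by
    refine Subset.antisymm ?_ ?_
    · rw [collar_eq_iUnion hC]
      exact iUnion_mono fun i => image_mono (prod_mono Ico_subset_Icc_self Subset.rfl)
    · refine iUnion_subset fun i => ?_
      rintro _ ⟨q, hq, rfl⟩
      exact ⟨_, hC.mem i q.1, _, hq.2, rfl⟩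
  rw [h]
  refine isCompact_iUnion fun i => (isCompact_Icc.prod isCompact_Icc).image_of_continuousOn ?_
  exact fun q hq => (hT.contDiffAt i (hsub hq.2)).continuousAt.continuousWithinAt

theorem IsTamed.injOn (hC : IsClosedCurve C L c) (hT : IsTamed S C c γ σ δ A) (i : Fin m) :
    InjOn (collarMap σ (c i)) (Ico 0 (L i) ×ˢ Ioo (-δ) δ) := by
  intro q hq q' hq' h
  obtain ⟨h1, h2⟩ := hT.injective _ (hC.mem i q.1) _ (hC.mem i q'.1) _ hq.2 _ hq'.2 h
  exact Prod.ext (hC.eq_of_eq hq.1 hq'.1 h1).2 h2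

theorem IsTamed.pairwise_disjoint (hC : IsClosedCurve C L c) (hT : IsTamed S C c γ σ δ A)
    {J : Set ℝ} (hJ : J ⊆ Ioo (-δ) δ) :
    Pairwise (Function.onFun Disjoint fun i => collarMap σ (c i) '' (Ico 0 (L i) ×ˢ J)) := by
  intro i i' hi
  refine disjoint_left.2 ?_
  rintro _ ⟨q, hq, rfl⟩ ⟨q', hq', h⟩
  have h1 := (hT.injective _ (hC.mem i' q'.1) _ (hC.mem i q.1) _ (hJ hq'.2) _ (hJ hq.2) h).1
  exact hi (hC.eq_of_eq hq'.1 hq.1 h1).1.symm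

theorem IsTamed.measurableSet_image (hC : IsClosedCurve C L c) (hT : IsTamed S C c γ σ δ A)
    (i : Fin m) {J : Set ℝ} (hJ : J ⊆ Ioo (-δ) δ) (hJm : MeasurableSet J) :
    MeasurableSet (collarMap σ (c i) '' (Ico 0 (L i) ×ˢ J)) :=
  (measurableSet_Ico.prod hJm).image_of_continuousOn_injOn
    (fun _ hq => (hT.contDiffAt i (hJ hq.2)).continuousAt.continuousWithinAt)
    ((hT.injOn hC i).mono (prod_mono Subset.rfl hJ))

theorem IsTamed.measurableSet_collar (hC : IsClosedCurve C L c) (hT : IsTamed S C c γ σ δ A)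
    {J : Set ℝ} (hJ : J ⊆ Ioo (-δ) δ) (hJm : MeasurableSet J) : MeasurableSet (collar σ C J) := by
  rw [collar_eq_iUnion hC]
  exact MeasurableSet.iUnion fun i => hT.measurableSet_image hC i hJ hJm

/-- The area of the collar, from the area formula. -/
theorem IsTamed.measure_collar (hC : IsClosedCurve C L c) (hT : IsTamed S C c γ σ δ A) :
    (μHE[2] : Measure E3) (collar σ C (Ioo (-δ) δ)) = ∑ i, ∫⁻ q in Ico 0 (L i) ×ˢ Ioo (-δ) δ,
      ENNReal.ofReal (gramJac (fderiv ℝ (collarMap σ (c i)) q)) := by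
  rw [collar_eq_iUnion hC, measure_iUnion (hT.pairwise_disjoint hC Subset.rfl)
    fun i => hT.measurableSet_image hC i Subset.rfl measurableSet_Ioo, tsum_fintype]
  refine Finset.sum_congr rfl fun i _ => ?_
  exact euclideanHausdorffMeasure_image_eq_lintegral (isOpen_strip δ) (hT.contDiffOn i)
    (measurableSet_Ico.prod measurableSet_Ioo) (prod_mono (subset_univ _) Subset.rfl)
    (hT.injOn hC i) fun q hq => hT.injective_fderiv i hq.2

theorem volume_box (a δ : ℝ) :
    volume (Ico 0 a ×ˢ Ioo (-δ) δ) = ENNReal.ofReal a * ENNReal.ofReal (2 * δ) := by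
  rw [Measure.volume_eq_prod, Measure.prod_prod, Real.volume_Ico, Real.volume_Ioo]
  congr 2 <;> ring

theorem IsClosedCurve.sum_nonneg (hC : IsClosedCurve C L c) : 0 ≤ ∑ i, L i :=
  Finset.sum_nonneg fun i _ => (hC.period_pos i).le

theorem IsClosedCurve.sum_ofReal_mul (hC : IsClosedCurve C L c) {B : ℝ} (hB : 0 ≤ B) (δ : ℝ) :
    ∑ i, ENNReal.ofReal B * (ENNReal.ofReal (L i) * ENNReal.ofReal (2 * δ)) =
      ENNReal.ofReal (B * (2 * δ) * ∑ i, L i) := by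
  rw [mul_comm (B * (2 * δ)), ENNReal.ofReal_mul hC.sum_nonneg, ENNReal.ofReal_sum_of_nonneg
    fun i _ => (hC.period_pos i).le, ENNReal.ofReal_mul hB, Finset.sum_mul]
  exact Finset.sum_congr rfl fun i _ => by ring

theorem IsTamed.measure_collar_le (hC : IsClosedCurve C L c) (hT : IsTamed S C c γ σ δ A) :
    (μHE[2] : Measure E3) (collar σ C (Ioo (-δ) δ)) ≤
      ENNReal.ofReal (A ^ 2 * (2 * δ) * ∑ i, L i) := by
  rw [hT.measure_collar hC]
  calc _ ≤ ∑ i, ENNReal.ofReal (A ^ 2) * (ENNReal.ofReal (L i) * ENNReal.ofReal (2 * δ)) := by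
        refine Finset.sum_le_sum fun i _ => ?_
        rw [← volume_box, ← setLIntegral_const]
        refine setLIntegral_mono' (measurableSet_Ico.prod measurableSet_Ioo) fun q hq => ?_
        exact ENNReal.ofReal_le_ofReal (gramJac_le (hT.deriv_le i q.1 q.2 hq.2))
    _ = _ := hC.sum_ofReal_mul (sq_nonneg A) δ

theorem IsTamed.le_measure_collar (hA : 0 < A) (hC : IsClosedCurve C L c)
    (hT : IsTamed S C c γ σ δ A) : ENNReal.ofReal ((A ^ 2)⁻¹ * (2 * δ) * ∑ i, L i) ≤
      (μHE[2] : Measure E3) (collar σ C (Ioo (-δ) δ)) := by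
  rw [hT.measure_collar hC]
  calc _ = ∑ i, ENNReal.ofReal ((A ^ 2)⁻¹) * (ENNReal.ofReal (L i) * ENNReal.ofReal (2 * δ)) :=
        (hC.sum_ofReal_mul (by positivity) δ).symm
    _ ≤ _ := by
        refine Finset.sum_le_sum fun i _ => ?_
        rw [← volume_box, ← setLIntegral_const]
        refine setLIntegral_mono' (measurableSet_Ico.prod measurableSet_Ioo) fun q hq => ?_
        exact ENNReal.ofReal_le_ofReal (le_gramJac hA (hT.inv_deriv_le i q.1 q.2 hq.2))

end collar

end QuantumLayer

/-! ### Cutoff functions adapted to a tamed curve -/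

namespace QuantumLayer

/-- A connected subset of `S` which meets a domain but not its boundary lies in the domain. -/
theorem IsCompactDomain.subset_of_inter_nonempty {S D : Set E3} (hD : IsCompactDomain S D)
    {Z : Set E3} (hZ : IsPreconnected Z) (hZS : Z ⊆ S) (hZb : Disjoint Z (bdry D))
    (hZD : (Z ∩ D).Nonempty) : Z ⊆ D := by
  obtain ⟨U, hU, rfl⟩ := hD.isOpen
  by_contra hsub
  obtain ⟨z, hzZ, hzU⟩ := not_subset.1 hsub
  have hcover : ∀ y ∈ Z, y ∈ closure (U ∩ S) → y ∈ U ∩ S := fun y hy hyc => by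
    by_contra h
    exact disjoint_left.1 hZb hy ⟨hyc, h⟩
  obtain ⟨y, hyZ, hyU, hyV⟩ := hZ U (closure (U ∩ S))ᶜ hU isClosed_closure.isOpen_compl
    (fun y hy => by
      by_cases hyc : y ∈ closure (U ∩ S)
      · exact Or.inl (hcover y hy hyc).1
      · exact Or.inr hyc)
    (hZD.mono fun y hy => ⟨hy.1, hy.2.1⟩) ⟨z, hzZ, fun h => hzU (hcover z hzZ h)⟩
  exact hyV (subset_closure ⟨hyU, hZS hyZ⟩)

section cutoff

variable {S C D : Set E3} {N : E3 → E3} {m : ℕ} {L : Fin m → ℝ} {c : Fin m → ℝ → E3} {γ : E3 → E3}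
  {σ : E3 → ℝ → E3} {δ A : ℝ}

theorem IsTamed.continuousOn_geodesic (hT : IsTamed S C c γ σ δ A) {x : E3} (hx : x ∈ C) :
    ContinuousOn (σ x) (Ioo (-δ) δ) := (hT.geodesic x hx).2.2.1.continuousOn

theorem IsTamed.mem_curve_iff (hT : IsTamed S C c γ σ δ A) (hδ : 0 < δ) {x : E3} (hx : x ∈ C)
    {t : ℝ} (ht : t ∈ Ioo (-δ) δ) : σ x t ∈ C ↔ t = 0 := by
  refine ⟨fun h => ?_, ?_⟩
  · refine (hT.injective x hx _ h t ht 0 (by simp [hδ]) ?_).2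
    rw [(hT.geodesic _ h).1]
  · rintro rfl
    rwa [(hT.geodesic x hx).1]

/-- The geodesics issuing from `C` stay on their side of `C`. -/
theorem IsTamed.mem_domain_iff (hD : IsCompactDomain S D) (hDC : bdry D = C)
    (hT : IsTamed S C c γ σ δ A) (hδ : 0 < δ) {x : E3} (hx : x ∈ C)
    (hside : (∀ᶠ t in 𝓝[<] 0, σ x t ∈ D) ∧ ∀ᶠ t in 𝓝[>] 0, σ x t ∉ D) {t : ℝ}
    (ht : t ∈ Ioo (-δ) δ) : σ x t ∈ D ↔ t < 0 := by
  have key : ∀ J ⊆ Ioo (-δ) δ, IsPreconnected J → 0 ∉ J → (∃ t ∈ J, σ x t ∈ D) →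
      ∀ t ∈ J, σ x t ∈ D := by
    intro J hJ hJp h0 ⟨t₀, ht₀, htD⟩ t ht
    refine hD.subset_of_inter_nonempty (hJp.image (σ x) ((hT.continuousOn_geodesic hx).mono hJ))
      ?_ ?_ ⟨_, mem_image_of_mem _ ht₀, htD⟩ (mem_image_of_mem _ ht)
    · rintro _ ⟨t, ht, rfl⟩
      exact hT.mem hx (hJ ht)
    · rw [hDC]
      refine disjoint_left.2 ?_
      rintro _ ⟨t, ht, rfl⟩ h
      rw [(hT.mem_curve_iff hδ hx (hJ ht)).1 h] at ht
      exact h0 ht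
  constructor
  · intro h
    by_contra hlt
    rcases (not_lt.1 hlt).eq_or_lt with rfl | hpos
    · rw [(hT.geodesic x hx).1] at h
      rw [← hDC] at hx
      exact hx.2 h
    · obtain ⟨s, h1, h2⟩ := (hside.2.and (Ioo_mem_nhdsGT hδ)).exists
      exact h1 (key (Ioo 0 δ) (Ioo_subset_Ioo_left (by linarith)) isPreconnected_Ioo (by simp)
        ⟨t, ⟨hpos, ht.2⟩, h⟩ s h2)
  · intro hlt
    obtain ⟨s, h1, h2⟩ := (hside.1.and (Ioo_mem_nhdsLT (by linarith : -δ < 0))).exists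
    exact key (Ioo (-δ) 0) (Ioo_subset_Ioo_right hδ.le) isPreconnected_Ioo (by simp)
      ⟨s, h2, h1⟩ t ⟨ht.1, hlt⟩

/-- A cutoff profile at scale `a`: a smooth nonincreasing function which drops from `1` to `0`
in `[-a, a]`. -/
structure IsProfile (φ : ℝ → ℝ) (a : ℝ) : Prop where
  contDiff : ContDiff ℝ 1 φ
  antitone : Antitone φ
  eq_one : ∀ t ≤ -a, φ t = 1
  eq_zero : ∀ t, a ≤ t → φ t = 0

theorem exists_isProfile {a : ℝ} (ha : 0 < a) : ∃ φ, IsProfile φ a := by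
  refine ⟨fun t => Real.smoothTransition ((a - t) / (2 * a)), ?_, fun s t hst => ?_, fun t ht => ?_,
    fun t ht => ?_⟩
  · exact Real.smoothTransition.contDiff.comp (by fun_prop)
  · refine Real.smoothTransition.monotone ?_
    gcongr
  · refine Real.smoothTransition.one_of_one_le ?_
    rw [le_div_iff₀ (by positivity)]
    linarith
  · exact Real.smoothTransition.zero_of_nonpos (div_nonpos_of_nonpos_of_nonneg (by linarith)
      (by positivity))

section profile

variable {φ : ℝ → ℝ} {a : ℝ}

theorem IsProfile.mem_Icc (hφ : IsProfile φ a) (t : ℝ) : φ t ∈ Icc (0 : ℝ) 1 := by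
  constructor
  · rw [← hφ.eq_zero (max a t) (le_max_left _ _)]
    exact hφ.antitone (le_max_right _ _)
  · rw [← hφ.eq_one (min (-a) t) (min_le_left _ _)]
    exact hφ.antitone (min_le_right _ _)

theorem IsProfile.deriv_nonpos (hφ : IsProfile φ a) (t : ℝ) : deriv φ t ≤ 0 :=
  hφ.antitone.deriv_nonpos

theorem IsProfile.deriv_eq_zero (hφ : IsProfile φ a) {t : ℝ} (ht : t ∉ Icc (-a) a) :
    deriv φ t = 0 := by
  rw [Set.mem_Icc, not_and_or, not_le, not_le] at ht
  rcases ht with ht | ht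
  · have h : φ =ᶠ[𝓝 t] fun _ => 1 := (eventually_lt_nhds ht).mono fun s hs => hφ.eq_one s hs.le
    rw [h.deriv_eq, deriv_const]
  · have h : φ =ᶠ[𝓝 t] fun _ => 0 := (eventually_gt_nhds ht).mono fun s hs => hφ.eq_zero s hs.le
    rw [h.deriv_eq, deriv_const]

theorem IsProfile.exists_deriv_bound (hφ : IsProfile φ a) : ∃ B > 0, ∀ t, |deriv φ t| ≤ B := by
  have hc : Continuous (deriv φ) := hφ.contDiff.continuous_deriv le_rfl
  obtain ⟨B, hB⟩ := isCompact_Icc.exists_bound_of_continuousOn (s := Icc (-a) a) hc.continuousOn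
  refine ⟨max B 1, by positivity, fun t => ?_⟩
  by_cases ht : t ∈ Icc (-a) a
  · exact (hB t ht).trans (le_max_left _ _)
  · rw [hφ.deriv_eq_zero ht, abs_zero]
    positivity

theorem IsProfile.integral_deriv (hφ : IsProfile φ a) (ha : 0 < a) :
    ∫ t in Icc (-a) a, -deriv φ t = 1 := by
  rw [integral_Icc_eq_integral_Ioc, ← intervalIntegral.integral_of_le (by linarith),
    intervalIntegral.integral_neg, intervalIntegral.integral_deriv_eq_sub'
      φ rfl (fun t _ => hφ.contDiff.differentiable (by norm_num) t)
      (hφ.contDiff.continuous_deriv le_rfl).continuousOn, hφ.eq_one _ le_rfl, hφ.eq_zero _ le_rfl]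
  norm_num

end profile

/-- `D` is a compact domain of `S` bounded by the tamed curve `C`, and the geodesics of the collar
leave `D`. -/
structure IsTamedBoundary (S D C : Set E3) {m : ℕ} (L : Fin m → ℝ) (c : Fin m → ℝ → E3)
    (γ : E3 → E3) (σ : E3 → ℝ → E3) (δ A : ℝ) : Prop where
  surface : IsC2Surface S
  domain : IsCompactDomain S D
  bdry_eq : bdry D = C
  curve : IsClosedCurve C L c
  tamed : IsTamed S C c γ σ δ A
  side : ∀ x ∈ C, (∀ᶠ t in 𝓝[<] 0, σ x t ∈ D) ∧ ∀ᶠ t in 𝓝[>] 0, σ x t ∉ D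
  width_pos : 0 < δ

section profile

variable {φ : ℝ → ℝ} {a : ℝ}

theorem Icc_subset_Ioo_of_lt (haδ : a < δ) : Icc (-a) a ⊆ Ioo (-δ) δ :=
  fun _ ht => ⟨by linarith [ht.1], by linarith [ht.2]⟩

theorem IsTamedBoundary.domain_subset (h : IsTamedBoundary S D C L c γ σ δ A) : D ⊆ S := by
  obtain ⟨U, -, rfl⟩ := h.domain.isOpen
  exact inter_subset_right

open Classical in
theorem IsTamedBoundary.cutoff_eq_of_notMem (h : IsTamedBoundary S D C L c γ σ δ A)
    (hφ : IsProfile φ a) {y : E3} (hy : y ∉ collar σ C (Icc (-a) a)) :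
    cutoff D σ C δ φ y = if y ∈ D then 1 else 0 := by
  by_cases hyV : y ∈ collar σ C (Ioo (-δ) δ)
  · obtain ⟨x, hx, t, ht, rfl⟩ := hyV
    rw [h.tamed.cutoff_apply φ hx ht,
      if_congr (h.tamed.mem_domain_iff h.domain h.bdry_eq h.width_pos hx (h.side x hx) ht) rfl rfl]
    have hta : t ∉ Icc (-a) a := fun hta => hy ⟨x, hx, t, hta, rfl⟩
    rw [Set.mem_Icc, not_and_or, not_le, not_le] at hta
    by_cases hpos : 0 < a
    · rcases hta with hta | hta
      · rw [if_pos (by linarith), hφ.eq_one t hta.le]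
      · rw [if_neg (by linarith), hφ.eq_zero t hta.le]
    · -- a profile at a nonpositive scale would take both values at the same point
      exfalso
      have h1 := hφ.eq_one (min a (-a)) (min_le_right _ _)
      have h2 := hφ.eq_zero a le_rfl
      have h3 := hφ.eq_one a (by linarith)
      linarith
  · rw [cutoff, if_neg hyV]

theorem IsTamedBoundary.exists_cutoff_eventuallyEq (h : IsTamedBoundary S D C L c γ σ δ A)
    (hφ : IsProfile φ a) (ha : 0 < a) (haδ : a < δ) {y : E3}
    (hy : y ∉ collar σ C (Icc (-a) a)) :
    ∃ k : ℝ, cutoff D σ C δ φ =ᶠ[𝓝[S] y] fun _ => k := by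
  classical
  have hW : ∀ᶠ z in 𝓝[S] y, z ∉ collar σ C (Icc (-a) a) := mem_nhdsWithin_of_mem_nhds
    ((h.tamed.isCompact_collar h.curve haδ).isClosed.isOpen_compl.mem_nhds hy)
  by_cases hyD : y ∈ D
  · refine ⟨1, ?_⟩
    obtain ⟨U, hU, hDU⟩ := h.domain.isOpen
    have hyU : y ∈ U := (hDU ▸ hyD).1
    filter_upwards [hW, self_mem_nhdsWithin, mem_nhdsWithin_of_mem_nhds (hU.mem_nhds hyU)]
      with z hz hzS hzU
    rw [h.cutoff_eq_of_notMem hφ hz, if_pos (hDU ▸ ⟨hzU, hzS⟩)]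
  · refine ⟨0, ?_⟩
    have hyc : y ∉ closure D := fun hyc => by
      have hyC : y ∈ C := h.bdry_eq ▸ ⟨hyc, hyD⟩
      exact hy ⟨y, hyC, 0, ⟨by linarith, ha.le⟩, (h.tamed.geodesic y hyC).1⟩
    filter_upwards [hW, mem_nhdsWithin_of_mem_nhds (isClosed_closure.isOpen_compl.mem_nhds hyc)]
      with z hz hzc
    rw [h.cutoff_eq_of_notMem hφ hz, if_neg fun hzD => hzc (subset_closure hzD)]

theorem IsTamedBoundary.isC1On_cutoff (h : IsTamedBoundary S D C L c γ σ δ A)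
    (hφ : IsProfile φ a) (ha : 0 < a) (haδ : a < δ) : IsC1On S (cutoff D σ C δ φ) := by
  intro y _
  by_cases hyW : y ∈ collar σ C (Icc (-a) a)
  · obtain ⟨x, hx, t, ht, rfl⟩ := hyW
    obtain ⟨i, s, -, rfl⟩ := h.curve.exists_eq hx
    obtain ⟨Ψ, h1, h2⟩ := h.tamed.exists_inverse h.surface h.curve i (q := (s, t))
      (Icc_subset_Ioo_of_lt haδ ht)
    refine ⟨fun z => φ (Ψ z).2, hφ.contDiff.contDiffAt.comp _ h1.snd, ?_⟩
    filter_upwards [h2] with z hz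
    have h3 := h.tamed.cutoff_apply (D := D) φ (h.curve.mem i (Ψ z).1) hz.1
    rwa [show σ (c i (Ψ z).1) (Ψ z).2 = z from hz.2] at h3
  · obtain ⟨k, hk⟩ := h.exists_cutoff_eventuallyEq hφ ha haδ hyW
    exact ⟨fun _ => k, contDiffAt_const, hk⟩

theorem cutoff_mem_Icc (hφ : IsProfile φ a) (y : E3) :
    cutoff D σ C δ φ y ∈ Icc (0 : ℝ) 1 := by
  unfold cutoff
  split_ifs
  · exact hφ.mem_Icc _
  · simp
  · simp

theorem cutoff_eq_zero {y : E3} (hy : y ∉ D ∪ collar σ C (Ioo (-δ) δ)) :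
    cutoff D σ C δ φ y = 0 := by
  rw [cutoff, if_neg fun h => hy (Or.inr h), if_neg fun h => hy (Or.inl h)]

theorem IsTamedBoundary.cutoff_eq_zero_of_notMem (h : IsTamedBoundary S D C L c γ σ δ A)
    (hφ : IsProfile φ a) {y : E3} (hy : y ∉ closure D ∪ collar σ C (Icc (-a) a)) :
    cutoff D σ C δ φ y = 0 := by
  rw [h.cutoff_eq_of_notMem hφ fun hW => hy (Or.inr hW),
    if_neg fun hD => hy (Or.inl (subset_closure hD))]

theorem IsTamedBoundary.isCompact_support (h : IsTamedBoundary S D C L c γ σ δ A) (haδ : a < δ) :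
    IsCompact (closure D ∪ collar σ C (Icc (-a) a)) :=
  h.domain.isCompact_closure.union (h.tamed.isCompact_collar h.curve haδ)

theorem IsTamedBoundary.support_subset (h : IsTamedBoundary S D C L c γ σ δ A) (haδ : a < δ) :
    closure D ∪ collar σ C (Icc (-a) a) ⊆ S :=
  union_subset h.domain.closure_subset (h.tamed.collar_subset (Icc_subset_Ioo_of_lt haδ))

/-- The cutoff function extends to a `C¹` function on `ℝ³`. -/
theorem IsTamedBoundary.exists_extension (h : IsTamedBoundary S D C L c γ σ δ A)
    (hφ : IsProfile φ a) (ha : 0 < a) (haδ : a < δ) :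
    ∃ X : E3 → ℝ, ContDiff ℝ 1 X ∧ EqOn X (cutoff D σ C δ φ) S := by
  obtain ⟨X, hX, -, -, hXe⟩ := (h.isC1On_cutoff hφ ha haδ).exists_contDiff_extension
    (h.isCompact_support haδ) (h.support_subset haδ) isOpen_univ (subset_univ _)
    fun x _ hx => h.cutoff_eq_zero_of_notMem hφ hx
  exact ⟨X, hX, hXe⟩

variable {X : E3 → ℝ}

theorem IsTamedBoundary.fderiv_eq_zero (h : IsTamedBoundary S D C L c γ σ δ A)
    (hφ : IsProfile φ a) (ha : 0 < a) (haδ : a < δ) (hX : ContDiff ℝ 1 X)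
    (hXe : EqOn X (cutoff D σ C δ φ) S) {y v : E3} (hyS : y ∈ S)
    (hy : y ∉ collar σ C (Icc (-a) a)) (hv : IsTangent S y v) : fderiv ℝ X y v = 0 := by
  obtain ⟨k, hk⟩ := h.exists_cutoff_eventuallyEq hφ ha haδ hy
  rw [hv.fderiv_eq hyS (hX.differentiable (by norm_num) y) (differentiableAt_const k)]
  · simp
  · filter_upwards [hk, self_mem_nhdsWithin] with z hz hzS
    rw [hXe hzS, hz]

theorem IsTamedBoundary.fderiv_apply (h : IsTamedBoundary S D C L c γ σ δ A)
    (hX : ContDiff ℝ 1 X) (hφc : ContDiff ℝ 1 φ)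
    (hXe : EqOn X (cutoff D σ C δ φ) S) (i : Fin m) {q : ℝ × ℝ} (hq : q.2 ∈ Ioo (-δ) δ)
    (w : ℝ × ℝ) : fderiv ℝ X (collarMap σ (c i) q) (fderiv ℝ (collarMap σ (c i)) q w) =
      deriv φ q.2 * w.2 := by
  have h1 := (hX.differentiable (by norm_num) (collarMap σ (c i) q)).hasFDerivAt.comp q
    ((h.tamed.contDiffAt i hq).differentiableAt (by norm_num)).hasFDerivAt
  have h2 : HasFDerivAt (fun u : ℝ × ℝ => φ u.2)
      (deriv φ q.2 • ContinuousLinearMap.snd ℝ ℝ ℝ) q :=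
    (hφc.differentiable (by norm_num) q.2).hasDerivAt.comp_hasFDerivAt q hasFDerivAt_snd
  have h3 := h1.unique (h2.congr_of_eventuallyEq ((eventually_mem_strip hq).mono fun u hu => by
    show X (σ (c i u.1) u.2) = _
    rw [hXe (h.tamed.mem (h.curve.mem i u.1) hu), h.tamed.cutoff_apply φ (h.curve.mem i u.1) hu]))
  simpa using congrArg (fun l => l w) h3

theorem IsTamedBoundary.isTangent_fderiv (h : IsTamedBoundary S D C L c γ σ δ A) (i : Fin m)
    {q : ℝ × ℝ} (hq : q.2 ∈ Ioo (-δ) δ) (w : ℝ × ℝ) :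
    IsTangent S (collarMap σ (c i) q) (fderiv ℝ (collarMap σ (c i)) q w) := by
  have hline : HasDerivAt (fun t : ℝ => q + t • w) w 0 := by
    simpa using ((hasDerivAt_id (0 : ℝ)).smul_const w).const_add q
  refine ⟨fun t => collarMap σ (c i) (q + t • w), by simp, ?_, ?_⟩
  · exact ((h.tamed.contDiffAt i hq).differentiableAt
      (by norm_num)).hasFDerivAt.comp_hasDerivAt_of_eq (0 : ℝ) hline (by simp)
  · have ht : Tendsto (fun t : ℝ => q + t • w) (𝓝 0) (𝓝 q) := by
      simpa using hline.continuousAt.tendsto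
    exact (ht.eventually (eventually_mem_strip hq)).mono fun t ht =>
      h.tamed.mem (h.curve.mem i _) ht

theorem IsTamedBoundary.exists_fderiv_eq (h : IsTamedBoundary S D C L c γ σ δ A)
    (hN : IsUnitNormal S N) (i : Fin m) {q : ℝ × ℝ} (hq : q.2 ∈ Ioo (-δ) δ) {v : E3}
    (hv : v ∈ tangentPlane N (collarMap σ (c i) q)) :
    ∃ w, fderiv ℝ (collarMap σ (c i)) q w = v := by
  have hS : collarMap σ (c i) q ∈ S := h.tamed.mem (h.curve.mem i q.1) hq
  have h1 : (fderiv ℝ (collarMap σ (c i)) q).range = tangentPlane N (collarMap σ (c i) q) := by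
    refine Submodule.eq_of_le_of_finrank_eq ?_ ?_
    · rintro _ ⟨w, rfl⟩
      exact mem_tangentPlane.2 (hN.orthogonal _ hS _ (h.isTangent_fderiv i hq w))
    · rw [hN.finrank_tangentPlane hS]
      refine (LinearMap.finrank_range_of_inj (h.tamed.injective_fderiv i hq)).trans ?_
      simp
  rw [← h1] at hv
  exact hv

/-- The gradient bound for cutoff functions: the differential of the signed distance is bounded by
the constant of the tamed curve. -/
theorem IsTamedBoundary.abs_fderiv_le (h : IsTamedBoundary S D C L c γ σ δ A)
    (hN : IsUnitNormal S N) (hφ : IsProfile φ a) (ha : 0 < a) (haδ : a < δ) (hX : ContDiff ℝ 1 X)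
    (hXe : EqOn X (cutoff D σ C δ φ) S) {B : ℝ} (hB : ∀ t, |deriv φ t| ≤ B) (hA : 0 ≤ A) {y v : E3}
    (hyS : y ∈ S) (hv : v ∈ tangentPlane N y) : |fderiv ℝ X y v| ≤ B * A * ‖v‖ := by
  have hB0 : 0 ≤ B := (abs_nonneg _).trans (hB 0)
  by_cases hy : y ∈ collar σ C (Icc (-a) a)
  · obtain ⟨x, hx, t, ht, rfl⟩ := hy
    obtain ⟨i, s, -, rfl⟩ := h.curve.exists_eq hx
    have hq := Icc_subset_Ioo_of_lt haδ ht
    obtain ⟨w, rfl⟩ := h.exists_fderiv_eq hN i (q := (s, t)) hq hv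
    rw [h.fderiv_apply hX hφ.contDiff hXe i (q := (s, t)) hq w, abs_mul, mul_assoc]
    refine mul_le_mul (hB t) ?_ (abs_nonneg _) hB0
    refine le_trans ?_ (h.tamed.inv_deriv_le i s t hq w.1 w.2)
    rw [← Real.sqrt_sq_eq_abs]
    exact Real.sqrt_le_sqrt (by nlinarith [sq_nonneg w.1])
  · rw [h.fderiv_eq_zero hφ ha haδ hX hXe hyS hy ((hN.isTangent_iff h.surface hyS).2 hv), abs_zero]
    positivity

end profile

end cutoff

end QuantumLayer

/-! ### The flux through a tamed curve -/

namespace QuantumLayer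

/-- For an immersed parametrisation with differential `l`, the flux density of the tangential part
of `η` through the curves on which the second coordinate is constant. -/
noncomputable def fluxDensity (η : E3) (l : ℝ × ℝ →L[ℝ] E3) : ℝ :=
  (‖l (1, 0)‖ ^ 2 * inner ℝ η (l (0, 1)) -
    inner ℝ (l (1, 0)) (l (0, 1)) * inner ℝ η (l (1, 0))) / gramJac l

/-- Maps with Lipschitz constant `1` do not increase length. -/
theorem euclideanHausdorffMeasure_one_image_le {f : ℝ → E3} (hf : LipschitzWith 1 f) (s : Set ℝ) :
    (μHE[1] : Measure E3) (f '' s) ≤ volume s := by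
  have h1 : (μHE[1] : Measure ℝ) = volume := by
    have := InnerProductSpace.euclideanHausdorffMeasure_eq_volume (V := ℝ)
    rwa [Module.finrank_self] at this
  rw [← h1, Measure.euclideanHausdorffMeasure_def, Measure.euclideanHausdorffMeasure_def,
    Measure.smul_apply, Measure.smul_apply]
  refine smul_le_smul_of_nonneg_left ?_ zero_le
  simpa using (hf.lipschitzOnWith (s := s)).hausdorffMeasure_image_le (d := 1) zero_le_one

section flux

variable {S C D : Set E3} {N : E3 → E3} {m : ℕ} {L : Fin m → ℝ} {c : Fin m → ℝ → E3} {γ : E3 → E3}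
  {σ : E3 → ℝ → E3} {δ A : ℝ} {φ : ℝ → ℝ} {a : ℝ} {X : E3 → ℝ} {η : E3}

theorem IsClosedCurve.measure_le (hC : IsClosedCurve C L c) :
    (μHE[1] : Measure E3) C ≤ ENNReal.ofReal (∑ i, L i) := by
  have h1 : C ⊆ ⋃ i, c i '' Ico 0 (L i) := fun x hx => by
    obtain ⟨i, s, hs, rfl⟩ := hC.exists_eq hx
    exact mem_iUnion.2 ⟨i, s, hs, rfl⟩
  refine (measure_mono h1).trans ((measure_iUnion_fintype_le _ _).trans ?_)
  rw [ENNReal.ofReal_sum_of_nonneg fun i _ => (hC.period_pos i).le]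
  refine Finset.sum_le_sum fun i _ => ?_
  refine (euclideanHausdorffMeasure_one_image_le ?_ _).trans (by rw [Real.volume_Ico, sub_zero])
  refine lipschitzWith_of_nnnorm_deriv_le ((hC.contDiff i).differentiable (by norm_num)) fun s => ?_
  rw [← NNReal.coe_le_coe, coe_nnnorm, hC.unitSpeed, NNReal.coe_one]

theorem IsTamed.hasDerivAt_snd (hT : IsTamed S C c γ σ δ A) (i : Fin m) {q : ℝ × ℝ}
    (hq : q.2 ∈ Ioo (-δ) δ) :
    HasDerivAt (σ (c i q.1)) (fderiv ℝ (collarMap σ (c i)) q (0, 1)) q.2 := by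
  have h1 := ((hT.contDiffAt i hq).differentiableAt (by norm_num)).hasFDerivAt
  have h2 : HasDerivAt (fun t : ℝ => (q.1, t)) ((0 : ℝ), (1 : ℝ)) q.2 :=
    (hasDerivAt_const q.2 q.1).prodMk (hasDerivAt_id q.2)
  exact HasFDerivAt.comp_hasDerivAt (l := collarMap σ (c i)) q.2 h1 h2

/-- Points of the collar are close to the curve. -/
theorem IsTamed.intrinsicDist_le (hC : IsClosedCurve C L c) (hT : IsTamed S C c γ σ δ A)
    (hδ : 0 < δ) (hA : 0 ≤ A) {x : E3} (hx : x ∈ C) {t : ℝ} (ht : t ∈ Ioo (-δ) δ) :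
    intrinsicDist S x (σ x t) ≤ ENNReal.ofReal (A * δ) := by
  obtain ⟨i, s, -, rfl⟩ := hC.exists_eq hx
  have hlip : LipschitzOnWith A.toNNReal (σ (c i s)) (Ioo (-δ) δ) := by
    refine (convex_Ioo _ _).lipschitzOnWith_of_nnnorm_hasDerivWithin_le
      (f' := fun t => fderiv ℝ (collarMap σ (c i)) (s, t) (0, 1))
      (fun t ht => (hT.hasDerivAt_snd i (q := (s, t)) ht).hasDerivWithinAt) fun t ht => ?_
    rw [← NNReal.coe_le_coe, coe_nnnorm, Real.coe_toNNReal A hA]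
    simpa using hT.deriv_le i s t ht 0 1
  have hmaps : MapsTo (σ (c i s)) (Ioo (-δ) δ) S := fun t ht => hT.mem hx ht
  have h0 : (0 : ℝ) ∈ Ioo (-δ) δ := ⟨by linarith, hδ⟩
  have key : ∀ u v, u ∈ Ioo (-δ) δ → v ∈ Ioo (-δ) δ → u ≤ v → v - u ≤ δ →
      intrinsicDist S (σ (c i s) u) (σ (c i s) v) ≤ ENNReal.ofReal (A * δ) := by
    intro u v hu hv huv hle
    have hsub : Icc u v ⊆ Ioo (-δ) δ := fun w hw => ⟨hu.1.trans_le hw.1, hw.2.trans_lt hv.2⟩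
    refine (intrinsicDist_le_of_lipschitzOnWith huv (hlip.mono hsub)
      (hmaps.mono_left hsub)).trans ?_
    rw [ENNReal.ofReal_mul hA]
    exact mul_le_mul' le_rfl (ENNReal.ofReal_le_ofReal hle)
  have hx0 : σ (c i s) 0 = c i s := (hT.geodesic _ hx).1
  rcases le_total 0 t with h | h
  · have := key 0 t h0 ht h (by linarith [ht.2])
    rwa [hx0] at this
  · have := key t 0 ht h0 h (by linarith [ht.1])
    rwa [hx0, intrinsicDist_comm] at this

theorem IsTamed.fluxDensity_zero (hC : IsClosedCurve C L c) (hT : IsTamed S C c γ σ δ A)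
    (hδ : 0 < δ) (hγ : IsConormal S c γ) (i : Fin m) (s : ℝ) :
    fluxDensity η (fderiv ℝ (collarMap σ (c i)) (s, 0)) = inner ℝ (γ (c i s)) η := by
  have h0 : (0 : ℝ) ∈ Ioo (-δ) δ := ⟨by linarith, hδ⟩
  have h01 : fderiv ℝ (collarMap σ (c i)) (s, 0) (0, 1) = γ (c i s) := by
    rw [← (hT.geodesic _ (hC.mem i s)).2.1, (hT.hasDerivAt_snd i (q := (s, 0)) h0).deriv]
  have h10 : fderiv ℝ (collarMap σ (c i)) (s, 0) (1, 0) = deriv (c i) s := by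
    have h1 := ((hT.contDiffAt i (q := (s, 0)) h0).differentiableAt (by norm_num)).hasFDerivAt
    have h2 : HasDerivAt (fun u : ℝ => (u, (0 : ℝ))) ((1 : ℝ), (0 : ℝ)) s :=
      (hasDerivAt_id s).prodMk (hasDerivAt_const s 0)
    have h3 := HasFDerivAt.comp_hasDerivAt (l := collarMap σ (c i)) s h1 h2
    have h4 : (collarMap σ (c i)) ∘ (fun u : ℝ => (u, (0 : ℝ))) = c i := by
      funext u
      exact (hT.geodesic _ (hC.mem i u)).1
    rw [h4] at h3
    exact h3.deriv.symm
  obtain ⟨-, h2, h3⟩ := hγ i s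
  rw [fluxDensity, gramJac, h01, h10, hC.unitSpeed, h2, real_inner_comm (γ (c i s)) (deriv (c i) s),
    h3, real_inner_comm]
  norm_num

theorem IsTamed.continuousOn_fluxDensity (hT : IsTamed S C c γ σ δ A) (i : Fin m) :
    ContinuousOn (fun q => fluxDensity η (fderiv ℝ (collarMap σ (c i)) q))
      (univ ×ˢ Ioo (-δ) δ) := by
  have h1 : ContinuousOn (fderiv ℝ (collarMap σ (c i))) (univ ×ˢ Ioo (-δ) δ) :=
    (hT.contDiffOn i).continuousOn_fderiv_of_isOpen (isOpen_strip δ) le_rfl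
  have h2 : ∀ w : ℝ × ℝ, ContinuousOn (fun q => fderiv ℝ (collarMap σ (c i)) q w)
      (univ ×ˢ Ioo (-δ) δ) := fun w => h1.clm_apply continuousOn_const
  refine ContinuousOn.div ?_ (continuous_gramJac.comp_continuousOn h1)
    fun q hq => (gramJac_pos (hT.injective_fderiv i hq.2)).ne'
  exact (((h2 _).norm.pow 2).mul (continuousOn_const.inner (h2 _))).sub
    (((h2 _).inner (h2 _)).mul (continuousOn_const.inner (h2 _)))

/-- Since it is at least `δ₂` on the curve, the flux density is at least `δ₂ / 2` on a thin collar. -/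
theorem IsTamed.exists_le_fluxDensity (hC : IsClosedCurve C L c) (hT : IsTamed S C c γ σ δ A)
    (hδ : 0 < δ) (hγ : IsConormal S c γ) {δ₂ : ℝ} (hδ₂ : 0 < δ₂)
    (hη : ∀ x ∈ C, δ₂ ≤ inner ℝ (γ x) η) :
    ∃ a ∈ Ioo 0 δ, ∀ i, ∀ q ∈ Ico 0 (L i) ×ˢ Icc (-a) a,
      δ₂ / 2 ≤ fluxDensity η (fderiv ℝ (collarMap σ (c i)) q) := by
  have key : ∀ i, ∀ᶠ a : ℝ in 𝓝[>] 0, ∀ q ∈ Ico 0 (L i) ×ˢ Icc (-a) a,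
      δ₂ / 2 ≤ fluxDensity η (fderiv ℝ (collarMap σ (c i)) q) := by
    intro i
    have hopen := (hT.continuousOn_fluxDensity (η := η) i).isOpen_inter_preimage (isOpen_strip δ)
      (isOpen_Ioi (a := δ₂ / 2))
    obtain ⟨u, v, -, hv, hu0, hv0, huv⟩ := generalized_tube_lemma (isCompact_Icc (a := 0) (b := L i))
      (isCompact_singleton (x := (0 : ℝ))) hopen (by
        rintro ⟨s, t⟩ ⟨-, rfl⟩
        refine ⟨⟨mem_univ _, by simp [hδ]⟩, ?_⟩
        show δ₂ / 2 < fluxDensity η (fderiv ℝ (collarMap σ (c i)) (s, 0))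
        rw [hT.fluxDensity_zero hC hδ hγ]
        linarith [hη _ (hC.mem i s)])
    obtain ⟨r, hr, hrv⟩ := Metric.isOpen_iff.1 hv 0 (hv0 rfl)
    filter_upwards [Ioo_mem_nhdsGT hr] with a ha q hq
    refine le_of_lt (huv ⟨hu0 (Ico_subset_Icc_self hq.1), hrv ?_⟩).2
    rw [Metric.mem_ball, dist_zero_right, Real.norm_eq_abs, abs_lt]
    exact ⟨by linarith [hq.2.1, ha.2], by linarith [hq.2.2, ha.2]⟩
  obtain ⟨a, h1, h2⟩ := ((eventually_all.2 key).and (Ioo_mem_nhdsGT hδ)).exists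
  exact ⟨a, h2, h1⟩

theorem IsTamedBoundary.gramJac_mul_fderiv (h : IsTamedBoundary S D C L c γ σ δ A)
    (hN : IsUnitNormal S N) (hX : ContDiff ℝ 1 X) (hφc : ContDiff ℝ 1 φ)
    (hXe : EqOn X (cutoff D σ C δ φ) S) (i : Fin m) {q : ℝ × ℝ} (hq : q.2 ∈ Ioo (-δ) δ) :
    gramJac (fderiv ℝ (collarMap σ (c i)) q) *
      fderiv ℝ X (collarMap σ (c i) q) (tangentPart (N (collarMap σ (c i) q)) η) =
      deriv φ q.2 * fluxDensity η (fderiv ℝ (collarMap σ (c i)) q) := by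
  have hS : collarMap σ (c i) q ∈ S := h.tamed.mem (h.curve.mem i q.1) hq
  have hn := hN.norm_eq_one _ hS
  obtain ⟨w, hw⟩ := h.exists_fderiv_eq hN i hq
    (mem_tangentPlane.2 (inner_tangentPart hn η))
  have hJ := gramJac_pos (h.tamed.injective_fderiv i hq)
  rw [← hw, h.fderiv_apply hX hφc hXe i hq, fluxDensity, ← gramJac_sq_mul_snd w]
  · field_simp
  · intro u
    rw [hw, tangentPart, inner_sub_left, real_inner_smul_left,
      hN.orthogonal _ hS _ (h.isTangent_fderiv i hq u), mul_zero, sub_zero]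

theorem IsTamedBoundary.integrable_fderiv (h : IsTamedBoundary S D C L c γ σ δ A)
    (hN : IsUnitNormal S N) (hφ : IsProfile φ a) (ha : 0 < a) (haδ : a < δ) (hX : ContDiff ℝ 1 X)
    (hXe : EqOn X (cutoff D σ C δ φ) S) :
    Integrable (fun y => fderiv ℝ X y (tangentPart (N y) η)) (areaMeasure S) :=
  h.surface.integrable_of_isCompact (h.tamed.isCompact_collar h.curve haδ)
    (h.tamed.collar_subset (Icc_subset_Ioo_of_lt haδ)) (continuousOn_fderiv_tangentPart hN η hX)
    fun _ hy hyW => h.fderiv_eq_zero hφ ha haδ hX hXe hy hyW (hN.isTangent_tangentPart h.surface η hy)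

/-- The flux of the tangential part of `η` through the level sets of a cutoff function is bounded
below by the length of the curve. -/
theorem IsTamedBoundary.le_integral_fderiv (h : IsTamedBoundary S D C L c γ σ δ A)
    (hN : IsUnitNormal S N) (hφ : IsProfile φ a) (ha : 0 < a) (haδ : a < δ) (hX : ContDiff ℝ 1 X)
    (hXe : EqOn X (cutoff D σ C δ φ) S) {b : ℝ}
    (hb : ∀ i, ∀ q ∈ Ico 0 (L i) ×ˢ Icc (-a) a,
      b ≤ fluxDensity η (fderiv ℝ (collarMap σ (c i)) q)) :
    b * ∑ i, L i ≤ -∫ y, fderiv ℝ X y (tangentPart (N y) η) ∂areaMeasure S := by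
  have hJ := Icc_subset_Ioo_of_lt haδ
  set g : E3 → ℝ := fun y => -fderiv ℝ X y (tangentPart (N y) η) with hg
  have hgi : IntegrableOn g S (μHE[2] : Measure E3) :=
    (h.integrable_fderiv hN hφ ha haδ hX hXe).neg
  have hsub : ∀ i, collarMap σ (c i) '' (Ico 0 (L i) ×ˢ Icc (-a) a) ⊆ S := by
    rintro i _ ⟨q, hq, rfl⟩
    exact h.tamed.mem (h.curve.mem i q.1) (hJ hq.2)
  have hmeas : ∀ i, MeasurableSet (Ico 0 (L i) ×ˢ Icc (-a) a) := fun i =>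
    measurableSet_Ico.prod measurableSet_Icc
  have hbox : ∀ i, Ico 0 (L i) ×ˢ Icc (-a) a ⊆ univ ×ˢ Ioo (-δ) δ := fun i =>
    prod_mono (subset_univ _) hJ
  rw [← integral_neg]
  change _ ≤ ∫ y in S, g y ∂(μHE[2] : Measure E3)
  rw [setIntegral_eq_of_subset_of_forall_sdiff_eq_zero h.surface.measurableSet
    (h.tamed.collar_subset hJ) fun y hy => by
      rw [hg]
      exact neg_eq_zero.2 (h.fderiv_eq_zero hφ ha haδ hX hXe hy.1 hy.2
        (hN.isTangent_tangentPart h.surface η hy.1)),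
    collar_eq_iUnion h.curve, integral_iUnion_fintype
      (fun i => h.tamed.measurableSet_image h.curve i hJ measurableSet_Icc)
      (h.tamed.pairwise_disjoint h.curve hJ) fun i => hgi.mono_set (hsub i), Finset.mul_sum]
  refine Finset.sum_le_sum fun i _ => ?_
  have hinj := (h.tamed.injOn h.curve i).mono (prod_mono (Subset.rfl (s := Ico 0 (L i))) hJ)
  have himm : ∀ q ∈ Ico 0 (L i) ×ˢ Icc (-a) a,
    Function.Injective (fderiv ℝ (collarMap σ (c i)) q) :=
      fun q hq => h.tamed.injective_fderiv i (hJ hq.2)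
  have hint := (integrableOn_image_iff_gramJac (isOpen_strip δ) (h.tamed.contDiffOn i) (hmeas i)
    (hbox i) hinj himm g).1 (hgi.mono_set (hsub i))
  rw [integral_image_eq_integral_gramJac (isOpen_strip δ) (h.tamed.contDiffOn i) (hmeas i)
    (hbox i) hinj himm g]
  have hb0 : b * L i = ∫ q in Ico 0 (L i) ×ˢ Icc (-a) a, b * -deriv φ q.2 := by
    rw [Measure.volume_eq_prod, setIntegral_prod_mul (fun _ => b) (fun t => -deriv φ t),
      hφ.integral_deriv ha, setIntegral_const]
    simp [Measure.real, (h.curve.period_pos i).le, mul_comm]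
  rw [hb0]
  refine setIntegral_mono_on ?_ hint (hmeas i) fun q hq => ?_
  · refine IntegrableOn.mono_set (t := Icc 0 (L i) ×ˢ Icc (-a) a) ?_
      (prod_mono Ico_subset_Icc_self Subset.rfl)
    refine Continuous.continuousOn ?_ |>.integrableOn_compact (isCompact_Icc.prod isCompact_Icc)
    exact continuous_const.mul ((hφ.contDiff.continuous_deriv le_rfl).comp continuous_snd).neg
  · have h1 := h.gramJac_mul_fderiv (η := η) hN hX hφ.contDiff hXe i (hJ hq.2)
    have h2 : gramJac (fderiv ℝ (collarMap σ (c i)) q) * g (collarMap σ (c i) q) =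
        -deriv φ q.2 * fluxDensity η (fderiv ℝ (collarMap σ (c i)) q) := by
      rw [hg, mul_neg, h1, neg_mul]
    refine (mul_comm b _).trans_le ?_
    refine le_of_le_of_eq (mul_le_mul_of_nonneg_left (hb i q hq) ?_) h2.symm
    linarith [hφ.deriv_nonpos q.2]

theorem abs_inner_normal_le (hN : IsUnitNormal S N) (hη : ‖η‖ = 1) {y : E3} (hy : y ∈ S) :
    |inner ℝ (N y) η| ≤ 1 := by
  have h1 := abs_real_inner_le_norm (N y) η
  rwa [hN.norm_eq_one y hy, hη, mul_one] at h1

theorem IsTamedBoundary.integrable_cutoff (h : IsTamedBoundary S D C L c γ σ δ A)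
    (hN : IsUnitNormal S N) (hφ : IsProfile φ a) (haδ : a < δ) (hX : ContDiff ℝ 1 X)
    (hXe : EqOn X (cutoff D σ C δ φ) S) :
    Integrable (fun y => X y * (meanCurvature S N y * inner ℝ (N y) η)) (areaMeasure S) :=
  h.surface.integrable_of_isCompact (h.isCompact_support haδ) (h.support_subset haδ)
    (continuousOn_meanCurvature_mul h.surface hN η hX.continuous.continuousOn)
    fun y hy hyK => by rw [hXe hy, h.cutoff_eq_zero_of_notMem hφ hyK, zero_mul]

/-- The integral of the mean curvature against a cutoff function is bounded below by the length of
the curve. For a steep profile this is the divergence theorem for the tangential part of `η`; another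
profile changes the integral by at most the supremum of the mean curvature over the collar times the
area of the collar. -/
theorem IsTamedBoundary.le_integral_cutoff (h : IsTamedBoundary S D C L c γ σ δ A)
    (hN : IsUnitNormal S N) (hγ : IsConormal S c γ) (hη : ‖η‖ = 1) {δ₂ : ℝ} (hδ₂ : 0 < δ₂)
    (hγη : ∀ x ∈ C, δ₂ ≤ inner ℝ (γ x) η) (hφ : IsProfile φ a) (haδ : a < δ)
    (hX : ContDiff ℝ 1 X) (hXe : EqOn X (cutoff D σ C δ φ) S) {b : ℝ} (hb0 : 0 ≤ b)
    (hb : ∀ y ∈ collar σ C (Ioo (-δ) δ), |meanCurvature S N y| ≤ b) :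
    δ₂ / 2 * ∑ i, L i - b * (A ^ 2 * (2 * δ) * ∑ i, L i) ≤
      ∫ y, X y * (meanCurvature S N y * inner ℝ (N y) η) ∂areaMeasure S := by
  obtain ⟨r, ⟨hr0, hrδ⟩, hr⟩ := h.tamed.exists_le_fluxDensity h.curve h.width_pos hγ hδ₂ hγη
  obtain ⟨ψ, hψ⟩ := exists_isProfile hr0
  obtain ⟨Y, hY, hYe⟩ := h.exists_extension hψ hr0 hrδ
  have h1 : δ₂ / 2 * ∑ i, L i ≤
      ∫ y, Y y * (meanCurvature S N y * inner ℝ (N y) η) ∂areaMeasure S := by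
    rw [integral_mul_meanCurvature_eq h.surface hN η hY (h.isCompact_support hrδ)
      (h.support_subset hrδ) fun y hy hyK => by
        rw [hYe hy, h.cutoff_eq_zero_of_notMem hψ hyK]]
    exact h.le_integral_fderiv hN hψ hr0 hrδ hY hYe hr
  have hYi := h.integrable_cutoff (η := η) hN hψ hrδ hY hYe
  have hXi := h.integrable_cutoff (η := η) hN hφ haδ hX hXe
  have hV := h.tamed.measure_collar_le h.curve
  set V := collar σ C (Ioo (-δ) δ) with hVdef
  have hVS : V ⊆ S := h.tamed.collar_subset Subset.rfl
  have h2 : |∫ y, (Y y * (meanCurvature S N y * inner ℝ (N y) η) -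
      X y * (meanCurvature S N y * inner ℝ (N y) η)) ∂areaMeasure S| ≤
      b * (μHE[2] : Measure E3).real V := by
    change |∫ y in S, _ ∂(μHE[2] : Measure E3)| ≤ _
    rw [setIntegral_eq_of_subset_of_forall_sdiff_eq_zero h.surface.measurableSet hVS
      fun y hy => by
        rw [hYe hy.1, hXe hy.1, cutoff, cutoff, if_neg hy.2, if_neg hy.2, sub_self],
      ← Real.norm_eq_abs]
    refine norm_setIntegral_le_of_norm_le_const (hV.trans_lt ENNReal.ofReal_lt_top) fun y hy => ?_
    rw [← sub_mul, norm_mul, norm_mul, Real.norm_eq_abs, Real.norm_eq_abs, Real.norm_eq_abs,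
      hYe (hVS hy), hXe (hVS hy)]
    have h3 := cutoff_mem_Icc (D := D) (C := C) (σ := σ) (δ := δ) hφ y
    have h4 := cutoff_mem_Icc (D := D) (C := C) (σ := σ) (δ := δ) hψ y
    calc _ ≤ 1 * (b * 1) := by
          refine mul_le_mul (abs_sub_le_iff.2 ⟨?_, ?_⟩) (mul_le_mul (hb y hy)
            (abs_inner_normal_le hN hη (hVS hy)) (abs_nonneg _) hb0) (by positivity) zero_le_one
          · linarith [h3.1, h4.2]
          · linarith [h4.1, h3.2]
      _ = b := by ring
  rw [integral_sub hYi hXi] at h2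
  have h5 : (μHE[2] : Measure E3).real V ≤ A ^ 2 * (2 * δ) * ∑ i, L i := by
    refine ENNReal.toReal_le_of_le_ofReal ?_ hV
    have := h.curve.sum_nonneg
    have := h.width_pos
    positivity
  have h6 := mul_le_mul_of_nonneg_left h5 hb0
  linarith [(abs_le.1 h2).2]

end flux

end QuantumLayer

/-! ### Cutoff functions far from a point -/

namespace QuantumLayer

/-- The open ball of radius `r` around `p` for the intrinsic distance of `S`. -/
abbrev intrinsicBall (S : Set E3) (p : E3) (r : ℝ) : Set E3 :=
  {x | x ∈ S ∧ intrinsicDist S p x < ENNReal.ofReal r}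

theorem measurableSet_intrinsicBall {S : Set E3} (hS : IsC2Surface S) (p : E3) (r : ℝ) :
    MeasurableSet (intrinsicBall S p r) := by
  obtain ⟨U, hU, h⟩ := exists_isOpen_intrinsic_ball hS (p := p) (ENNReal.ofReal r)
  rw [intrinsicBall, h]
  exact hU.measurableSet.inter hS.measurableSet

theorem intrinsicBall_mono {S : Set E3} (p : E3) {r r' : ℝ} (h : r ≤ r') :
    intrinsicBall S p r ⊆ intrinsicBall S p r' :=
  fun _ hx => ⟨hx.1, hx.2.trans_le (ENNReal.ofReal_le_ofReal h)⟩

/-- What the estimates use about a tamed curve of length `ℓ` bounding `D`, with collar `V`, outside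
the ball of radius `r`: the function `X` cuts off `D` in the collar, its gradient is controlled, the
areas of `V` and `D` are controlled by `ℓ`, and the integral of `X` against the mean curvature is
bounded below by `ℓ` if the mean curvature is at most `b` off the ball. -/
structure IsFarCutoff (S : Set E3) (N : E3 → E3) (p : E3) (δ₁ δ₂ δ₃ A B b r : ℝ) (D V : Set E3)
    (ℓ : ℝ) (η : E3) (X : E3 → ℝ) : Prop where
  length_pos : 0 < ℓ
  norm_eq_one : ‖η‖ = 1
  measurableSet_domain : MeasurableSet D
  domain_subset : D ⊆ S
  measurableSet_collar : MeasurableSet V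
  collar_subset : V ⊆ S
  contDiff : ContDiff ℝ 1 X
  mem_Icc : ∀ y ∈ S, X y ∈ Icc (0 : ℝ) 1
  eq_zero : ∀ y ∈ S, y ∉ D ∪ V → X y = 0
  exists_isCompact : ∃ K ⊆ S, IsCompact K ∧ ∀ y ∈ S, y ∉ K → X y = 0
  abs_fderiv_le : ∀ y ∈ S, ∀ v ∈ tangentPlane N y, |fderiv ℝ X y v| ≤ B * A * ‖v‖
  fderiv_eq_zero : ∀ y ∈ S, y ∉ V → ∀ v ∈ tangentPlane N y, fderiv ℝ X y v = 0
  disjoint_collar : Disjoint V (intrinsicBall S p r)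
  ball_subset_or_disjoint : intrinsicBall S p r ⊆ D ∨ Disjoint (intrinsicBall S p r) D
  collar_le : (μHE[2] : Measure E3) V ≤ ENNReal.ofReal (A ^ 2 * (2 * δ₃) * ℓ)
  le_collar : ENNReal.ofReal ((A ^ 2)⁻¹ * (2 * δ₃) * ℓ) ≤ (μHE[2] : Measure E3) V
  domain_le : ENNReal.ofReal δ₁ * (μHE[2] : Measure E3) D ≤ ENNReal.ofReal (ℓ ^ 2)
  le_integral : δ₂ / 2 * ℓ - b * (A ^ 2 * (2 * δ₃) * ℓ) ≤
    ∫ y, X y * (meanCurvature S N y * inner ℝ (N y) η) ∂areaMeasure S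

section far

variable {S : Set E3} {N : E3 → E3} {p : E3} {δ₁ δ₂ δ₃ A B b r : ℝ}

theorem exists_isFarCutoff (hS : IsC2Surface S) (hconn : IsConnected S) (hN : IsUnitNormal S N)
    (hcomplete : IsCompleteSurface S) (hnoncompact : ¬ IsCompact S) (hp : p ∈ S)
    (hiso : IsoperimetricInequality S δ₁) (hδ₂ : 0 < δ₂) (hδ₃ : 0 < δ₃) (hA : 0 < A)
    (hcurves : ∀ K ⊆ S, IsCompact K →
      ∃ (D C : Set E3) (m : ℕ) (L : Fin m → ℝ) (c : Fin m → ℝ → E3) (γ : E3 → E3)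
        (σ : E3 → ℝ → E3) (η : E3),
        IsCompactDomain S D ∧ bdry D = C ∧ C ⊆ S \ K ∧
        IsClosedCurve C L c ∧ IsConormal S c γ ∧ IsTamed S C c γ σ δ₃ A ∧
        (∀ x ∈ C, (∀ᶠ t in 𝓝[<] 0, σ x t ∈ D) ∧ ∀ᶠ t in 𝓝[>] 0, σ x t ∉ D) ∧
        ‖η‖ = 1 ∧ ∀ x ∈ C, δ₂ ≤ inner ℝ (γ x) η)
    {φ : ℝ → ℝ} {a : ℝ} (hφ : IsProfile φ a) (ha : 0 < a) (haδ : a < δ₃)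
    (hB : ∀ t, |deriv φ t| ≤ B) (hr : 0 ≤ r) (hb0 : 0 ≤ b)
    (hb : ∀ y ∈ S, y ∉ intrinsicBall S p r → |meanCurvature S N y| ≤ b) :
    ∃ D V ℓ η X, IsFarCutoff S N p δ₁ δ₂ δ₃ A B b r D V ℓ η X := by
  obtain ⟨D, C, m, L, c, γ, σ, η, hD, hDC, hCK, hC, hγ, hT, hside, hη, hγη⟩ :=
    hcurves _ (fun _ hx => hx.1) (isCompact_intrinsic_closedBall hS hcomplete hp (r + A * δ₃))
  have h : IsTamedBoundary S D C L c γ σ δ₃ A := ⟨hS, hD, hDC, hC, hT, hside, hδ₃⟩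
  obtain ⟨X, hX, hXe⟩ := h.exists_extension hφ ha haδ
  have hVS : collar σ C (Ioo (-δ₃) δ₃) ⊆ S := hT.collar_subset Subset.rfl
  have hCV : C ⊆ collar σ C (Ioo (-δ₃) δ₃) := fun x hx =>
    ⟨x, hx, 0, ⟨by linarith, hδ₃⟩, (hT.geodesic x hx).1⟩
  have hVd : Disjoint (collar σ C (Ioo (-δ₃) δ₃)) (intrinsicBall S p r) := by
    refine disjoint_left.2 ?_
    rintro _ ⟨x, hx, t, ht, rfl⟩ ⟨-, hlt⟩
    refine (hCK hx).2 ⟨(hCK hx).1, (intrinsicDist_triangle p (σ x t) x).trans ?_⟩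
    rw [ENNReal.ofReal_add hr (by positivity), intrinsicDist_comm (σ x t) x]
    exact add_le_add hlt.le (hT.intrinsicDist_le hC hδ₃ hA.le hx ht)
  -- the curve is not empty, since otherwise `D` would be closed
  have hCne : C.Nonempty := by
    by_contra hCe
    rw [not_nonempty_iff_eq_empty] at hCe
    have hSD : S ⊆ D := hD.subset_of_inter_nonempty hconn.isPreconnected Subset.rfl
      (by rw [hDC, hCe]; exact disjoint_empty S) (by
        rw [inter_eq_right.2 h.domain_subset]
        exact hD.connected.nonempty)
    have hSc : S = closure D := (hSD.trans subset_closure).antisymm hD.closure_subset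
    exact hnoncompact (hSc ▸ hD.isCompact_closure)
  have hDm : MeasurableSet D := by
    obtain ⟨U, hU, rfl⟩ := hD.isOpen
    exact hU.measurableSet.inter hS.measurableSet
  refine ⟨D, collar σ C (Ioo (-δ₃) δ₃), ∑ i, L i, η, X, ?_, hη, hDm, h.domain_subset,
    hT.measurableSet_collar hC Subset.rfl measurableSet_Ioo, hVS, hX,
    fun y hy => hXe hy ▸ cutoff_mem_Icc hφ y, fun y hy hyn => (hXe hy).trans (cutoff_eq_zero hyn),
    ⟨_, h.support_subset haδ, h.isCompact_support haδ,
      fun y hy hyn => (hXe hy).trans (h.cutoff_eq_zero_of_notMem hφ hyn)⟩,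
    fun y hy v hv => h.abs_fderiv_le hN hφ ha haδ hX hXe hB hA.le hy hv, fun y hy hyV v hv =>
      h.fderiv_eq_zero hφ ha haδ hX hXe hy
        (fun hW => hyV (collar_mono (Icc_subset_Ioo_of_lt haδ) hW)) ((hN.isTangent_iff hS hy).2 hv),
    hVd, ?_, hT.measure_collar_le hC, hT.le_measure_collar hA hC, ?_, ?_⟩
  · obtain ⟨x, hx⟩ := hCne
    obtain ⟨i, -⟩ := hC.exists_eq hx
    exact Finset.sum_pos (fun i _ => hC.period_pos i) ⟨i, Finset.mem_univ i⟩
  · refine or_iff_not_imp_right.2 fun hnd => hD.subset_of_inter_nonempty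
      (isPreconnected_intrinsic_ball _) (fun x hx => hx.1) ?_ (not_disjoint_iff_nonempty_inter.1 hnd)
    rw [hDC]
    exact (hVd.mono_left hCV).symm
  · refine (hiso D hD).trans ?_
    rw [hDC, ENNReal.ofReal_pow hC.sum_nonneg]
    exact pow_le_pow_left' hC.measure_le 2
  · exact h.le_integral_cutoff hN hγ hη hδ₂ hγη hφ haδ hX hXe hb0 fun y hy =>
      hb y (hVS hy) (disjoint_left.1 hVd hy)

variable {D V : Set E3} {ℓ : ℝ} {η : E3} {X : E3 → ℝ}

theorem IsFarCutoff.measure_domain_le (h : IsFarCutoff S N p δ₁ δ₂ δ₃ A B b r D V ℓ η X)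
    (hδ₁ : 0 < δ₁) : (μHE[2] : Measure E3) D ≤ ENNReal.ofReal (ℓ ^ 2 / δ₁) := by
  rw [ENNReal.ofReal_div_of_pos hδ₁,
    ENNReal.le_div_iff_mul_le (Or.inl (by simpa using hδ₁)) (Or.inl ENNReal.ofReal_ne_top), mul_comm]
  exact h.domain_le

theorem IsFarCutoff.measureReal_union_le (h : IsFarCutoff S N p δ₁ δ₂ δ₃ A B b r D V ℓ η X)
    (hδ₁ : 0 < δ₁) (hδ₃ : 0 < δ₃) :
    (μHE[2] : Measure E3).real (D ∪ V) ≤ ℓ ^ 2 / δ₁ + A ^ 2 * (2 * δ₃) * ℓ := by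
  have hℓ := h.length_pos
  refine ENNReal.toReal_le_of_le_ofReal (by positivity) ?_
  rw [ENNReal.ofReal_add (by positivity) (by positivity)]
  exact (measure_union_le _ _).trans (add_le_add (h.measure_domain_le hδ₁) h.collar_le)

theorem IsFarCutoff.measure_union_lt_top (h : IsFarCutoff S N p δ₁ δ₂ δ₃ A B b r D V ℓ η X)
    (hδ₁ : 0 < δ₁) : (μHE[2] : Measure E3) (D ∪ V) < ⊤ :=
  (measure_union_le _ _).trans_lt (ENNReal.add_lt_top.2
    ⟨(h.measure_domain_le hδ₁).trans_lt ENNReal.ofReal_lt_top,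
      h.collar_le.trans_lt ENNReal.ofReal_lt_top⟩)

/-- If the ball lies outside `D`, then the mean curvature is small on `D` and on the collar, and the
lower bound for its integral forces the curve to be long. -/
theorem IsFarCutoff.one_le_length_of_disjoint
    (h : IsFarCutoff S N p δ₁ δ₂ δ₃ A B b r D V ℓ η X) (hS : IsC2Surface S) (hN : IsUnitNormal S N)
    (hδ₁ : 0 < δ₁) (hδ₂ : 0 < δ₂) (hδ₃ : 0 < δ₃) (hb0 : 0 ≤ b) (hb1 : b * (A ^ 2 * (2 * δ₃)) ≤ δ₂ / 8)
    (hb2 : b ≤ δ₁ * δ₂ / 4) (hb : ∀ y ∈ S, y ∉ intrinsicBall S p r → |meanCurvature S N y| ≤ b)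
    (hd : Disjoint (intrinsicBall S p r) D) : 1 ≤ ℓ := by
  have hℓ := h.length_pos
  have hsub : D ∪ V ⊆ S := union_subset h.domain_subset h.collar_subset
  have h1 : ∫ y, X y * (meanCurvature S N y * inner ℝ (N y) η) ∂areaMeasure S ≤
      b * (μHE[2] : Measure E3).real (D ∪ V) := by
    refine (le_abs_self _).trans ?_
    change |∫ y in S, _ ∂(μHE[2] : Measure E3)| ≤ _
    rw [setIntegral_eq_of_subset_of_forall_sdiff_eq_zero hS.measurableSet hsub
      fun y hy => by rw [h.eq_zero y hy.1 hy.2, zero_mul], ← Real.norm_eq_abs]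
    refine norm_setIntegral_le_of_norm_le_const (h.measure_union_lt_top hδ₁) fun y hy => ?_
    have hyB : y ∉ intrinsicBall S p r := fun hyB => hy.elim (disjoint_left.1 hd hyB)
      fun hyV => disjoint_left.1 h.disjoint_collar hyV hyB
    have hX := h.mem_Icc y (hsub hy)
    rw [norm_mul, norm_mul, Real.norm_eq_abs, Real.norm_eq_abs, Real.norm_eq_abs,
      abs_of_nonneg hX.1]
    calc _ ≤ 1 * (b * 1) := mul_le_mul hX.2 (mul_le_mul (hb y (hsub hy) hyB)
          (abs_inner_normal_le hN h.norm_eq_one (hsub hy)) (abs_nonneg _) hb0) (by positivity)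
          zero_le_one
      _ = b := by ring
  have h2 := mul_le_mul_of_nonneg_left (h.measureReal_union_le hδ₁ hδ₃) hb0
  have h3 := h.le_integral
  have h4 : b * (A ^ 2 * (2 * δ₃) * ℓ) ≤ δ₂ / 8 * ℓ := by
    have := mul_le_mul_of_nonneg_right hb1 hℓ.le
    linarith
  have h5 : δ₂ / 4 * ℓ ≤ b * (ℓ ^ 2 / δ₁) := by linarith
  have h6 : b * (ℓ ^ 2 / δ₁) ≤ δ₂ / 4 * ℓ ^ 2 := by
    rw [← mul_div_assoc, div_le_iff₀ hδ₁]
    nlinarith [mul_le_mul_of_nonneg_right hb2 (sq_nonneg ℓ)]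
  by_contra hlt
  have h7 : ℓ ^ 2 < ℓ := by nlinarith [not_le.1 hlt]
  nlinarith

theorem IsFarCutoff.mul_measure_ball_le (h : IsFarCutoff S N p δ₁ δ₂ δ₃ A B b r D V ℓ η X)
    (hd : intrinsicBall S p r ⊆ D) :
    ENNReal.ofReal δ₁ * (μHE[2] : Measure E3) (intrinsicBall S p r) ≤ ENNReal.ofReal (ℓ ^ 2) :=
  (mul_le_mul_right (measure_mono hd) _).trans h.domain_le

theorem iUnion_intrinsicBall (hS : IsC2Surface S) (hconn : IsConnected S) (hp : p ∈ S) :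
    ⋃ n : ℕ, intrinsicBall S p n = S := by
  refine Subset.antisymm (iUnion_subset fun n x hx => hx.1) fun x hx => ?_
  obtain ⟨n, hn⟩ := ENNReal.exists_nat_gt (intrinsicDist_lt_top hS hconn hp hx).ne
  exact mem_iUnion.2 ⟨n, hx, by rwa [ENNReal.ofReal_natCast]⟩

/-- The areas of the balls tend to infinity: otherwise the complements of large balls would have
small area, and could not contain collars of long curves. -/
theorem tendsto_measure_intrinsicBall (hS : IsC2Surface S) (hconn : IsConnected S) (hp : p ∈ S)
    (hδ₁ : 0 < δ₁) (hδ₃ : 0 < δ₃) (hA : 0 < A)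
    (hfar : ∀ᶠ n : ℕ in atTop, ∃ D V ℓ η X, IsFarCutoff S N p δ₁ δ₂ δ₃ A B b n D V ℓ η X ∧
      (Disjoint (intrinsicBall S p n) D → 1 ≤ ℓ)) :
    Tendsto (fun n : ℕ => (μHE[2] : Measure E3) (intrinsicBall S p n)) atTop (𝓝 ⊤) := by
  have hmono : Monotone fun n : ℕ => intrinsicBall S p n := fun n k hnk =>
    intrinsicBall_mono p (by exact_mod_cast hnk)
  have ht := tendsto_measure_iUnion_atTop (μ := (μHE[2] : Measure E3)) hmono
  rw [iUnion_intrinsicBall hS hconn hp] at ht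
  suffices hinf : (μHE[2] : Measure E3) S = ⊤ by rwa [hinf] at ht
  by_contra hfin
  -- all far curves have length at least `k`
  have hball : 0 < (μHE[2] : Measure E3) (intrinsicBall S p (1 : ℕ)) :=
    hS.measure_pos_of_mem_nhdsWithin hp (by
      filter_upwards [hS.eventually_intrinsicDist_lt hp (ε := ENNReal.ofReal (1 : ℕ)) (by simp),
        self_mem_nhdsWithin] with y hy hyS using ⟨hyS, hy⟩)
  set w := (μHE[2] : Measure E3).real (intrinsicBall S p (1 : ℕ)) with hw
  have hwfin : (μHE[2] : Measure E3) (intrinsicBall S p (1 : ℕ)) ≠ ⊤ :=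
    ne_top_of_le_ne_top hfin (measure_mono fun _ hx => hx.1)
  have hw0 : 0 < w := ENNReal.toReal_pos hball.ne' hwfin
  set k := min 1 (√(δ₁ * w)) with hk
  have hk0 : 0 < k := lt_min one_pos (Real.sqrt_pos.2 (by positivity))
  have hlen : ∀ᶠ n : ℕ in atTop, ENNReal.ofReal ((A ^ 2)⁻¹ * (2 * δ₃) * k) ≤
      (μHE[2] : Measure E3) (S \ intrinsicBall S p n) := by
    filter_upwards [hfar, eventually_ge_atTop 1] with n ⟨D, V, ℓ, η, X, h, hℓ⟩ hn
    have hkℓ : k ≤ ℓ := by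
      rcases h.ball_subset_or_disjoint with hd | hd
      · refine (min_le_right _ _).trans (Real.sqrt_le_iff.2 ⟨h.length_pos.le, ?_⟩)
        have h1 := (mul_le_mul_right (measure_mono (hmono hn)) _).trans (h.mul_measure_ball_le hd)
        rw [hw, Measure.real, ← ENNReal.ofReal_le_ofReal_iff (sq_nonneg ℓ), ENNReal.ofReal_mul hδ₁.le,
          ENNReal.ofReal_toReal hwfin]
        exact h1
      · exact (min_le_left _ _).trans (hℓ hd)
    refine le_trans (ENNReal.ofReal_le_ofReal ?_) (h.le_collar.trans (measure_mono fun y hy =>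
      ⟨h.collar_subset hy, disjoint_left.1 h.disjoint_collar hy⟩))
    gcongr
  have ht0 : Tendsto (fun n : ℕ => (μHE[2] : Measure E3) (S \ intrinsicBall S p n)) atTop (𝓝 0) := by
    have h1 := tendsto_measure_iInter_atTop (μ := (μHE[2] : Measure E3))
      (s := fun n : ℕ => S \ intrinsicBall S p n)
      (fun n => (hS.measurableSet.diff (measurableSet_intrinsicBall hS p n)).nullMeasurableSet)
      (fun n k hnk => sdiff_subset_sdiff_right (hmono hnk))
      ⟨0, ne_top_of_le_ne_top hfin (measure_mono sdiff_subset)⟩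
    rwa [← sdiff_iUnion, iUnion_intrinsicBall hS hconn hp, sdiff_self, measure_empty] at h1
  have h0 := ge_of_tendsto ht0 hlen
  rw [nonpos_iff_eq_zero, ENNReal.ofReal_eq_zero] at h0
  have : 0 < (A ^ 2)⁻¹ * (2 * δ₃) * k := by positivity
  linarith

end far

end QuantumLayer

/-! ### The test functions -/

namespace QuantumLayer

theorem IsC2Surface.exists_bump {S K : Set E3} (hS : IsC2Surface S) (hK : IsCompact K) (hKS : K ⊆ S) :
    ∃ (ψ : E3 → ℝ) (Q : Set E3) (M : ℝ), ContDiff ℝ 1 ψ ∧ (∀ᶠ y in 𝓝ˢ K, ψ y = 1) ∧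
      (∀ y, ψ y ∈ Icc (0 : ℝ) 1) ∧ Q ⊆ S ∧ IsCompact Q ∧
      (∀ y ∈ S, y ∉ Q → ψ y = 0 ∧ fderiv ℝ ψ y = 0) ∧ ∀ y, ‖fderiv ℝ ψ y‖ ≤ M := by
  obtain ⟨O, hO, hSO, hOS⟩ := hS.exists_isOpen
  obtain ⟨Q, hQ, hKQ, hQO⟩ := exists_compact_between hK hO (hKS.trans hSO)
  obtain ⟨ψ, h1, h0, hψ⟩ := exists_contMDiffMap_one_nhds_of_subset_interior
    (modelWithCornersSelf ℝ E3) (n := 1) hK.isClosed hKQ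
  have hC : ContDiff ℝ 1 ψ := ψ.contMDiff.contDiff
  have hsupp : tsupport ψ ⊆ Q := closure_minimal (fun x hx => by
    by_contra h
    exact hx (h0 x h)) hQ.isClosed
  have hcomp : HasCompactSupport ψ := HasCompactSupport.of_support_subset_isCompact hQ
    ((subset_tsupport _).trans hsupp)
  obtain ⟨M, hM⟩ := (hcomp.fderiv (𝕜 := ℝ)).exists_bound_of_continuous
    (hC.continuous_fderiv (by norm_num))
  have hQS : Q ∩ S = Q ∩ closure S := Subset.antisymm
    (inter_subset_inter_right _ subset_closure) fun x hx => ⟨hx.1, hOS ⟨hx.2, hQO hx.1⟩⟩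
  refine ⟨ψ, Q ∩ S, M, hC, h1, hψ, inter_subset_right, hQS ▸ hQ.inter_right isClosed_closure,
    fun y hy hyn => ?_, hM⟩
  have hyQ : y ∉ Q := fun h => hyn ⟨h, hy⟩
  exact ⟨h0 y hyQ, image_eq_zero_of_notMem_tsupport
    fun h => hyQ (hsupp (tsupport_fderiv_subset ℝ h))⟩

section test

variable {S : Set E3} {N : E3 → E3} {p : E3} {δ₁ δ₂ δ₃ A B b r : ℝ} {D V : Set E3} {ℓ : ℝ} {η : E3}
  {X ψ G : E3 → ℝ}

theorem fderiv_testFunction_apply (hS : IsC2Surface S) (hN : IsUnitNormal S N)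
    (hX : ContDiff ℝ 1 X) (hψ : ContDiff ℝ 1 ψ) (hG : ContDiff ℝ 1 G)
    (hGe : EqOn G (fun y => X y * ((1 - ψ y) * inner ℝ (N y) η)) S) {y v : E3} (hy : y ∈ S)
    (hv : v ∈ tangentPlane N y) :
    fderiv ℝ G y v = fderiv ℝ X y v * ((1 - ψ y) * inner ℝ (N y) η) +
      X y * ((1 - ψ y) * inner ℝ (fderivWithin ℝ N S y v) η - fderiv ℝ ψ y v * inner ℝ (N y) η) := by
  obtain ⟨n, hn, hNn⟩ := hN.isC1On hS y hy
  have hvT := (hN.isTangent_iff hS hy).2 hv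
  have hnd := (hn.differentiableAt (by norm_num)).hasFDerivAt
  have hn0 : N y = n y := hNn.self_of_nhdsWithin hy
  have h1 : fderivWithin ℝ N S y v = fderiv ℝ n y v :=
    hvT.hasFDerivWithinAt_unique
      ((hN.isC1On hS).differentiableWithinAt hy).hasFDerivWithinAt
      (hnd.hasFDerivWithinAt.congr_of_eventuallyEq hNn hn0)
  have hXd := (hX.differentiable (by norm_num) y).hasFDerivAt
  have hψd := (hψ.differentiable (by norm_num) y).hasFDerivAt
  have hF := hXd.fun_mul ((hψd.const_sub 1).fun_mul (hnd.inner ℝ (hasFDerivAt_const η y)))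
  rw [hvT.fderiv_eq hy (hG.differentiable (by norm_num) y) hF.differentiableAt (by
    filter_upwards [hNn, self_mem_nhdsWithin] with z hz hzS
    rw [hGe hzS]
    simp only [hz]), hF.fderiv, h1, hn0]
  simp
  ring

/-- The gradient of the test function: the cutoff in the collar contributes its gradient, the cutoff
near the base point is felt only where `X` does not vanish, and the normal field contributes the
second fundamental form, which is small where `ψ` differs from `1`. -/
theorem IsFarCutoff.gradNormSq_le (h : IsFarCutoff S N p δ₁ δ₂ δ₃ A B b r D V ℓ η X)
    (hS : IsC2Surface S) (hN : IsUnitNormal S N) (hA : 0 ≤ A) (hB : 0 ≤ B)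
    (hψ : ContDiff ℝ 1 ψ) (hψ01 : ∀ y, ψ y ∈ Icc (0 : ℝ) 1)
    (hG : ContDiff ℝ 1 G) (hGe : EqOn G (fun y => X y * ((1 - ψ y) * inner ℝ (N y) η)) S) {y : E3}
    (hy : y ∈ S) (hshape : ψ y ≠ 1 → ‖shapeOperator S N y‖ ≤ 1) :
    gradNormSq N G y ≤ (B * A + 1 + X y * ‖fderiv ℝ ψ y‖) ^ 2 := by
  have hX := h.mem_Icc y hy
  refine gradNormSq_le_sq (by have := hX.1; positivity) fun v hv => ?_
  rw [fderiv_testFunction_apply hS hN h.contDiff hψ hG hGe hy hv]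
  have h0 := hψ01 y
  have hNη := abs_inner_normal_le hN h.norm_eq_one hy
  have h1 : |fderiv ℝ X y v * ((1 - ψ y) * inner ℝ (N y) η)| ≤ B * A * ‖v‖ := by
    rw [abs_mul]
    refine (mul_le_of_le_one_right (abs_nonneg _) ?_).trans (h.abs_fderiv_le y hy v hv)
    rw [abs_mul]
    refine mul_le_one₀ ?_ (abs_nonneg _) hNη
    rw [abs_of_nonneg (by linarith [h0.2])]
    linarith [h0.1]
  have h2 : |(1 - ψ y) * inner ℝ (fderivWithin ℝ N S y v) η| ≤ ‖v‖ := by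
    by_cases hψ1 : ψ y = 1
    · rw [hψ1, sub_self, zero_mul, abs_zero]
      exact norm_nonneg v
    rw [abs_mul, abs_of_nonneg (by linarith [h0.2])]
    refine (mul_le_of_le_one_left (abs_nonneg _) (by linarith [h0.1])).trans ?_
    refine (abs_real_inner_le_norm _ _).trans ?_
    rw [h.norm_eq_one, mul_one]
    exact (hN.norm_fderivWithin_le hS hy hv).trans
      (mul_le_of_le_one_left (norm_nonneg _) (hshape hψ1))
  have h3 : |fderiv ℝ ψ y v * inner ℝ (N y) η| ≤ ‖fderiv ℝ ψ y‖ * ‖v‖ := by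
    rw [abs_mul]
    exact (mul_le_of_le_one_right (abs_nonneg _) hNη).trans ((fderiv ℝ ψ y).le_opNorm v)
  have h4 : |(1 - ψ y) * inner ℝ (fderivWithin ℝ N S y v) η - fderiv ℝ ψ y v * inner ℝ (N y) η| ≤
      ‖v‖ + ‖fderiv ℝ ψ y‖ * ‖v‖ := (abs_sub _ _).trans (add_le_add h2 h3)
  calc _ ≤ B * A * ‖v‖ + X y * (‖v‖ + ‖fderiv ℝ ψ y‖ * ‖v‖) := by
        refine (abs_add_le _ _).trans (add_le_add h1 ?_)
        rw [abs_mul, abs_of_nonneg hX.1]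
        exact mul_le_mul_of_nonneg_left h4 hX.1
    _ ≤ B * A * ‖v‖ + (1 * ‖v‖ + X y * (‖fderiv ℝ ψ y‖ * ‖v‖)) := by
        rw [mul_add]
        have := mul_le_mul_of_nonneg_right hX.2 (norm_nonneg v)
        linarith
    _ = _ := by ring

theorem IsFarCutoff.gradNormSq_eq_zero (h : IsFarCutoff S N p δ₁ δ₂ δ₃ A B b r D V ℓ η X)
    (hS : IsC2Surface S) (hN : IsUnitNormal S N) (hψ : ContDiff ℝ 1 ψ)
    (hG : ContDiff ℝ 1 G) (hGe : EqOn G (fun y => X y * ((1 - ψ y) * inner ℝ (N y) η)) S) {y : E3}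
    (hy : y ∈ S) (hyn : y ∉ D ∪ V) : gradNormSq N G y = 0 := by
  refine le_antisymm ?_ (gradNormSq_nonneg _ _ _)
  refine (gradNormSq_le_sq le_rfl fun v hv => ?_).trans (by norm_num)
  rw [fderiv_testFunction_apply hS hN h.contDiff hψ hG hGe hy hv, h.eq_zero y hy hyn,
    h.fderiv_eq_zero y hy (fun hV => hyn (Or.inr hV)) v hv]
  simp

/-- The energy of the test function. -/
theorem IsFarCutoff.integral_energy_le (h : IsFarCutoff S N p δ₁ δ₂ δ₃ A B b r D V ℓ η X)
    (hS : IsC2Surface S) (hN : IsUnitNormal S N) (hA : 0 ≤ A) (hB : 0 ≤ B) (hδ₁ : 0 < δ₁)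
    (hδ₃ : 0 < δ₃) (hψ : ContDiff ℝ 1 ψ) (hψ01 : ∀ y, ψ y ∈ Icc (0 : ℝ) 1) {Z : Set E3} {M : ℝ}
    (hZS : Z ⊆ S) (hZm : MeasurableSet Z) (hZ : (μHE[2] : Measure E3) Z < ⊤)
    (hψZ : ∀ y ∈ S, X y ≠ 0 → y ∉ Z → fderiv ℝ ψ y = 0) (hM : ∀ y, ‖fderiv ℝ ψ y‖ ≤ M)
    (hG : ContDiff ℝ 1 G) (hGe : EqOn G (fun y => X y * ((1 - ψ y) * inner ℝ (N y) η)) S)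
    (hshape : ∀ y ∈ S, ψ y ≠ 1 → ‖shapeOperator S N y‖ ≤ 1) :
    ∫ y, (gradNormSq N G y + G y ^ 2) ∂areaMeasure S ≤
      (2 * (B * A + 1) ^ 2 + 1) * (ℓ ^ 2 / δ₁ + A ^ 2 * (2 * δ₃) * ℓ) +
        2 * M ^ 2 * (μHE[2] : Measure E3).real Z := by
  have hsub : D ∪ V ⊆ S := union_subset h.domain_subset h.collar_subset
  have hDVm : MeasurableSet (D ∪ V) := h.measurableSet_domain.union h.measurableSet_collar
  have hreal : ∀ {W : Set E3}, W ⊆ S → (areaMeasure S).real W = (μHE[2] : Measure E3).real W :=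
    fun hW => congrArg ENNReal.toReal (areaMeasure_apply hS hW)
  set e : E3 → ℝ := fun y => (D ∪ V).indicator (fun _ => 2 * (B * A + 1) ^ 2 + 1) y +
    Z.indicator (fun _ => 2 * M ^ 2) y with he
  have hi1 : Integrable ((D ∪ V).indicator fun _ => 2 * (B * A + 1) ^ 2 + 1) (areaMeasure S) := by
    rw [integrable_indicator_iff hDVm]
    exact integrableOn_const (by rw [areaMeasure_apply hS hsub]; exact (h.measure_union_lt_top hδ₁).ne)
  have hi2 : Integrable (Z.indicator fun _ => 2 * M ^ 2) (areaMeasure S) := by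
    rw [integrable_indicator_iff hZm]
    exact integrableOn_const (by rw [areaMeasure_apply hS hZS]; exact hZ.ne)
  have hle : ∀ y ∈ S, gradNormSq N G y + G y ^ 2 ≤ e y := by
    intro y hy
    have hZ0 : 0 ≤ Z.indicator (fun _ => 2 * M ^ 2) y := indicator_nonneg (fun _ _ => by positivity) y
    by_cases hyD : y ∈ D ∪ V
    · have hX := h.mem_Icc y hy
      have h1 := h.gradNormSq_le hS hN hA hB hψ hψ01 hG hGe hy (hshape y hy)
      have h2 : G y ^ 2 ≤ 1 := by
        rw [sq_le_one_iff_abs_le_one, hGe hy, abs_mul, abs_mul, abs_of_nonneg hX.1,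
          abs_of_nonneg (by linarith [(hψ01 y).2] : 0 ≤ 1 - ψ y)]
        refine mul_le_one₀ hX.2 (by have := (hψ01 y).2; positivity)
          (mul_le_one₀ (by linarith [(hψ01 y).1]) (abs_nonneg _)
            (abs_inner_normal_le hN h.norm_eq_one hy))
      have h3 : (X y * ‖fderiv ℝ ψ y‖) ^ 2 * 2 ≤ Z.indicator (fun _ => 2 * M ^ 2) y := by
        by_cases hyZ : y ∈ Z
        · rw [indicator_of_mem hyZ]
          have h4 : X y * ‖fderiv ℝ ψ y‖ ≤ M :=
            (mul_le_of_le_one_left (norm_nonneg _) hX.2).trans (hM y)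
          have := pow_le_pow_left₀ (mul_nonneg hX.1 (norm_nonneg _)) h4 2
          linarith
        · by_cases hX0 : X y = 0
          · rw [hX0, zero_mul]; simpa using hZ0
          · rw [hψZ y hy hX0 hyZ, norm_zero, mul_zero]; simpa using hZ0
      rw [he]
      simp only [indicator_of_mem hyD]
      nlinarith [sq_nonneg (B * A + 1 - X y * ‖fderiv ℝ ψ y‖)]
    · have h1 := h.gradNormSq_eq_zero hS hN hψ hG hGe hy hyD
      have h2 : G y = 0 := by rw [hGe hy]; simp [h.eq_zero y hy hyD]
      rw [h1, h2, he]
      simpa [indicator_of_notMem hyD] using hZ0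
  calc _ ≤ ∫ y, e y ∂areaMeasure S := by
        refine integral_mono_of_nonneg (Eventually.of_forall fun y =>
          add_nonneg (gradNormSq_nonneg _ _ _) (sq_nonneg _)) (hi1.add hi2) ?_
        exact (ae_restrict_iff' hS.measurableSet).2 (Eventually.of_forall hle)
    _ = (2 * (B * A + 1) ^ 2 + 1) * (μHE[2] : Measure E3).real (D ∪ V) +
        2 * M ^ 2 * (μHE[2] : Measure E3).real Z := by
        rw [he, integral_add hi1 hi2, integral_indicator_const _ hDVm, integral_indicator_const _ hZm,
          hreal hsub, hreal hZS, smul_eq_mul, smul_eq_mul, mul_comm, mul_comm (_ : ℝ) (2 * M ^ 2)]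
    _ ≤ _ := by
        gcongr
        exact h.measureReal_union_le hδ₁ hδ₃

/-- The integral of the mean curvature against the test function. -/
theorem IsFarCutoff.le_integral_meanCurvature (h : IsFarCutoff S N p δ₁ δ₂ δ₃ A B b r D V ℓ η X)
    (hS : IsC2Surface S) (hN : IsUnitNormal S N) (hψ : ContDiff ℝ 1 ψ)
    (hψ01 : ∀ y, ψ y ∈ Icc (0 : ℝ) 1) {Q Z : Set E3} (hQS : Q ⊆ S) (hQ : IsCompact Q)
    (hψQ : ∀ y ∈ S, y ∉ Q → ψ y = 0) (hZQ : Z ⊆ Q)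
    (hψZ : ∀ y ∈ S, X y ≠ 0 → y ∉ Z → ψ y = 0) {M : ℝ} (hM0 : 0 ≤ M)
    (hM : ∀ y ∈ Q, |meanCurvature S N y| ≤ M)
    (hGe : EqOn G (fun y => X y * ((1 - ψ y) * inner ℝ (N y) η)) S) :
    δ₂ / 2 * ℓ - b * (A ^ 2 * (2 * δ₃) * ℓ) - M * (μHE[2] : Measure E3).real Z ≤
      ∫ y, meanCurvature S N y * G y ∂areaMeasure S := by
  obtain ⟨K, hKS, hK, hK0⟩ := h.exists_isCompact
  have hi1 : Integrable (fun y => X y * (meanCurvature S N y * inner ℝ (N y) η)) (areaMeasure S) :=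
    hS.integrable_of_isCompact hK hKS
      (continuousOn_meanCurvature_mul hS hN η h.contDiff.continuous.continuousOn)
      fun y hy hyK => by rw [hK0 y hy hyK, zero_mul]
  have hi2 : Integrable (fun y => (X y * ψ y) * (meanCurvature S N y * inner ℝ (N y) η))
      (areaMeasure S) :=
    hS.integrable_of_isCompact hQ hQS
      (continuousOn_meanCurvature_mul hS hN η
        (h.contDiff.continuous.mul hψ.continuous).continuousOn)
      fun y hy hyQ => by rw [hψQ y hy hyQ, mul_zero, zero_mul]
  have h1 : ∫ y, meanCurvature S N y * G y ∂areaMeasure S =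
      ∫ y, X y * (meanCurvature S N y * inner ℝ (N y) η) ∂areaMeasure S -
        ∫ y, (X y * ψ y) * (meanCurvature S N y * inner ℝ (N y) η) ∂areaMeasure S := by
    rw [← integral_sub hi1 hi2]
    refine setIntegral_congr_fun hS.measurableSet fun y hy => ?_
    rw [hGe hy]
    ring
  have h2 : |∫ y, (X y * ψ y) * (meanCurvature S N y * inner ℝ (N y) η) ∂areaMeasure S| ≤
      M * (μHE[2] : Measure E3).real Z := by
    change |∫ y in S, _ ∂(μHE[2] : Measure E3)| ≤ _
    rw [setIntegral_eq_of_subset_of_forall_sdiff_eq_zero hS.measurableSet (hZQ.trans hQS)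
      fun y hy => by
        by_cases hX0 : X y = 0
        · rw [hX0, zero_mul, zero_mul]
        · rw [hψZ y hy.1 hX0 hy.2, mul_zero, zero_mul], ← Real.norm_eq_abs]
    refine norm_setIntegral_le_of_norm_le_const ((measure_mono hZQ).trans_lt
      (hS.measure_lt_top_of_isCompact hQ hQS)) fun y hy => ?_
    have hyS := hQS (hZQ hy)
    have hX := h.mem_Icc y hyS
    have h0 := hψ01 y
    rw [norm_mul, norm_mul, norm_mul, Real.norm_eq_abs, Real.norm_eq_abs, Real.norm_eq_abs,
      Real.norm_eq_abs, abs_of_nonneg hX.1, abs_of_nonneg h0.1]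
    calc _ ≤ 1 * (M * 1) := mul_le_mul (mul_le_one₀ hX.2 h0.1 h0.2) (mul_le_mul (hM y (hZQ hy))
          (abs_inner_normal_le hN h.norm_eq_one hyS) (abs_nonneg _) hM0) (by positivity) zero_le_one
      _ = M := by ring
  rw [h1]
  linarith [(abs_le.1 h2).2, h.le_integral]

end test

end QuantumLayer

/-! ### The mean curvature condition -/

namespace QuantumLayer

theorem meanCurvatureCondition_of_hasTamedCurvesAtInfinity {S : Set E3} {N : E3 → E3}
    (hS : IsC2Surface S) (hconn : IsConnected S) (hN : IsUnitNormal S N)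
    (hcomplete : IsCompleteSurface S) (hnoncompact : ¬ IsCompact S) (hflat : AsymptoticallyFlat S N)
    (hiso : ∃ δ₁ > 0, IsoperimetricInequality S δ₁) (htamed : HasTamedCurvesAtInfinity S)
    {p : E3} (hp : p ∈ S) : MeanCurvatureCondition S N p := by
  obtain ⟨δ₁, hδ₁, hiso⟩ := hiso
  obtain ⟨δ₂, hδ₂, δ₃, hδ₃, A, hA, hcurves⟩ := htamed
  obtain ⟨φ, hφ⟩ := exists_isProfile (half_pos hδ₃)
  obtain ⟨B, hB0, hB⟩ := hφ.exists_deriv_bound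
  -- a bound for the mean curvature far out, so small that the error terms are absorbed by the flux
  obtain ⟨b, hb0, hb1, hb2, hb3⟩ : ∃ b : ℝ, 0 < b ∧ b * (A ^ 2 * (2 * δ₃)) ≤ δ₂ / 8 ∧
      b ≤ δ₁ * δ₂ / 4 ∧ b ≤ 1 := by
    refine ⟨min (δ₂ / 8 / (A ^ 2 * (2 * δ₃))) (min (δ₁ * δ₂ / 4) 1), by positivity, ?_,
      (min_le_right _ _).trans (min_le_left _ _), (min_le_right _ _).trans (min_le_right _ _)⟩
    rw [← le_div_iff₀ (by positivity)]
    exact min_le_left _ _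
  obtain ⟨K, hKS, hK, hKshape⟩ := hflat (b / 2) (half_pos hb0)
  have hH : ∀ y ∈ S, y ∉ K → |meanCurvature S N y| ≤ b := fun y hy hyK => by
    linarith [hN.abs_meanCurvature_le hy, hKshape y ⟨hy, hyK⟩]
  have hfar : ∀ r : ℝ, 0 ≤ r → K ⊆ intrinsicBall S p r → ∃ D V ℓ η X,
      IsFarCutoff S N p δ₁ δ₂ δ₃ A B b r D V ℓ η X ∧
      (Disjoint (intrinsicBall S p r) D → 1 ≤ ℓ) := by
    intro r hr hKr
    have hHr : ∀ y ∈ S, y ∉ intrinsicBall S p r → |meanCurvature S N y| ≤ b :=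
      fun y hy hyr => hH y hy fun hyK => hyr (hKr hyK)
    obtain ⟨D, V, ℓ, η, X, h⟩ := exists_isFarCutoff hS hconn hN hcomplete hnoncompact hp hiso hδ₂ hδ₃
      hA hcurves hφ (half_pos hδ₃) (half_lt_self hδ₃) hB hr hb0.le hHr
    exact ⟨D, V, ℓ, η, X, h, h.one_le_length_of_disjoint hS hN hδ₁ hδ₂ hδ₃ hb0.le hb1 hb2 hHr⟩
  have harea := tendsto_measure_intrinsicBall (B := B) (b := b) hS hconn hp hδ₁ hδ₃ hA (by
    obtain ⟨r, -, hr⟩ := exists_subset_intrinsic_ball hS hconn hp hK hKS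
    obtain ⟨n₀, hn₀⟩ := exists_nat_ge r
    filter_upwards [eventually_ge_atTop n₀] with n hn
    exact hfar n n.cast_nonneg
      (hr.trans (intrinsicBall_mono p (hn₀.trans (by exact_mod_cast hn)))))
  set E := (2 * (B * A + 1) ^ 2 + 1) * (1 / δ₁ + A ^ 2 * (2 * δ₃)) + 2 with hE
  have hE0 : 0 < E := by positivity
  refine ⟨δ₂ ^ 2 / (32 * E), by positivity, fun R hR => ?_⟩
  -- the test functions vanish near `K` and near the ball of radius `R`
  obtain ⟨ψ, Q, M, hψ, hψ1, hψ01, hQS, hQ, hψQ, hM⟩ := hS.exists_bump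
    ((isCompact_intrinsic_closedBall hS hcomplete hp R).union hK)
    (union_subset (fun _ hx => hx.1) hKS)
  obtain ⟨M', hM'⟩ := hQ.exists_bound_of_continuousOn ((hN.continuousOn_meanCurvature hS).mono hQS)
  have hHQ : ∀ y ∈ Q, |meanCurvature S N y| ≤ max M' 0 := fun y hy =>
    (hM' y hy).trans (le_max_left _ _)
  have hM'0 : 0 ≤ max M' 0 := le_max_right _ _
  set M'' := max M' 0
  have hQfin := hS.measure_lt_top_of_isCompact hQ hQS
  set w := (μHE[2] : Measure E3).real Q with hw
  have hw0 : 0 ≤ w := measureReal_nonneg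
  -- the length which makes the contributions of the cutoff `ψ` negligible
  set Λ := 1 + M'' * w / (δ₂ / 8) + M ^ 2 * w with hΛ
  have hΛ1 : 0 ≤ M'' * w / (δ₂ / 8) := by positivity
  have hΛ2 : 0 ≤ M ^ 2 * w := by positivity
  obtain ⟨r₁, hr₁, hr₁b⟩ := exists_subset_intrinsic_ball hS hconn hp (hQ.union hK)
    (union_subset hQS hKS)
  obtain ⟨n₁, hn₁⟩ := exists_nat_ge r₁
  obtain ⟨n, hn, hnn⟩ := ((harea.eventually (eventually_ge_nhds
    (ENNReal.ofReal_lt_top (r := Λ ^ 2 / δ₁)))).and (eventually_ge_atTop n₁)).exists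
  have hball : Q ∪ K ⊆ intrinsicBall S p n :=
    hr₁b.trans (intrinsicBall_mono p (hn₁.trans (by exact_mod_cast hnn)))
  obtain ⟨D, V, ℓ, η, X, h, hℓd⟩ := hfar n n.cast_nonneg (subset_union_right.trans hball)
  have hℓ := h.length_pos
  have hX0 : ∀ y ∈ S, X y ≠ 0 → y ∉ Q ∩ D → y ∉ Q := fun y hy hXy hyZ hyQ =>
    hXy (h.eq_zero y hy fun hyDV => hyDV.elim (fun hyD => hyZ ⟨hyQ, hyD⟩)
      fun hyV => disjoint_left.1 h.disjoint_collar hyV (hball (Or.inl hyQ)))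
  have hZm : MeasurableSet (Q ∩ D) := hQ.measurableSet.inter h.measurableSet_domain
  obtain ⟨hℓ1, hZ1, hZ2⟩ : 1 ≤ ℓ ∧ M'' * (μHE[2] : Measure E3).real (Q ∩ D) ≤ δ₂ / 8 * ℓ ∧
      M ^ 2 * (μHE[2] : Measure E3).real (Q ∩ D) ≤ ℓ ^ 2 := by
    rcases h.ball_subset_or_disjoint with hd | hd
    · have h1 : Λ ≤ ℓ := by
        have h2 := (mul_le_mul_right hn (ENNReal.ofReal δ₁)).trans (h.mul_measure_ball_le hd)
        rw [← ENNReal.ofReal_mul hδ₁.le, ENNReal.ofReal_le_ofReal_iff (sq_nonneg ℓ),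
          mul_div_cancel₀ _ hδ₁.ne'] at h2
        exact abs_le_of_sq_le_sq' h2 hℓ.le |>.2
      have h3 : (μHE[2] : Measure E3).real (Q ∩ D) ≤ w :=
        measureReal_mono inter_subset_left hQfin.ne
      refine ⟨by linarith, ?_, ?_⟩
      · rw [mul_comm (δ₂ / 8), ← div_le_iff₀ (by positivity)]
        have h4 : M'' * (μHE[2] : Measure E3).real (Q ∩ D) / (δ₂ / 8) ≤ M'' * w / (δ₂ / 8) := by
          gcongr
        linarith
      · have := mul_le_mul_of_nonneg_left h3 (sq_nonneg M)
        nlinarith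
    · have hZ : Q ∩ D = ∅ := disjoint_iff_inter_eq_empty.1
        (hd.mono_left (subset_union_left.trans hball))
      rw [hZ, measureReal_empty, mul_zero, mul_zero]
      exact ⟨hℓd hd, by positivity, sq_nonneg ℓ⟩
  obtain ⟨KX, hKXS, hKX, hKX0⟩ := h.exists_isCompact
  have hψ1' : ∀ y ∈ {x | x ∈ S ∧ intrinsicDist S p x ≤ ENNReal.ofReal R} ∪ K, {z | ψ z = 1} ∈ 𝓝 y :=
    fun y hy => (eventually_nhdsSet_iff_forall.1 hψ1) y hy
  refine exists_isTestFunctionOutside (g := fun y => X y * ((1 - ψ y) * inner ℝ (N y) η))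
    hS hN hcomplete hp (h.contDiff.isC1On.mul ((contDiff_const.sub hψ).isC1On.mul ((hN.isC1On hS).inner_const η)))
    (hKX.diff (isOpen_interior (s := {z | ψ z = 1}))) (sdiff_subset.trans hKXS)
    (fun y hy => ?_) (fun y hy hyn => ?_) fun G hG hGe => ?_
  · by_contra hle
    exact hy.2 (mem_interior_iff_mem_nhds.2 (hψ1' y (Or.inl ⟨hKXS hy.1, not_lt.1 hle⟩)))
  · by_cases hyK : y ∈ KX
    · have hy1 : y ∈ interior {z | ψ z = 1} := by_contra fun hyi => hyn ⟨hyK, hyi⟩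
      have hy2 : y ∈ {z | ψ z = 1} := interior_subset hy1
      have hy2 : ψ y = 1 := hy2
      simp [hy2]
    · rw [hKX0 y hy hyK, zero_mul]
  · have hshape : ∀ y ∈ S, ψ y ≠ 1 → ‖shapeOperator S N y‖ ≤ 1 := fun y hy hy1 => by
      have hyK : y ∉ K := fun hyK =>
        hy1 (show y ∈ {z | ψ z = 1} from mem_of_mem_nhds (hψ1' y (Or.inr hyK)))
      linarith [hKshape y ⟨hy, hyK⟩]
    have h1 := h.integral_energy_le hS hN hA.le hB0.le hδ₁ hδ₃ hψ hψ01
      (inter_subset_left.trans hQS) hZm ((measure_mono inter_subset_left).trans_lt hQfin)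
      (fun y hy hXy hyZ => (hψQ y hy (hX0 y hy hXy hyZ)).2) hM hG hGe hshape
    have h2 := h.le_integral_meanCurvature hS hN hψ hψ01 hQS hQ (fun y hy hyQ => (hψQ y hy hyQ).1)
      inter_subset_left (fun y hy hXy hyZ => (hψQ y hy (hX0 y hy hXy hyZ)).1) hM'0 hHQ hGe
    have h3 : δ₂ / 4 * ℓ ≤ ∫ y, meanCurvature S N y * G y ∂areaMeasure S := by
      have := mul_le_mul_of_nonneg_right hb1 hℓ.le
      linarith
    have h4 : ∫ y, (gradNormSq N G y + G y ^ 2) ∂areaMeasure S ≤ E * ℓ ^ 2 := by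
      have h5 : ℓ ^ 2 / δ₁ + A ^ 2 * (2 * δ₃) * ℓ ≤ (1 / δ₁ + A ^ 2 * (2 * δ₃)) * ℓ ^ 2 := by
        have h6 : ℓ ≤ ℓ ^ 2 := by nlinarith
        have := mul_le_mul_of_nonneg_left h6 (by positivity : 0 ≤ A ^ 2 * (2 * δ₃))
        rw [add_mul, one_div, inv_mul_eq_div]
        linarith
      have h7 := mul_le_mul_of_nonneg_left h5 (by positivity : 0 ≤ 2 * (B * A + 1) ^ 2 + 1)
      rw [hE, add_mul, mul_assoc]
      linarith
    calc _ ≤ δ₂ ^ 2 / (32 * E) * (E * ℓ ^ 2) := by gcongr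
      _ = (δ₂ * ℓ) ^ 2 / 32 := by field_simp
      _ < (δ₂ / 4 * ℓ) ^ 2 := by
        have : 0 < (δ₂ * ℓ) ^ 2 := by positivity
        linarith [show (δ₂ / 4 * ℓ) ^ 2 = (δ₂ * ℓ) ^ 2 / 16 by ring]
      _ ≤ _ := by gcongr

end QuantumLayer

theorem mainTheorem6 (S : Set QuantumLayer.E3) (N : QuantumLayer.E3 → QuantumLayer.E3)
    (hS : QuantumLayer.IsC2Surface S) (hconn : IsConnected S)
    (hN : QuantumLayer.IsUnitNormal S N)
    (hcomplete : QuantumLayer.IsCompleteSurface S) (hnoncompact : ¬ IsCompact S)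
    (hnotgeodesic : ∃ x ∈ S, QuantumLayer.shapeOperator S N x ≠ 0)
    (hflat : QuantumLayer.AsymptoticallyFlat S N)
    (hiso : ∃ δ₁ > 0, QuantumLayer.IsoperimetricInequality S δ₁)
    (htamed : QuantumLayer.HasTamedCurvesAtInfinity S)
    (hκ : MeasureTheory.Integrable (QuantumLayer.gaussCurvature S N)
      (QuantumLayer.areaMeasure S))
    (p : QuantumLayer.E3) (hp : p ∈ S) :
    QuantumLayer.MeanCurvatureCondition S N p :=
  QuantumLayer.meanCurvatureCondition_of_hasTamedCurvesAtInfinity hS hconn hN hcomplete hnoncompact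
    hflat hiso htamed hp
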